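/- **Setting.** Let $M_1(\mathbb Z)$ be the space of probability measures on $\mathbb Z$ with the topology of weak convergence, and $\Omega=M_1(\mathbb Z)^{\mathbb Z\times\mathbb N}$ ($\mathbb N=\{1,2,\dots\}$), with the product topology, the space of cookie environments $\omega=(\omega_{x,j})_{x\in\mathbb Z,\,j\ge1}$; write $\omega_x=(\omega_{x,j})_{j\ge1}$. For $\omega\in\Omega$ and $x\in\mathbb Z$, the excited random walk $(X_n)_{n\ge0}$ in $\omega$ started at $x$ has law $P^x_\omega$ given by $P_\omega^x(X_0=x)=1$ and $$P_\omega^x(X_{n+1}=X_n+z\mid X_0,\dots,X_n)=\omega_{X_n,L_n(X_n)}(z),\qquad L_n(y)=\#\{k\in\{0,\dots,n\}:X_k=y\}.$$ For a probability measure $\alpha$ on $\Omega\times\mathbb Z$ let $\mathbb P_\alpha(\cdot)=\int P_\omega^x(\cdot)\,\alpha(d\omega,dx)$; for a probability measure $\eta$ on $\Omega$ let $\mathbb P_\eta(\cdot)=\int P^0_\omega(\cdot)\,\eta(d\omega)$. Put $$\mathcal R=\Big\{\sum_{n\ge0}\mathbf 1_{\{X_n=x\}}=\infty\ \ \forall x\in\mathbb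 Z\Big\},\qquad \mathcal T_+=\Big\{\lim_{n\to\infty}X_n=+\infty\Big\}.$$ **Assumptions.** There are $M\ge1$ and $\mu\in M_1(\mathbb Z)$ with mean $0$, $\mu\ne\delta_0$, such that: 1. under $\eta$ the sequence $(\omega_x)_{x\in\mathbb Z}$ is stationary and ergodic, and $\eta$-a.s., for all $x$, each $\omega_{x,j}$ with $j\le M$ has a finite nonnegative mean and $\omega_{x,j}=\mu$ for all $j>M$; 2. $\mu([-B,B])=1$ for some $B<\infty$, and the support of $\mu$ generates the group $\mathbb Z$; 3. $E_\eta\big[\sum_{j=1}^M\sum_{z}|z|\,\omega_{0,j}(z)\big]<\infty$; 4. $(\omega_x)_{x\in\mathbb Z}$ is i.i.d. under $\eta$; 5. $\eta(\omega_{0,1}([1,\infty))>0)=1$ and $E_\eta\big[\prod_{j=1}^M\sum_{z\le0}\omega_{0,j}(z)\big]>0$. **The cookie environment process.** Let $\tau_k=\inf\{n\ge0:X_n\ge k\}$, let $\theta$ be the shift $(\theta\omega)_{x,j}=\omega_{x+1,j}$, and let $\bar\omega(n)_{x,j}=\omega_{x,\,\ell_n(x)+j}$ with $\ell_n(x)=\#\{k<n:X_k=x\}$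 be the environment of cookies left just before the jump made at time $n$. On $$\Psi=\{(\omega,x)\in\Omega\times\mathbb Z_{\ge0}:P^x_\omega(\limsup_n X_n=\infty)=1\}$$ consider the Markov chain $\zeta_k=(\theta^k\bar\omega(\tau_k),\,X_{\tau_k}-k)$, $k\ge0$, and let $\mu_n=\frac1n\sum_{k=1}^n\mathbb P_\eta(\zeta_k\in\cdot)$. **Proposition 5.1.** Under these assumptions, $$\mathbb P_\eta(\mathcal T_+)=1-\mathbb P_\eta(\mathcal R)\in\{0,1\}.$$ Moreover, the sequence $(\mu_n)$ has at least one subsequential weak limit $\pi$ that is a probability measure on $\Psi$, and every such $\pi$ is a stationary distribution of the chain $(\zeta_k)$ and satisfies $$\mathbb P_\pi(\mathcal T_+)=1-\mathbb P_\pi(\mathcal R)\in\{0,1\}.$$ -/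

import Mathlib

open MeasureTheory ProbabilityTheory Filter Topology Set
open scoped ENNReal BoundedContinuousFunction

noncomputable section

namespace ExcitedWalk

/-- `M₁(ℤ)`: probability distributions on `ℤ`, with the topology of weak convergence and the
σ-algebra generated by the evaluations (which is its Borel σ-algebra). -/
abbrev M1 : Type := ProbabilityMeasure ℤ

/-- Cookie environments `ω = (ω_{x,j})`, with the product topology and product σ-algebra. Cookies at
a site are numbered from `0`: `ω x j` is the step distribution on the `(j+1)`-st visit to `x`. -/
abbrev Env : Type := ℤ → ℕ → M1

/-- Trajectories of the walk. -/
abbrev Path : Type := ℕ → ℤ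

/-! ### The walk in a fixed environment -/

/-- For a history `h = (X₀, …, X_n)`: the number of visits to the present site `X_n` strictly
before time `n`. -/
def priorVisits {n : ℕ} (h : (i : Finset.Iic n) → ℤ) : ℕ :=
  (Finset.univ.filter fun k : Finset.Iic n =>
    (k : ℕ) < n ∧ h k = h ⟨n, Finset.mem_Iic.2 le_rfl⟩).card

/-- The conditional law of `X_{n+1}` given the history `(X₀, …, X_n)`: the walk jumps by `z` with
probability `ω_{X_n, j}(z)`, where `j` is the cookie belonging to the present visit to `X_n`. -/
def stepKernel (ω : Env) (n : ℕ) : Kernel ((i : Finset.Iic n) → ℤ) ℤ :=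
  Kernel.ofFunOfCountable fun h =>
    (ω (h ⟨n, Finset.mem_Iic.2 le_rfl⟩) (priorVisits h) : Measure ℤ).map
      (fun z => h ⟨n, Finset.mem_Iic.2 le_rfl⟩ + z)

instance (ω : Env) (n : ℕ) : IsMarkovKernel (stepKernel ω n) := by
  refine ⟨fun h => ?_⟩
  exact Measure.isProbabilityMeasure_map (measurable_of_countable _).aemeasurable

/-- The quenched law `P_ω^x` of the excited random walk in the environment `ω` started at `x`: the
law on trajectories with `X₀ = x` and the transition probabilities `stepKernel`. -/
def quenched (ω : Env) (x : ℤ) : Measure Path :=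
  Kernel.trajMeasure (X := fun _ => ℤ) (Measure.dirac x) (stepKernel ω)

instance (ω : Env) (x : ℤ) : IsProbabilityMeasure (quenched ω x) := by
  unfold quenched; infer_instance

/-- The defining one-step transition property: a history `h` up to time `n+1` has the probability of
its restriction to times `≤ n` multiplied by the transition probability of the last step. -/
lemma quenched_path_succ (ω : Env) (x : ℤ) (n : ℕ) (h : (i : Finset.Iic (n + 1)) → ℤ) :
    (quenched ω x).map (Preorder.frestrictLe (π := fun _ => ℤ) (n + 1)) {h} =
      stepKernel ω n (Preorder.frestrictLe₂ (π := fun _ => ℤ) n.le_succ h)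
          {h ⟨n + 1, Finset.mem_Iic.2 le_rfl⟩} *
        (quenched ω x).map (Preorder.frestrictLe (π := fun _ => ℤ) n)
          {Preorder.frestrictLe₂ (π := fun _ => ℤ) n.le_succ h} := by
  have key := Kernel.map_frestrictLe_trajMeasure_compProd_eq_map_trajMeasure
    (X := fun _ => ℤ) (μ₀ := Measure.dirac x) (κ := stepKernel ω) (a := n)
  have e := congrArg (fun m => m ({(Preorder.frestrictLe₂ (π := fun _ => ℤ) n.le_succ h)} ×ˢ
    {h ⟨n + 1, Finset.mem_Iic.2 le_rfl⟩})) key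
  rw [Measure.compProd_apply_prod (measurableSet_singleton _) (measurableSet_singleton _),
    lintegral_singleton, Measure.map_apply (by fun_prop)
      ((measurableSet_singleton _).prod (measurableSet_singleton _))] at e
  unfold quenched
  rw [e, Measure.map_apply (by fun_prop) (measurableSet_singleton _)]
  congr 1
  ext X
  simp only [mem_preimage, mem_singleton_iff, mem_prod]
  constructor
  · rintro rfl
    exact ⟨rfl, rfl⟩
  · rintro ⟨h1, h2⟩
    funext ⟨i, hi⟩
    rcases Nat.lt_or_ge n i with hlt | hle
    · have : i = n + 1 := le_antisymm (Finset.mem_Iic.1 hi) hlt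
      subst this
      exact h2
    · exact congrFun h1 ⟨i, Finset.mem_Iic.2 hle⟩

/-- Probabilities of finite paths depend measurably on the environment and the starting point. -/
lemma measurable_quenched_path (n : ℕ) (h : (i : Finset.Iic n) → ℤ) :
    Measurable fun p : Env × ℤ =>
      (quenched p.1 p.2).map (Preorder.frestrictLe (π := fun _ => ℤ) n) {h} := by
  induction n with
  | zero =>
    have : ∀ p q : Env × ℤ, p.2 = q.2 →
        (quenched p.1 p.2).map (Preorder.frestrictLe (π := fun _ => ℤ) 0) {h} =
        (quenched q.1 q.2).map (Preorder.frestrictLe (π := fun _ => ℤ) 0) {h} := by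
      intro p q hpq
      unfold quenched Kernel.trajMeasure
      rw [Measure.map_comp _ _ (by fun_prop), Measure.map_comp _ _ (by fun_prop),
        Kernel.traj_map_frestrictLe, Kernel.traj_map_frestrictLe, Kernel.partialTraj_self,
        Kernel.partialTraj_self, hpq]
    have e : (fun p : Env × ℤ =>
        (quenched p.1 p.2).map (Preorder.frestrictLe (π := fun _ => ℤ) 0) {h}) =
        (fun x : ℤ => (quenched (fun _ _ => ⟨Measure.dirac 0, inferInstance⟩) x).map
          (Preorder.frestrictLe (π := fun _ => ℤ) 0) {h}) ∘ Prod.snd := by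
      funext p
      exact this p (_, p.2) rfl
    rw [e]
    exact (measurable_of_countable _).comp measurable_snd
  | succ n ih =>
    simp_rw [quenched_path_succ]
    refine Measurable.mul ?_ (ih _)
    simp only [stepKernel, Kernel.ofFunOfCountable, Kernel.coe_mk]
    simp_rw [Measure.map_apply (measurable_of_countable _) (measurableSet_singleton _)]
    refine (Measure.measurable_coe (MeasurableSet.of_discrete)).comp ?_
    refine measurable_subtype_coe.comp ?_
    exact (measurable_pi_apply _).comp ((measurable_pi_apply _).comp measurable_fst)

/-- The quenched law depends measurably on the environment and the starting point. -/
lemma measurable_quenched : Measurable fun p : Env × ℤ => quenched p.1 p.2 := by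
  refine Measurable.measure_of_isPiSystem_of_isProbabilityMeasure
    (generateFrom_measurableCylinders (α := fun _ : ℕ => ℤ)).symm
    isPiSystem_measurableCylinders ?_
  intro t ht
  obtain ⟨N, S, mS, rfl⟩ : ∃ N S, MeasurableSet S ∧ t = cylinder (Finset.Iic N) S := by
    simpa [measurableCylinders_nat] using ht
  have e : ∀ p : Env × ℤ, quenched p.1 p.2 (cylinder (Finset.Iic N) S) =
      ∑' h : S, (quenched p.1 p.2).map (Preorder.frestrictLe (π := fun _ => ℤ) N) {h.1} := by
    intro p
    rw [← measure_iUnion (fun a b hab => by simpa [Subtype.ext_iff] using hab)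
      (fun a => measurableSet_singleton _), iUnion_of_singleton_coe,
      Measure.map_apply (by fun_prop) mS]
    rfl
  simp_rw [e]
  exact Measurable.tsum fun h => measurable_quenched_path N h.1

/-- The quenched laws as a Markov kernel from (environment, starting point) to trajectories. -/
def walkKernel : Kernel (Env × ℤ) Path where
  toFun p := quenched p.1 p.2
  measurable' := measurable_quenched

instance : IsMarkovKernel walkKernel :=
  ⟨fun p => inferInstanceAs (IsProbabilityMeasure (quenched p.1 p.2))⟩

/-- The averaged law `ℙ_α = E_α[P_ω^{X₀}(·)]` when `(ω, X₀)` has law `α`. -/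
def averaged (α : Measure (Env × ℤ)) : Measure Path := α.bind walkKernel

/-- The law of `(ω, X₀)` when `ω` has law `η` and `X₀ = 0`; thus `ℙ_η` is
`averaged (fromZero η)`. -/
def fromZero (η : Measure Env) : Measure (Env × ℤ) := η.prod (Measure.dirac 0)

/-! ### Events -/

/-- Recurrence `ℛ`: every site is visited infinitely often. -/
def recurrent : Set Path := {X | ∀ x : ℤ, {n | X n = x}.Infinite}

/-- Transience to the right `𝒯₊`. -/
def transientRight : Set Path := {X | Tendsto X atTop atTop}

/-- `limsup X_n = +∞`. -/
def limsupTop : Set Path := {X | ∀ m : ℤ, ∃ᶠ n in atTop, m ≤ X n}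

/-! ### The cookie environment process -/

/-- The left shift `θ`. -/
def shift (ω : Env) : Env := fun x j => ω (x + 1) j

/-- The environment `ω` with the first `ℓ(x)` cookies removed at every site `x`. -/
def removeCookies (ω : Env) (ℓ : ℤ → ℕ) : Env := fun x j => ω x (ℓ x + j)

/-- The number of visits of `X` to `y` at times `0, …, n-1`. -/
def visitsBefore (X : Path) (n : ℕ) (y : ℤ) : ℕ :=
  ((Finset.range n).filter fun k => X k = y).card

/-- `ω̄(n)`: the cookies that remain just before the jump made at time `n`. -/
def remaining (ω : Env) (X : Path) (n : ℕ) : Env := removeCookies ω (visitsBefore X n)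

/-- The first time `τ_k` at which the walk is in `[k, ∞)` (with value `0` if there is none, which is
a null event under all the laws for which it is used). -/
def hitAbove (X : Path) (k : ℤ) : ℕ := sInf {n | k ≤ X n}

/-- The cookie environment process `ζ_k = (θ^k ω̄(τ_k), X_{τ_k} - k)`. -/
def zeta (k : ℕ) (q : (Env × ℤ) × Path) : Env × ℤ :=
  (shift^[k] (remaining q.1.1 q.2 (hitAbove q.2 k)), q.2 (hitAbove q.2 k) - k)

/-- The law of `ζ_k` under `ℙ_α`. -/
def zetaLaw (α : Measure (Env × ℤ)) (k : ℕ) : Measure (Env × ℤ) :=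
  (α ⊗ₘ walkKernel).map (zeta k)

/-- The state space `Ψ` of the cookie environment process. -/
def stateSpace : Set (Env × ℤ) := {p | 0 ≤ p.2 ∧ quenched p.1 p.2 limsupTop = 1}

/-- `π` is a stationary probability measure on `Ψ` for the Markov chain `ζ`: if `(ω, X₀)` has law
`π`, then so has `ζ₁`. -/
structure IsStationaryLaw (π : Measure (Env × ℤ)) : Prop where
  prob : IsProbabilityMeasure π
  mem_stateSpace : ∀ᵐ p ∂π, p ∈ stateSpace
  invariant : zetaLaw π 1 = π

/-- The Cesàro averages `μ_n = n⁻¹ ∑_{k=1}^n ℙ_η(ζ_k ∈ ·)`. -/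
def cesaro (η : Measure Env) (n : ℕ) : Measure (Env × ℤ) :=
  (n : ℝ≥0∞)⁻¹ • ∑ k ∈ Finset.Icc 1 n, zetaLaw (fromZero η) k

/-- `π` is a probability measure on `Ψ` which is the weak limit of `μ_n` along a subsequence. (All
the measures are carried by `Ψ`, and `Ψ` has the subspace topology, so that weak convergence on `Ψ`
and on the ambient space are the same.) -/
structure IsCesaroLimit (η : Measure Env) (π : Measure (Env × ℤ)) : Prop where
  prob : IsProbabilityMeasure π
  mem_stateSpace : ∀ᵐ p ∂π, p ∈ stateSpace
  weak_limit : ∃ φ : ℕ → ℕ, StrictMono φ ∧ ∀ f : (Env × ℤ) →ᵇ ℝ,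
    Tendsto (fun m => ∫ p, f p ∂(cesaro η (φ m))) atTop (𝓝 (∫ p, f p ∂π))

/-! ### Assumptions on the law of the environment -/

/-- The mean `d(ν)`; meaningful if the identity is integrable. -/
def drift (ν : M1) : ℝ := ∫ z : ℤ, (z : ℝ) ∂(ν : Measure ℤ)

/-- `ℳ₊`: distributions with finite nonnegative mean. -/
def meanNonneg : Set M1 :=
  {ν | Integrable (fun z : ℤ => (z : ℝ)) (ν : Measure ℤ) ∧ 0 ≤ drift ν}

/-- `ℳ₀`: distributions with mean zero. -/
def meanZero : Set M1 :=
  {ν | Integrable (fun z : ℤ => (z : ℝ)) (ν : Measure ℤ) ∧ drift ν = 0}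

/-- `Ω⁺_{M,μ}`: the first `M` cookies at each site are in `ℳ₊`, all others equal `μ`. -/
def envSet (M : ℕ) (μ : M1) : Set Env :=
  {ω | ∀ x : ℤ, (∀ j < M, ω x j ∈ meanNonneg) ∧ ∀ j, M ≤ j → ω x j = μ}

/-- The standing assumptions on the law `η` of the environment, with `M` cookies per site and the
distribution `μ` used when no cookies are left. -/
structure Assumptions (η : Measure Env) (M : ℕ) (μ : M1) : Prop where
  one_le : 1 ≤ M
  mean_zero : μ ∈ meanZero
  ne_dirac : (μ : Measure ℤ) ≠ Measure.dirac 0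
  /-- `η` is stationary and ergodic. -/
  ergodic : Ergodic shift η
  mem_envSet : ∀ᵐ ω ∂η, ω ∈ envSet M μ
  /-- `μ` has bounded support. -/
  bounded : ∃ B : ℕ, (μ : Measure ℤ) (Icc (-(B : ℤ)) B) = 1
  /-- The support of `μ` generates `ℤ`. -/
  span : AddSubgroup.closure {z : ℤ | 0 < (μ : Measure ℤ) {z}} = ⊤
  /-- The cookies at a site have finite expected total absolute first moment. -/
  moment : ∫⁻ ω, ∑ j ∈ Finset.range M, ∫⁻ z : ℤ, ‖(z : ℝ)‖ₑ ∂(ω 0 j : Measure ℤ) ∂η < ∞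
  /-- The cookie stacks at different sites are independent. -/
  indep : iIndepFun (fun (x : ℤ) (ω : Env) => ω x) η
  /-- The cookie stacks at different sites have the same law. -/
  ident : ∀ x : ℤ, IdentDistrib (fun ω : Env => ω x) (fun ω : Env => ω 0) η η
  /-- Weak ellipticity: the first cookie always allows a jump to the right. -/
  right_jump : ∀ᵐ ω ∂η, 0 < (ω 0 0 : Measure ℤ) (Ici 1)
  /-- Weak ellipticity: with positive probability all `M` cookies allow nonpositive jumps. -/
  left_jump : 0 < ∫⁻ ω, ∏ j ∈ Finset.range M, (ω 0 j : Measure ℤ) (Iic 0) ∂η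

end ExcitedWalk

end

open ExcitedWalk

/-!
# The zero-one law and the cookie environment process of excited random walks

The argument rests on one class of initial laws of (environment, starting point), `Admissible`: the
walk starts in `[0, ∞)`, the cookie stacks in `[0, ∞)` are independent of everything else and
distributed as under `η`, and every stack arises from one under `η` by removal of at most `M`
cookies, in the form of a domination of measures. The law of `(ω, 0)` under `η`, the laws of the
cookie environment process (`admissible_zetaLaw`), and the weak limits of their Cesàro averages
(`IsWeakLimit.admissible`) all belong to it, so that the zero-one law has to be proved only once,
for admissible laws (`Admissible.zero_one`).

*Recurrence or transience.* A cookie is used at most once, so that expectations of sums over the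
jumps are bounded by sums over cookies (`lintegral_jumps_le`). Optional stopping and the nonnegative
drift of the cookies then show that the walk is unbounded from above
(`Admissible.averaged_bounded`). As `μ` has mean zero and its support generates `ℤ`, a walk that
visits one site infinitely often visits all sites infinitely often, by a conditional Borel–Cantelli
argument (`ae_recurrent_of_visitedIO`). A walk without such a site leaves every bounded interval,
and makes only finitely many jumps from the far left to the right, by the moment assumption, so that
it tends to `+∞` (`Admissible.ae_recurrent_or_transientRight`).

*The zero-one law.* Whenever the walk enters a half-line `[y, ∞)` at `y`, it meets fresh stacks, so
that it makes an independent trial. An approximation argument shows that trials succeed also given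
an event of positive probability (`Admissible.exists_trial`). If the walk in an environment with law
`η` can stay in `[0, ∞)` with positive probability, then some trial leads to transience even given
recurrence, so that recurrence is a null event. If it cannot, suppose that transience had positive
probability. Given transience, some trial succeeds in which the walk eats up all cookies of a large
window before it leaves the window to the right; this is possible since all cookies allow
nonpositive jumps with positive probability (`eatUp_pos`). As the window is hardly ever jumped over
later, the walk afterwards sees an environment without cookies to the left and tends to `+∞`. When
its excursions to the left are replaced by bounded paths of `μ`-jumps, one gets a walk that stays
above some `-N` (`confined_pos_of_upcrossing`), and hence, if it has eaten up the cookies of a window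
of width `N` before, a walk that stays in `[0, ∞)`, which is a contradiction
(`Admissible.averaged_transientRight_eq_zero`).

*Limits.* The Cesàro averages are tight: the environments by domination, and the overshoots by the
bound `excess` on long jumps (`exists_isCompact_cesaro`). The expectation of `f (ζ₁)` for bounded
continuous `f ≥ 0` is a sum over finite histories of continuous functions of the initial state
(`historyTerm`), and hence lower semicontinuous. Together with the Markov property
(`Admissible.zetaLaw_succ`) this gives `zetaLaw π 1 ≤ π` on such functions for every weak limit `π`,
and thus stationarity (`IsWeakLimit.zetaLaw_eq`).
-/

noncomputable section

namespace ExcitedWalk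

/-! ### The topology of `M₁(ℤ)` -/

lemma continuous_eval_M1 (s : Set ℤ) : Continuous fun ν : M1 => ν s := by
  rw [continuous_iff_continuousAt]
  intro ν
  refine ProbabilityMeasure.tendsto_measure_of_isClopen_of_tendsto tendsto_id ?_
  exact ⟨isClosed_discrete s, isOpen_discrete s⟩

/-- On `ℤ`, weak convergence is pointwise convergence of the weights. -/
lemma isInducing_eval : IsInducing fun (ν : M1) (z : ℤ) => ν {z} := by
  have hc : Continuous fun (ν : M1) (z : ℤ) => ν {z} :=
    continuous_pi fun z => continuous_eval_M1 {z}
  rw [isInducing_iff_nhds]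
  intro ν
  refine le_antisymm hc.continuousAt.le_comap ?_
  -- By the portmanteau theorem it suffices that `κ ↦ κ G` is lower semicontinuous, and `κ G` is a
  -- supremum of finite sums of weights.
  have hL : Tendsto (fun κ : M1 => κ)
      (comap (fun (κ : M1) (z : ℤ) => κ {z}) (𝓝 fun z => ν {z})) (𝓝 ν) := by
    refine tendsto_of_forall_isOpen_le_liminf' fun G _ => ?_
    have hsum : ∀ κ : M1, (κ : Measure ℤ) G = ∑' z : G, (κ : Measure ℤ) {z.1} := by
      intro κ
      rw [← measure_iUnion (fun a b hab => by simpa [Subtype.ext_iff] using hab)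
        (fun a => measurableSet_singleton _), iUnion_of_singleton_coe]
    rw [hsum ν, ENNReal.tsum_eq_iSup_sum]
    refine iSup_le fun F => ?_
    have hlim : Tendsto (fun κ : M1 => ∑ z ∈ F, (κ : Measure ℤ) {z.1})
        (comap (fun (κ : M1) (z : ℤ) => κ {z}) (𝓝 fun z => ν {z}))
        (𝓝 (∑ z ∈ F, (ν : Measure ℤ) {z.1})) := by
      refine tendsto_finsetSum F fun z _ => ?_
      have h1 : Tendsto (fun κ : M1 => κ {z.1})
          (comap (fun (κ : M1) (z : ℤ) => κ {z}) (𝓝 fun z => ν {z})) (𝓝 (ν {z.1})) :=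
        ((continuous_apply (A := fun _ : ℤ => NNReal) z.1).tendsto
          (fun z => ν {z})).comp tendsto_comap
      simpa [ProbabilityMeasure.ennreal_coeFn_eq_coeFn_toMeasure] using
        (ENNReal.tendsto_coe.2 h1)
    rcases eq_or_neBot (comap (fun (κ : M1) (z : ℤ) => κ {z}) (𝓝 fun z => ν {z})) with hb | hb
    · rw [hb]; simp
    · rw [← hlim.liminf_eq]
      refine liminf_le_liminf (Eventually.of_forall fun κ => ?_)
      rw [hsum κ]
      exact ENNReal.sum_le_tsum F
  exact hL

instance : SecondCountableTopology M1 := isInducing_eval.secondCountableTopology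

/-- The σ-algebra generated by the evaluations is the Borel σ-algebra of the weak topology. -/
instance : BorelSpace M1 := by
  constructor
  apply le_antisymm
  · have h : ∀ s : Set ℤ, @Measurable M1 ℝ≥0∞ (borel M1) _ fun ν => (ν : Measure ℤ) s := by
      intro s
      borelize M1
      have := (ENNReal.continuous_coe.comp (continuous_eval_M1 s)).measurable
      simpa [Function.comp_def, ProbabilityMeasure.ennreal_coeFn_eq_coeFn_toMeasure] using this
    have h2 : @Measurable M1 (Measure ℤ) (borel M1) _ Subtype.val :=
      @Measure.measurable_of_measurable_coe _ _ _ (borel M1) _ fun s _ => h s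
    intro s hs
    obtain ⟨t, ht, rfl⟩ := hs
    exact h2 ht
  · have h : Measurable fun (ν : M1) (z : ℤ) => ν {z} :=
      measurable_pi_lambda _ fun z => ((Measure.measurable_coe (measurableSet_singleton z)).comp
          measurable_subtype_coe).ennreal_toNNReal
    rw [isInducing_eval.eq_induced, borel_comap, ← BorelSpace.measurable_eq (α := ℤ → NNReal)]
    exact h.comap_le

/-! ### Path weights and the Markov property -/

/-- The environment `ω` with one cookie removed at `x`. -/
def eat (ω : Env) (x : ℤ) : Env := removeCookies ω (Pi.single x 1)

/-- The trajectory that follows `X` before time `n` and `Y` from then on. -/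
def glue (n : ℕ) (X Y : Path) : Path := fun i => if i < n then X i else Y (i - n)

/-- The trajectory `x, Y 0, Y 1, …`. -/
def cons (x : ℤ) (Y : Path) : Path := fun i => Nat.casesOn i x Y

@[simp] lemma cons_zero (x : ℤ) (Y : Path) : cons x Y 0 = x := rfl
@[simp] lemma cons_succ (x : ℤ) (Y : Path) (n : ℕ) : cons x Y (n + 1) = Y n := rfl

@[simp] lemma glue_zero (X Y : Path) : glue 0 X Y = Y := by
  funext i; simp [glue]

lemma glue_of_lt {n i : ℕ} (h : i < n) (X Y : Path) : glue n X Y i = X i := by simp [glue, h]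

lemma glue_add (n i : ℕ) (X Y : Path) : glue n X Y (n + i) = Y i := by simp [glue]

lemma glue_succ_cons (n : ℕ) (x : ℤ) (X Y : Path) :
    glue (n + 1) (cons x X) Y = cons x (glue n X Y) := by
  funext i
  cases i with
  | zero => simp [glue]
  | succ i => simp [glue]

@[simp] lemma visitsBefore_zero (X : Path) (y : ℤ) : visitsBefore X 0 y = 0 := by
  simp [visitsBefore]

lemma visitsBefore_succ (X : Path) (n : ℕ) (y : ℤ) :
    visitsBefore X (n + 1) y = visitsBefore X n y + if X n = y then 1 else 0 := by
  unfold visitsBefore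
  rw [Finset.range_add_one, Finset.filter_insert]
  split_ifs with h
  · rw [Finset.card_insert_of_notMem (by simp)]
  · rfl

lemma visitsBefore_cons_succ (x : ℤ) (X : Path) (n : ℕ) (y : ℤ) :
    visitsBefore (cons x X) (n + 1) y = (if x = y then 1 else 0) + visitsBefore X n y := by
  induction n with
  | zero =>
    rw [visitsBefore_succ, visitsBefore_zero, visitsBefore_zero, zero_add, add_zero]
    rfl
  | succ n ih => rw [visitsBefore_succ, ih, visitsBefore_succ, cons_succ, add_assoc]

lemma visitsBefore_congr {X X' : Path} {n : ℕ} (h : ∀ i < n, X i = X' i) (y : ℤ) :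
    visitsBefore X n y = visitsBefore X' n y := by
  unfold visitsBefore
  congr 1
  refine Finset.filter_congr fun i hi => ?_
  rw [h i (Finset.mem_range.1 hi)]

lemma visitsBefore_glue (X Z : Path) (n m : ℕ) (y : ℤ) :
    visitsBefore (glue n X Z) (n + m) y = visitsBefore X n y + visitsBefore Z m y := by
  induction m with
  | zero => simpa using visitsBefore_congr (fun i hi => glue_of_lt hi X Z) y
  | succ m ih => rw [← add_assoc, visitsBefore_succ, ih, visitsBefore_succ, glue_add, add_assoc]

@[simp] lemma remaining_zero (ω : Env) (X : Path) : remaining ω X 0 = ω := by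
  funext y j; simp [remaining, removeCookies]

lemma eat_apply (ω : Env) (x y : ℤ) (j : ℕ) :
    eat ω x y j = ω y ((if x = y then 1 else 0) + j) := by
  simp only [eat, removeCookies, Pi.single_apply, eq_comm (a := x)]

lemma eat_self (ω : Env) (x : ℤ) (j : ℕ) : eat ω x x j = ω x (j + 1) := by
  rw [eat_apply, if_pos rfl, add_comm]

lemma eat_of_ne (ω : Env) {x y : ℤ} (h : x ≠ y) : eat ω x y = ω y := by
  funext j; rw [eat_apply, if_neg h, zero_add]

lemma remaining_cons (ω : Env) (x : ℤ) (X : Path) (n : ℕ) :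
    remaining ω (cons x X) (n + 1) = remaining (eat ω x) X n := by
  funext y j
  simp only [remaining, removeCookies, visitsBefore_cons_succ, eat_apply, add_assoc]

lemma remaining_congr (ω : Env) {X X' : Path} {n : ℕ} (h : ∀ i < n, X i = X' i) :
    remaining ω X n = remaining ω X' n := by
  funext y j
  simp only [remaining, removeCookies, visitsBefore_congr h]

lemma remaining_glue (ω : Env) (X Z : Path) (n m : ℕ) :
    remaining ω (glue n X Z) (n + m) = remaining (remaining ω X n) Z m := by
  funext y j
  simp only [remaining, removeCookies, visitsBefore_glue, add_assoc]

/-- The trajectories that agree with `X` up to time `n`. -/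
def cyl (X : Path) (n : ℕ) : Set Path := {Y | ∀ i ≤ n, Y i = X i}

lemma cyl_eq_preimage (X : Path) (n : ℕ) :
    cyl X n = Preorder.frestrictLe (π := fun _ => ℤ) n ⁻¹'
      {Preorder.frestrictLe (π := fun _ => ℤ) n X} := by
  ext Y
  simp only [cyl, mem_ofPred_eq, mem_preimage, mem_singleton_iff, funext_iff, Subtype.forall,
    Finset.mem_Iic]
  rfl

lemma measurableSet_cyl (X : Path) (n : ℕ) : MeasurableSet (cyl X n) := by
  rw [cyl_eq_preimage]
  exact (Preorder.measurable_frestrictLe n) (measurableSet_singleton _)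

/-- Extension of a finite history to a trajectory. -/
def extend {n : ℕ} (h : (i : Finset.Iic n) → ℤ) : Path :=
  fun i => if hi : i ≤ n then h ⟨i, Finset.mem_Iic.2 hi⟩ else 0

lemma frestrictLe_extend {n : ℕ} (h : (i : Finset.Iic n) → ℤ) :
    Preorder.frestrictLe (π := fun _ => ℤ) n (extend h) = h := by
  funext ⟨i, hi⟩
  simp [extend, Preorder.frestrictLe, Finset.mem_Iic.1 hi]

/-- Finite measures on trajectories are determined by the probabilities of finite paths. -/
lemma path_measure_ext {P Q : Measure Path} [IsFiniteMeasure P] [IsFiniteMeasure Q]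
    (h : ∀ X n, P (cyl X n) = Q (cyl X n)) : P = Q := by
  have hmap : ∀ n, P.map (Preorder.frestrictLe (π := fun _ => ℤ) n) =
      Q.map (Preorder.frestrictLe (π := fun _ => ℤ) n) := by
    intro n
    refine Measure.ext_of_singleton fun g => ?_
    rw [Measure.map_apply (by fun_prop) (measurableSet_singleton _),
      Measure.map_apply (by fun_prop) (measurableSet_singleton _)]
    have := h (extend g) n
    rwa [cyl_eq_preimage, frestrictLe_extend] at this
  refine ext_of_generate_finite (measurableCylinders fun _ : ℕ => ℤ)
    (generateFrom_measurableCylinders (α := fun _ : ℕ => ℤ)).symm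
    isPiSystem_measurableCylinders ?_ ?_
  · intro t ht
    obtain ⟨N, S, mS, rfl⟩ : ∃ N S, MeasurableSet S ∧ t = cylinder (Finset.Iic N) S := by
      simpa [measurableCylinders_nat] using ht
    have := congrArg (fun m => m S) (hmap N)
    simp only [] at this
    rwa [Measure.map_apply (by fun_prop) mS, Measure.map_apply (by fun_prop) mS] at this
  · have := congrArg (fun m => m univ) (hmap 0)
    simp only [] at this
    rwa [Measure.map_apply (by fun_prop) .univ, Measure.map_apply (by fun_prop) .univ,
      preimage_univ] at this

lemma stepKernel_apply_restrict (ω : Env) (X : Path) (n : ℕ) :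
    stepKernel ω n (Preorder.frestrictLe (π := fun _ => ℤ) n X) {X (n + 1)} =
      (ω (X n) (visitsBefore X n (X n)) : Measure ℤ) {X (n + 1) - X n} := by
  have hv : priorVisits (Preorder.frestrictLe (π := fun _ => ℤ) n X) =
      visitsBefore X n (X n) := by
    unfold priorVisits visitsBefore
    refine Finset.card_bij (fun k _ => (k : ℕ)) ?_ ?_ ?_
    · intro a ha
      simp only [Finset.mem_filter, Finset.mem_univ, true_and] at ha
      simpa using ha
    · intro a _ b _ hab
      exact Subtype.ext hab
    · intro b hb
      simp only [Finset.mem_filter, Finset.mem_range] at hb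
      exact ⟨⟨b, Finset.mem_Iic.2 hb.1.le⟩,
        Finset.mem_filter.2 ⟨Finset.mem_univ _, hb⟩, rfl⟩
  simp only [stepKernel, Kernel.ofFunOfCountable, Kernel.coe_mk]
  rw [Measure.map_apply (measurable_of_countable _) (measurableSet_singleton _), hv]
  congr 1
  ext z
  change X n + z = X (n + 1) ↔ z = X (n + 1) - X n
  constructor <;> intro h <;> linarith

lemma quenched_cyl_succ (ω : Env) (x : ℤ) (X : Path) (n : ℕ) :
    quenched ω x (cyl X (n + 1)) = quenched ω x (cyl X n) *
      (ω (X n) (visitsBefore X n (X n)) : Measure ℤ) {X (n + 1) - X n} := by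
  have h := quenched_path_succ ω x n (Preorder.frestrictLe (π := fun _ => ℤ) (n + 1) X)
  rw [Measure.map_apply (by fun_prop) (measurableSet_singleton _),
    Measure.map_apply (by fun_prop) (measurableSet_singleton _)] at h
  rw [cyl_eq_preimage, cyl_eq_preimage, h, mul_comm, ← stepKernel_apply_restrict]
  rfl

lemma quenched_cyl_zero (ω : Env) (x : ℤ) (X : Path) :
    quenched ω x (cyl X 0) = if X 0 = x then 1 else 0 := by
  rw [cyl_eq_preimage, ← Measure.map_apply (by fun_prop) (measurableSet_singleton _)]
  unfold quenched Kernel.trajMeasure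
  rw [Measure.map_comp _ _ (by fun_prop), Kernel.traj_map_frestrictLe, Kernel.partialTraj_self,
    Measure.id_comp, Measure.map_apply (by fun_prop) (measurableSet_singleton _),
    Measure.dirac_apply' _ (by measurability)]
  split_ifs with h
  · refine indicator_of_mem ?_ _
    simp only [mem_preimage, mem_singleton_iff]
    funext ⟨i, hi⟩
    obtain rfl : i = 0 := by simpa using hi
    exact h.symm
  · refine indicator_of_notMem (fun h' => h ?_) _
    simp only [mem_preimage, mem_singleton_iff] at h'
    exact (congrFun h' ⟨0, by simp⟩).symm

lemma measurable_cons (x : ℤ) : Measurable (cons x) := by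
  refine measurable_pi_lambda _ fun i => ?_
  cases i with
  | zero => exact measurable_const
  | succ i => exact measurable_pi_apply i

lemma cons_preimage_cyl_zero (x : ℤ) (X : Path) :
    cons x ⁻¹' cyl X 0 = if X 0 = x then univ else ∅ := by
  ext Y
  split_ifs with h <;> simp [cyl, h, eq_comm]

lemma cons_preimage_cyl_succ (x : ℤ) (X : Path) (n : ℕ) :
    cons x ⁻¹' cyl X (n + 1) = if X 0 = x then cyl (fun i => X (i + 1)) n else ∅ := by
  ext Y
  have : Y ∈ cons x ⁻¹' cyl X (n + 1) ↔ x = X 0 ∧ ∀ i ≤ n, Y i = X (i + 1) := by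
    constructor
    · intro h
      exact ⟨h 0 (by omega), fun i hi => h (i + 1) (by omega)⟩
    · rintro ⟨h1, h2⟩ i hi
      cases i with
      | zero => exact h1
      | succ i => exact h2 i (by omega)
  rw [this]
  split_ifs with h
  · simp [cyl, h]
  · simpa using fun h' => absurd h'.symm h

/-- The law of the walk decomposed according to its first step. -/
lemma quenched_eq_bind (ω : Env) (x : ℤ) :
    quenched ω x = (ω x 0 : Measure ℤ).bind
      fun z => (quenched (eat ω x) (x + z)).map (cons x) := by
  have hm : Measurable fun z : ℤ => (quenched (eat ω x) (x + z)).map (cons x) :=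
    measurable_of_countable _
  have hp : IsProbabilityMeasure ((ω x 0 : Measure ℤ).bind
      fun z => (quenched (eat ω x) (x + z)).map (cons x)) := by
    constructor
    rw [Measure.bind_apply .univ hm.aemeasurable]
    simp [Measure.map_apply (measurable_cons x) .univ]
  have hb : ∀ X n, ((ω x 0 : Measure ℤ).bind
      fun z => (quenched (eat ω x) (x + z)).map (cons x)) (cyl X n) =
      ∫⁻ z, quenched (eat ω x) (x + z) (cons x ⁻¹' cyl X n) ∂(ω x 0 : Measure ℤ) := by
    intro X n
    rw [Measure.bind_apply (measurableSet_cyl X n) hm.aemeasurable]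
    simp_rw [Measure.map_apply (measurable_cons x) (measurableSet_cyl X n)]
  refine path_measure_ext fun X n => ?_
  rw [hb]
  rcases n with _ | n
  · rw [quenched_cyl_zero, cons_preimage_cyl_zero]
    split_ifs <;> simp
  rw [cons_preimage_cyl_succ]
  by_cases h0 : X 0 = x
  swap
  · simp only [if_neg h0, measure_empty, lintegral_zero]
    refine measure_mono_null (fun Y hY => ?_) (t := cyl X 0) ?_
    · exact fun i hi => hY i (by omega)
    · rw [quenched_cyl_zero, if_neg h0]
  simp only [if_pos h0]
  induction n with
  | zero =>
    rw [quenched_cyl_succ, quenched_cyl_zero, if_pos h0]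
    simp_rw [quenched_cyl_zero]
    have : ∀ z : ℤ, (if X (0 + 1) = x + z then (1 : ℝ≥0∞) else 0) =
        indicator {X 1 - X 0} 1 z := by
      intro z
      simp only [indicator_apply, mem_singleton_iff, Pi.one_apply, h0]
      refine if_congr ⟨fun h => ?_, fun h => ?_⟩ rfl rfl <;> simp at * <;> linarith
    simp_rw [this]
    rw [lintegral_indicator_one (measurableSet_singleton _), h0]
    simp
  | succ n ih =>
    rw [quenched_cyl_succ, ih]
    simp_rw [quenched_cyl_succ _ _ (fun i => X (i + 1)) n]
    rw [lintegral_mul_const _ (measurable_of_countable _)]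
    congr 2
    have hX : X = cons x fun i => X (i + 1) := by
      funext i
      cases i with
      | zero => exact h0
      | succ i => rfl
    rw [eat_apply]
    congr 2
    conv_lhs => rw [hX]
    rw [visitsBefore_cons_succ]
    rfl

/-- First step analysis. -/
lemma lintegral_quenched (ω : Env) (x : ℤ) {F : Path → ℝ≥0∞} (hF : Measurable F) :
    ∫⁻ X, F X ∂(quenched ω x) =
      ∫⁻ z, ∫⁻ Y, F (cons x Y) ∂(quenched (eat ω x) (x + z)) ∂(ω x 0 : Measure ℤ) := by
  rw [quenched_eq_bind, Measure.lintegral_bind (measurable_of_countable _).aemeasurable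
    hF.aemeasurable]
  simp_rw [lintegral_map hF (measurable_cons x)]

lemma quenched_apply (ω : Env) (x : ℤ) {A : Set Path} (hA : MeasurableSet A) :
    quenched ω x A =
      ∫⁻ z, quenched (eat ω x) (x + z) (cons x ⁻¹' A) ∂(ω x 0 : Measure ℤ) := by
  rw [quenched_eq_bind, Measure.bind_apply hA (measurable_of_countable _).aemeasurable]
  simp_rw [Measure.map_apply (measurable_cons x) hA]

lemma ae_start (ω : Env) (x : ℤ) : ∀ᵐ X ∂(quenched ω x), X 0 = x := by
  have h := quenched_cyl_zero ω x fun _ => x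
  rw [if_pos rfl] at h
  have : ∀ᵐ X ∂(quenched ω x), X ∈ cyl (fun _ => x) 0 := by
    rw [← prob_compl_eq_zero_iff (measurableSet_cyl _ _)] at h
    exact h
  filter_upwards [this] with X hX using hX 0 le_rfl

lemma measurable_visitsBefore (n : ℕ) (y : ℤ) : Measurable fun X : Path => visitsBefore X n y := by
  induction n with
  | zero => simp
  | succ n ih =>
    simp_rw [visitsBefore_succ]
    refine ih.add (Measurable.ite ?_ measurable_const measurable_const)
    exact measurableSet_eq_fun (measurable_pi_apply n) measurable_const

lemma measurable_removeCookies :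
    Measurable fun p : Env × (ℤ → ℕ) => removeCookies p.1 p.2 := by
  refine measurable_pi_lambda _ fun y => measurable_pi_lambda _ fun j => ?_
  have h1 : Measurable fun q : (ℕ → M1) × ℕ => q.1 (q.2 + j) :=
    measurable_from_prod_countable_left fun n => measurable_pi_apply (n + j)
  have h2 : Measurable fun p : Env × (ℤ → ℕ) => (p.1 y, p.2 y) := by fun_prop
  exact h1.comp h2

lemma measurable_remaining (n : ℕ) :
    Measurable fun p : Env × Path => remaining p.1 p.2 n :=
  measurable_removeCookies.comp (measurable_fst.prodMk (measurable_pi_lambda _ fun y =>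
    (measurable_visitsBefore n y).comp measurable_snd))

lemma measurable_glue (n : ℕ) : Measurable fun p : Path × Path => glue n p.1 p.2 := by
  refine measurable_pi_lambda _ fun i => ?_
  unfold glue
  by_cases h : i < n
  · simp only [h, if_true]
    exact (measurable_pi_apply i).comp measurable_fst
  · simp only [h, if_false]
    exact (measurable_pi_apply _).comp measurable_snd

/-- Expectations under the quenched law depend measurably on environment and starting point. -/
lemma measurable_lintegral_quenched {β : Type*} [MeasurableSpace β] {F : β × Path → ℝ≥0∞}
    (hF : Measurable F) {g : β → Env × ℤ} (hg : Measurable g) :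
    Measurable fun b => ∫⁻ Y, F (b, Y) ∂(quenched (g b).1 (g b).2) := by
  exact hF.lintegral_kernel_prod_right' (κ := walkKernel.comap g hg)

/-- The Markov property at a fixed time `n`: given the past, the walk continues as a walk in the
environment of remaining cookies. -/
lemma lintegral_quenched_glue (n : ℕ) (ω : Env) (x : ℤ) {F : Path → ℝ≥0∞} (hF : Measurable F) :
    ∫⁻ X, F X ∂(quenched ω x) =
      ∫⁻ X, ∫⁻ Y, F (glue n X Y) ∂(quenched (remaining ω X n) (X n)) ∂(quenched ω x) := by
  induction n generalizing ω x F with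
  | zero =>
    simp only [glue_zero, remaining_zero]
    have : (fun X : Path => ∫⁻ Y, F Y ∂(quenched ω (X 0))) =ᵐ[quenched ω x]
        fun _ => ∫⁻ Y, F Y ∂(quenched ω x) := by
      filter_upwards [ae_start ω x] with X hX
      rw [hX]
    rw [lintegral_congr_ae this]
    simp
  | succ n ih =>
    have hG : Measurable fun X : Path =>
        ∫⁻ Y, F (glue (n + 1) X Y) ∂(quenched (remaining ω X (n + 1)) (X (n + 1))) :=
      measurable_lintegral_quenched (F := fun p : Path × Path => F (glue (n + 1) p.1 p.2))
        (hF.comp (measurable_glue _))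
        (g := fun X => (remaining ω X (n + 1), X (n + 1)))
        (((measurable_remaining _).comp (measurable_const.prodMk measurable_id)).prodMk
          (measurable_pi_apply _))
    rw [lintegral_quenched ω x hF, lintegral_quenched ω x hG]
    refine lintegral_congr fun z => ?_
    have := ih (eat ω x) (x + z) (hF.comp (measurable_cons x))
    simp only [Function.comp_apply] at this
    rw [this]
    simp only [remaining_cons, glue_succ_cons, cons_succ]

lemma quenched_apply_glue (n : ℕ) (ω : Env) (x : ℤ) {A : Set Path} (hA : MeasurableSet A) :
    quenched ω x A = ∫⁻ X, quenched (remaining ω X n) (X n) {Y | glue n X Y ∈ A}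
      ∂(quenched ω x) := by
  rw [← lintegral_indicator_one hA, lintegral_quenched_glue n ω x (measurable_one.indicator hA)]
  refine lintegral_congr fun X => ?_
  have hm : MeasurableSet {Y | glue n X Y ∈ A} :=
    ((measurable_glue n).comp (measurable_const.prodMk measurable_id)) hA
  rw [← lintegral_indicator_one hm]
  rfl

/-! ### Locality, translation, and the sum over all cookies -/

/-- As long as the walk stays in `I`, its law only depends on the cookies in `I`. -/
lemma lintegral_quenched_congr {I : Set ℤ} (n : ℕ) {ω ω' : Env} (hω : ∀ y ∈ I, ω y = ω' y) (x : ℤ)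
    {F : Path → ℝ≥0∞} (hF : Measurable F)
    (hdep : ∀ X X' : Path, (∀ i ≤ n, X i = X' i) → F X = F X')
    (hI : ∀ X, F X ≠ 0 → ∀ i < n, X i ∈ I) :
    ∫⁻ X, F X ∂(quenched ω x) = ∫⁻ X, F X ∂(quenched ω' x) := by
  induction n generalizing ω ω' x F with
  | zero =>
    have h : ∀ ω, ∫⁻ X, F X ∂(quenched ω x) = F fun _ => x := by
      intro ω
      have : F =ᵐ[quenched ω x] fun _ => F fun _ => x := by
        filter_upwards [ae_start ω x] with X hX
        exact hdep _ _ fun i hi => by rw [Nat.le_zero.1 hi, hX]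
      rw [lintegral_congr_ae this]
      simp
    rw [h, h]
  | succ n ih =>
    by_cases hx : x ∈ I
    · rw [lintegral_quenched ω x hF, lintegral_quenched ω' x hF, hω x hx]
      refine lintegral_congr fun z => ih (fun y hy => ?_) _ (hF.comp (measurable_cons x)) ?_ ?_
      · funext j
        rw [eat_apply, eat_apply, hω y hy]
      · intro X X' h
        refine hdep _ _ fun i hi => ?_
        cases i with
        | zero => rfl
        | succ i => exact h i (by omega)
      · intro X h i hi
        exact hI _ h (i + 1) (by omega)
    · have h : ∀ ω, ∫⁻ X, F X ∂(quenched ω x) = 0 := by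
        intro ω
        rw [lintegral_eq_zero_iff hF]
        filter_upwards [ae_start ω x] with X hX
        by_contra h
        exact hx (hX ▸ hI X h 0 (by omega))
      rw [h, h]

lemma quenched_congr {I : Set ℤ} (n : ℕ) {ω ω' : Env} (hω : ∀ y ∈ I, ω y = ω' y) (x : ℤ)
    {A : Set Path} (hA : MeasurableSet A)
    (hdep : ∀ X X' : Path, (∀ i ≤ n, X i = X' i) → (X ∈ A ↔ X' ∈ A))
    (hI : ∀ X ∈ A, ∀ i < n, X i ∈ I) :
    quenched ω x A = quenched ω' x A := by
  rw [← lintegral_indicator_one hA, ← lintegral_indicator_one hA]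
  refine lintegral_quenched_congr n hω x (measurable_one.indicator hA) ?_ ?_
  · intro X X' h
    by_cases hX : X ∈ A
    · rw [indicator_of_mem hX, indicator_of_mem ((hdep X X' h).1 hX)]; rfl
    · rw [indicator_of_notMem hX, indicator_of_notMem (fun h' => hX ((hdep X X' h).2 h'))]
  · intro X h
    exact hI X (by by_contra h'; exact h (indicator_of_notMem h' _))

/-- The event that the walk never leaves `I`. -/
def confined (I : Set ℤ) : Set Path := {X | ∀ n, X n ∈ I}

lemma measurableSet_confined (I : Set ℤ) : MeasurableSet (confined I) := by
  have : confined I = ⋂ n, (fun X : Path => X n) ⁻¹' I := by ext; simp [confined]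
  rw [this]
  exact MeasurableSet.iInter fun n => measurable_pi_apply n MeasurableSet.of_discrete

lemma quenched_confined_congr {I : Set ℤ} {ω ω' : Env} (hω : ∀ y ∈ I, ω y = ω' y) (x : ℤ) :
    quenched ω x (confined I) = quenched ω' x (confined I) := by
  set A : ℕ → Set Path := fun n => {X | ∀ i < n, X i ∈ I} with hA
  have hAm : ∀ n, MeasurableSet (A n) := by
    intro n
    have : A n = ⋂ i, ⋂ (_ : i < n), (fun X : Path => X i) ⁻¹' I := by ext; simp [hA]
    rw [this]
    exact MeasurableSet.iInter fun i => MeasurableSet.iInter fun _ =>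
      measurable_pi_apply i MeasurableSet.of_discrete
  have hc : confined I = ⋂ n, A n := by
    ext X
    simp only [confined, hA, mem_ofPred_eq, mem_iInter]
    exact ⟨fun h n i _ => h i, fun h n => h (n + 1) n (by omega)⟩
  have hanti : Antitone A := fun m n hmn X hX i hi => hX i (by omega)
  have hlim : ∀ ω, Tendsto (fun n => quenched ω x (A n)) atTop (𝓝 (quenched ω x (confined I))) := by
    intro ω
    rw [hc]
    exact tendsto_measure_iInter_atTop (fun n => (hAm n).nullMeasurableSet) hanti
      ⟨0, measure_ne_top _ _⟩
  refine tendsto_nhds_unique (hlim ω) ?_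
  have : ∀ n, quenched ω x (A n) = quenched ω' x (A n) := fun n =>
    quenched_congr n hω x (hAm n)
      (fun X X' h => forall₂_congr fun i hi => by rw [h i (by omega)]) fun X hX => hX
  simp_rw [this]
  exact hlim ω'

/-- Translation of the environment by `k`. -/
def shiftBy (k : ℤ) (ω : Env) : Env := fun y => ω (y + k)

lemma measurable_shiftBy (k : ℤ) : Measurable (shiftBy k) :=
  measurable_pi_lambda _ fun y => measurable_pi_apply (y + k)

lemma shift_iterate (k : ℕ) (ω : Env) : shift^[k] ω = shiftBy k ω := by
  induction k generalizing ω with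
  | zero => funext y; simp [shiftBy]
  | succ k ih =>
    rw [Function.iterate_succ_apply, ih]
    funext y j
    simp only [shiftBy, shift]
    push_cast
    congr 1
    ring

/-- Translation of trajectories by `-k`. -/
def translate (k : ℤ) (X : Path) : Path := fun n => X n - k

lemma measurable_translate (k : ℤ) : Measurable (translate k) :=
  measurable_pi_lambda _ fun n => (measurable_of_countable fun z : ℤ => z - k).comp
    (measurable_pi_apply n)

lemma visitsBefore_translate (k : ℤ) (X : Path) (n : ℕ) (y : ℤ) :
    visitsBefore (translate k X) n y = visitsBefore X n (y + k) := by
  unfold visitsBefore translate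
  simp only [sub_eq_iff_eq_add]

/-- Translation invariance of the quenched laws. -/
lemma quenched_shiftBy (k : ℤ) (ω : Env) (x : ℤ) :
    quenched (shiftBy k ω) x = (quenched ω (x + k)).map (translate k) := by
  have : IsProbabilityMeasure ((quenched ω (x + k)).map (translate k)) :=
    Measure.isProbabilityMeasure_map (measurable_translate k).aemeasurable
  refine path_measure_ext fun X n => ?_
  rw [Measure.map_apply (measurable_translate k) (measurableSet_cyl X n)]
  have hp : ∀ n, translate k ⁻¹' cyl X n = cyl (translate (-k) X) n := by
    intro n
    ext Y
    simp only [cyl, translate, mem_preimage, mem_ofPred_eq]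
    exact forall₂_congr fun i _ => by constructor <;> intro h <;> linarith
  rw [hp]
  induction n with
  | zero =>
    rw [quenched_cyl_zero, quenched_cyl_zero]
    simp only [translate, sub_neg_eq_add, add_left_inj]
  | succ n ih =>
    rw [quenched_cyl_succ, quenched_cyl_succ, ih, visitsBefore_translate]
    simp only [translate, shiftBy, sub_neg_eq_add, add_sub_add_right_eq_sub]
    rw [add_neg_cancel_right]

/-- Membership in an event of positive probability can be decided by a possible first step. -/
lemma quenched_pos_iff {ω : Env} {x : ℤ} {A : Set Path} (hA : MeasurableSet A) :
    0 < quenched ω x A ↔ ∃ z : ℤ, 0 < (ω x 0 : Measure ℤ) {z} ∧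
      0 < quenched (eat ω x) (x + z) (cons x ⁻¹' A) := by
  rw [quenched_apply ω x hA, lintegral_pos_iff_support (measurable_of_countable _), pos_iff_ne_zero,
    ne_eq, ← not_iff_not, not_not]
  constructor
  · rintro h ⟨z, hz1, hz2⟩
    exact hz1.ne' (measure_mono_null (singleton_subset_iff.2 hz2.ne') h)
  · intro h
    rw [← biUnion_of_singleton (Function.support _)]
    refine (measure_biUnion_null_iff (to_countable _)).2 fun z hz => ?_
    by_contra h'
    exact h ⟨z, pos_iff_ne_zero.2 h', pos_iff_ne_zero.2 hz⟩

/-- The sum over all cookies of the expected value of `f` at the jump made with that cookie. -/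
def cookieSum (f : ℤ → ℤ → ℝ≥0∞) (ω : Env) : ℝ≥0∞ :=
  ∑' y, ∑' j, ∫⁻ z, f y (y + z) ∂(ω y j : Measure ℤ)

lemma cookieSum_eat (f : ℤ → ℤ → ℝ≥0∞) (ω : Env) (x : ℤ) :
    (∫⁻ z, f x (x + z) ∂(ω x 0 : Measure ℤ)) + cookieSum f (eat ω x) = cookieSum f ω := by
  unfold cookieSum
  rw [ENNReal.tsum_eq_add_tsum_ite x, ENNReal.tsum_eq_add_tsum_ite (f := fun y => ∑' j, _) x,
    ← add_assoc]
  congr 1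
  · simp_rw [eat_self]
    rw [tsum_eq_zero_add' (f := fun j => ∫⁻ z, f x (x + z) ∂(ω x j : Measure ℤ))
      ENNReal.summable]
  · refine tsum_congr fun y => ?_
    split_ifs with h
    · rfl
    · rw [eat_of_ne ω (Ne.symm h)]

lemma cookieSum_removeCookies_le (f : ℤ → ℤ → ℝ≥0∞) (ω : Env) (ℓ : ℤ → ℕ) :
    cookieSum f (removeCookies ω ℓ) ≤ cookieSum f ω := by
  unfold cookieSum removeCookies
  refine ENNReal.tsum_le_tsum fun y => ?_
  exact ENNReal.tsum_comp_le_tsum_of_injective (add_right_injective (ℓ y))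
    fun j => ∫⁻ z, f y (y + z) ∂(ω y j : Measure ℤ)

/-- Every cookie is used at most once, so that the expected sum of a function over all the jumps is
at most the sum over all cookies. -/
lemma lintegral_jumps_le (f : ℤ → ℤ → ℝ≥0∞) (ω : Env) (x : ℤ) :
    ∫⁻ X, ∑' i, f (X i) (X (i + 1)) ∂(quenched ω x) ≤ cookieSum f ω := by
  have hm : ∀ i, Measurable fun X : Path => f (X i) (X (i + 1)) := fun i =>
    (measurable_of_countable fun p : ℤ × ℤ => f p.1 p.2).comp
      (g := fun p : ℤ × ℤ => f p.1 p.2) (f := fun X : Path => (X i, X (i + 1))) (by fun_prop)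
  rw [lintegral_tsum fun i => (hm i).aemeasurable]
  refine ENNReal.tsum_le_of_sum_range_le fun n => ?_
  rw [← lintegral_finsetSum _ fun i _ => hm i]
  induction n generalizing ω x with
  | zero => simp
  | succ n ih =>
    rw [lintegral_quenched ω x (Finset.measurable_sum _ fun i _ => hm i)]
    have h : ∀ z : ℤ, ∫⁻ Y, ∑ i ∈ Finset.range (n + 1), f (cons x Y i) (cons x Y (i + 1))
        ∂(quenched (eat ω x) (x + z)) ≤ cookieSum f (eat ω x) + f x (x + z) := by
      intro z
      simp_rw [Finset.sum_range_succ', cons_succ, cons_zero]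
      rw [lintegral_add_left (Finset.measurable_sum _ fun i _ => hm i)]
      refine add_le_add (ih _ _) (le_of_eq ?_)
      have : (fun Y : Path => f x (Y 0)) =ᵐ[quenched (eat ω x) (x + z)] fun _ => f x (x + z) := by
        filter_upwards [ae_start (eat ω x) (x + z)] with Y hY
        rw [hY]
      rw [lintegral_congr_ae this]
      simp
    refine (lintegral_mono h).trans (le_of_eq ?_)
    rw [lintegral_add_left measurable_const, ← cookieSum_eat f ω x, add_comm]
    simp

/-! ### Sites visited infinitely often -/

/-- The event that `y` is visited infinitely often. -/
def visitedIO (y : ℤ) : Set Path := {X | {n | X n = y}.Infinite}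

/-- The event that the walk never jumps from `y` to `y'`. -/
def noJump (y y' : ℤ) : Set Path := {X | ∀ i, ¬(X i = y ∧ X (i + 1) = y')}

lemma visitedIO_eq (y : ℤ) : visitedIO y = ⋂ N, ⋃ n, ⋃ (_ : N ≤ n), {X : Path | X n = y} := by
  ext X
  simp only [visitedIO, mem_ofPred_eq, ← Nat.frequently_atTop_iff_infinite, frequently_atTop,
    mem_iInter, mem_iUnion, exists_prop]

lemma measurableSet_apply_eq (n : ℕ) (y : ℤ) : MeasurableSet {X : Path | X n = y} :=
  measurableSet_eq_fun (measurable_pi_apply n) measurable_const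

lemma measurableSet_visitedIO (y : ℤ) : MeasurableSet (visitedIO y) := by
  rw [visitedIO_eq]
  exact MeasurableSet.iInter fun N => MeasurableSet.iUnion fun n => MeasurableSet.iUnion fun _ =>
    measurableSet_apply_eq n y

lemma measurableSet_noJump (y y' : ℤ) : MeasurableSet (noJump y y') := by
  have : noJump y y' = ⋂ i, ({X : Path | X i = y} ∩ {X : Path | X (i + 1) = y'})ᶜ := by
    ext X; simp [noJump]
  rw [this]
  exact MeasurableSet.iInter fun i =>
    ((measurableSet_apply_eq i y).inter (measurableSet_apply_eq (i + 1) y')).compl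

/-- If each cookie at `y` allows the jump `z` with probability at least `p`, then the jump is
avoided at the first `m` visits with probability at most `(1 - p) ^ m`. -/
lemma quenched_avoid_jump_le {y z : ℤ} {p : ℝ≥0∞} (n m : ℕ) {ω : Env}
    (hω : ∀ j, p ≤ (ω y j : Measure ℤ) {z}) (x : ℤ) :
    quenched ω x {X | m ≤ visitsBefore X n y ∧ ∀ i < n, ¬(X i = y ∧ X (i + 1) = y + z)} ≤
      (1 - p) ^ m := by
  rcases Nat.eq_zero_or_pos m with rfl | hm0
  · simpa using prob_le_one
  induction n generalizing ω x m with
  | zero =>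
    have : {X : Path | m ≤ visitsBefore X 0 y ∧ ∀ i < 0, ¬(X i = y ∧ X (i + 1) = y + z)} = ∅ := by
      ext X
      simp only [visitsBefore_zero, mem_ofPred_eq, mem_empty_iff_false, iff_false, not_and]
      omega
    rw [this]
    simp
  | succ n ih =>
    have hmeas : MeasurableSet {X : Path | m ≤ visitsBefore X (n + 1) y ∧
        ∀ i < n + 1, ¬(X i = y ∧ X (i + 1) = y + z)} := by
      refine MeasurableSet.inter
        (measurableSet_le measurable_const (measurable_visitsBefore _ y)) ?_
      have : {X : Path | ∀ i < n + 1, ¬(X i = y ∧ X (i + 1) = y + z)} = ⋂ i, ⋂ (_ : i < n + 1),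
          ({X : Path | X i = y} ∩ {X : Path | X (i + 1) = y + z})ᶜ := by
        ext X; simp
      refine MeasurableSet.congr ?_ this.symm
      exact MeasurableSet.iInter fun i => MeasurableSet.iInter fun _ =>
        ((measurableSet_apply_eq i y).inter (measurableSet_apply_eq (i + 1) _)).compl
    have hω' : ∀ j, p ≤ (eat ω x y j : Measure ℤ) {z} := fun j => by rw [eat_apply]; exact hω _
    rw [quenched_apply ω x hmeas]
    by_cases hx : x = y
    · subst hx
      have h : ∀ z' : ℤ, quenched (eat ω x) (x + z') (cons x ⁻¹' {X : Path |
          m ≤ visitsBefore X (n + 1) x ∧ ∀ i < n + 1, ¬(X i = x ∧ X (i + 1) = x + z)}) ≤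
          ({z}ᶜ : Set ℤ).indicator (fun _ => (1 - p) ^ (m - 1)) z' := by
        intro z'
        by_cases hz : z' = z
        · subst hz
          rw [indicator_of_notMem (by simp)]
          refine le_of_eq (measure_mono_null (fun Y hY => ?_) (ae_iff.1 (ae_start _ _)))
          intro h0
          exact hY.2 0 (by omega) ⟨rfl, h0⟩
        · rw [indicator_of_mem (by simpa using hz)]
          have hsub : (cons x ⁻¹' {X : Path | m ≤ visitsBefore X (n + 1) x ∧
              ∀ i < n + 1, ¬(X i = x ∧ X (i + 1) = x + z)}) ⊆
              {X | m - 1 ≤ visitsBefore X n x ∧ ∀ i < n, ¬(X i = x ∧ X (i + 1) = x + z)} := by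
            rintro Y ⟨h1, h2⟩
            rw [visitsBefore_cons_succ, if_pos rfl] at h1
            exact ⟨by omega, fun i hi => h2 (i + 1) (by omega)⟩
          refine (measure_mono hsub).trans ?_
          rcases Nat.eq_zero_or_pos (m - 1) with h0 | h0
          · rw [h0, pow_zero]; exact prob_le_one
          · exact ih _ hω' _ h0
      refine (lintegral_mono h).trans ?_
      rw [lintegral_indicator_const (by measurability), prob_compl_eq_one_sub (by measurability)]
      calc (1 - p) ^ (m - 1) * (1 - (ω x 0 : Measure ℤ) {z})
          ≤ (1 - p) ^ (m - 1) * (1 - p) := by gcongr; exact hω 0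
        _ = (1 - p) ^ m := by rw [← pow_succ]; congr 1; omega
    · have h : ∀ z' : ℤ, quenched (eat ω x) (x + z') (cons x ⁻¹' {X : Path |
          m ≤ visitsBefore X (n + 1) y ∧ ∀ i < n + 1, ¬(X i = y ∧ X (i + 1) = y + z)}) ≤
          (1 - p) ^ m := by
        intro z'
        refine (measure_mono ?_).trans (ih m hω' _ hm0)
        rintro Y ⟨h1, h2⟩
        rw [visitsBefore_cons_succ, if_neg hx, zero_add] at h1
        exact ⟨h1, fun i hi => h2 (i + 1) (by omega)⟩
      refine (lintegral_mono h).trans ?_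
      simp

lemma visitsBefore_mono (X : Path) (y : ℤ) : Monotone fun n => visitsBefore X n y :=
  monotone_nat_of_le_succ fun n => by rw [visitsBefore_succ]; omega

lemma exists_le_visitsBefore {X : Path} {y : ℤ} (h : X ∈ visitedIO y) (m : ℕ) :
    ∃ n, m ≤ visitsBefore X n y := by
  induction m with
  | zero => exact ⟨0, Nat.zero_le _⟩
  | succ m ih =>
    obtain ⟨n, hn⟩ := ih
    obtain ⟨k, hk, hnk⟩ := h.exists_gt n
    refine ⟨k + 1, ?_⟩
    rw [visitsBefore_succ, if_pos (show X k = y from hk)]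
    have := visitsBefore_mono X y hnk.le
    simp only at this
    omega

lemma quenched_visitedIO_inter_noJump {ω : Env} {y z : ℤ} {p : ℝ≥0∞} (hp : 0 < p)
    (hω : ∀ j, p ≤ (ω y j : Measure ℤ) {z}) (x : ℤ) :
    quenched ω x (visitedIO y ∩ noJump y (y + z)) = 0 := by
  have hle : ∀ m : ℕ, quenched ω x (visitedIO y ∩ noJump y (y + z)) ≤ (1 - p) ^ m := by
    intro m
    set C : ℕ → Set Path := fun n => {X | m ≤ visitsBefore X n y} ∩ noJump y (y + z) with hC
    have hmono : Monotone C := fun a b hab X hX => ⟨hX.1.trans (visitsBefore_mono X y hab), hX.2⟩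
    have hsub : visitedIO y ∩ noJump y (y + z) ⊆ ⋃ n, C n := by
      rintro X ⟨h1, h2⟩
      obtain ⟨n, hn⟩ := exists_le_visitsBefore h1 m
      exact mem_iUnion.2 ⟨n, hn, h2⟩
    refine (measure_mono hsub).trans ?_
    rw [hmono.measure_iUnion]
    refine iSup_le fun n => (measure_mono ?_).trans (quenched_avoid_jump_le n m hω x)
    exact fun X hX => ⟨hX.1, fun i _ => hX.2 i⟩
  have hlt : 1 - p < 1 := ENNReal.sub_lt_self ENNReal.one_ne_top one_ne_zero hp.ne'
  exact le_antisymm (ge_of_tendsto' (ENNReal.tendsto_pow_atTop_nhds_zero_of_lt_one hlt) hle)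
    zero_le

/-- Conditional Borel–Cantelli: if `y` is visited infinitely often, and if the steps at `y` have
distribution `μ` once `M` cookies are eaten, then every jump `z` in the support of `μ` is made from
`y` infinitely often. -/
lemma ae_visitedIO_add {ω : Env} {μ : M1} {M : ℕ} {y z : ℤ} (hω : ∀ j, M ≤ j → ω y j = μ)
    (hz : 0 < (μ : Measure ℤ) {z}) (x : ℤ) :
    ∀ᵐ X ∂(quenched ω x), X ∈ visitedIO y → X ∈ visitedIO (y + z) := by
  set A : Set Path := visitedIO y ∩ noJump y (y + z) with hA
  have hAm : MeasurableSet A := (measurableSet_visitedIO y).inter (measurableSet_noJump _ _)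
  have hN : ∀ N, ∀ᵐ X ∂(quenched ω x), ¬ (M ≤ visitsBefore X N y ∧ (fun i => X (N + i)) ∈ A) := by
    intro N
    have hm : MeasurableSet {X : Path | M ≤ visitsBefore X N y ∧ (fun i => X (N + i)) ∈ A} := by
      refine MeasurableSet.inter
        (measurableSet_le measurable_const (measurable_visitsBefore N y)) ?_
      exact (measurable_pi_lambda (fun (X : Path) i => X (N + i))
        fun i => measurable_pi_apply (N + i)) hAm
    rw [ae_iff]
    simp only [not_not]
    rw [quenched_apply_glue N ω x hm]
    refine (lintegral_congr fun X => ?_).trans lintegral_zero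
    by_cases hX : M ≤ visitsBefore X N y
    · refine measure_mono_null (fun Y hY => ?_) (quenched_visitedIO_inter_noJump
        (ω := remaining ω X N) (z := z) hz (fun j => by
          rw [remaining, removeCookies, hω _ (by omega)]) (X N))
      have := hY.2
      simp only [glue_add] at this
      exact this
    · refine measure_mono_null (fun Y hY => hX ?_) measure_empty
      have h1 := hY.1
      have h2 := visitsBefore_glue X Y N 0 y
      rw [add_zero, visitsBefore_zero, add_zero] at h2
      omega
  filter_upwards [ae_all_iff.2 hN] with X hX hy
  by_contra hyz
  -- after the last visit to `y + z`, the walk never jumps from `y` to `y + z`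
  obtain ⟨N1, hN1⟩ := (not_infinite.1 hyz).bddAbove
  obtain ⟨N2, hN2⟩ := exists_le_visitsBefore hy M
  refine hX (max N1 N2) ⟨hN2.trans (visitsBefore_mono X y (le_max_right _ _)), ?_, ?_⟩
  · refine infinite_of_forall_exists_gt fun a => ?_
    obtain ⟨k, hk, hak⟩ := hy.exists_gt (max N1 N2 + a)
    refine ⟨k - max N1 N2, ?_, by omega⟩
    simp only [mem_ofPred_eq]
    rw [show max N1 N2 + (k - max N1 N2) = k by omega]
    exact hk
  · rintro i ⟨-, hi⟩
    have := hN1 (show max N1 N2 + (i + 1) ∈ {n | X n = y + z} from hi)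
    omega

/-- The jumps that are possible under `ν`. -/
def jumps (ν : M1) : Set ℤ := {z | 0 < (ν : Measure ℤ) {z}}

lemma ae_mem_jumps (ν : M1) : ∀ᵐ z ∂(ν : Measure ℤ), z ∈ jumps ν :=
  ae_iff_of_countable.2 fun _ hz => pos_iff_ne_zero.2 hz

/-- A distribution with nonnegative mean allows nonnegative jumps. -/
lemma exists_nonneg_jump {ν : M1} (h : ν ∈ meanNonneg) : ∃ z ∈ jumps ν, 0 ≤ z := by
  by_contra! hneg
  have hlt : ∀ᵐ z : ℤ ∂(ν : Measure ℤ), (0 : ℝ) < -(z : ℝ) := by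
    filter_upwards [ae_mem_jumps ν] with z hz
    have := hneg z hz
    rw [neg_pos]
    exact_mod_cast this
  have hpos : 0 < ∫ z : ℤ, -(z : ℝ) ∂(ν : Measure ℤ) := by
    rw [integral_pos_iff_support_of_nonneg_ae (hlt.mono fun z hz => hz.le) h.1.neg]
    have : (Function.support fun z : ℤ => -(z : ℝ)) =ᵐ[(ν : Measure ℤ)] univ := by
      filter_upwards [hlt] with z hz
      exact propext ⟨fun _ => mem_univ z, fun _ => hz.ne'⟩
    rw [measure_congr this]
    simp
  rw [integral_neg] at hpos
  have := h.2
  unfold drift at this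
  linarith

lemma exists_jump_neg {μ : M1} (h0 : μ ∈ meanZero) {a : ℤ} (ha : a ∈ jumps μ) (ha0 : a ≠ 0) :
    ∃ z ∈ jumps μ, z < 0 := by
  by_contra! hnn
  have h : (fun z : ℤ => (z : ℝ)) =ᵐ[(μ : Measure ℤ)] 0 := by
    refine (integral_eq_zero_iff_of_nonneg_ae ?_ h0.1).1 h0.2
    filter_upwards [ae_mem_jumps μ] with z hz
    simpa using hnn z hz
  have := ae_iff_of_countable.1 h a ha.ne'
  exact ha0 (by simpa using this)

lemma exists_jump_pos {μ : M1} (h0 : μ ∈ meanZero) {a : ℤ} (ha : a ∈ jumps μ) (ha0 : a ≠ 0) :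
    ∃ z ∈ jumps μ, 0 < z := by
  by_contra! hnn
  have h : (fun z : ℤ => -(z : ℝ)) =ᵐ[(μ : Measure ℤ)] 0 := by
    refine (integral_eq_zero_iff_of_nonneg_ae ?_ h0.1.neg).1 ?_
    · filter_upwards [ae_mem_jumps μ] with z hz
      have := hnn z hz
      simpa using this
    · have := h0.2
      unfold drift at this
      simp only [Pi.neg_apply]
      rw [integral_neg, this, neg_zero]
  have := ae_iff_of_countable.1 h a ha.ne'
  exact ha0 (by simpa using this)

lemma exists_jump_ne_zero {μ : M1} (hs : AddSubgroup.closure (jumps μ) = ⊤) :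
    ∃ a ∈ jumps μ, a ≠ 0 := by
  by_contra! h
  have h1 : (1 : ℤ) ∈ AddSubgroup.closure (jumps μ) := hs ▸ AddSubgroup.mem_top _
  have : AddSubgroup.closure (jumps μ) ≤ (⊥ : AddSubgroup ℤ) :=
    (AddSubgroup.closure_le _).2 fun a ha => h a ha
  exact one_ne_zero (this h1)

/-- Since `μ` has mean zero, the jumps of `μ` generate `ℤ` even as a monoid. -/
lemma closure_jumps {μ : M1} (h0 : μ ∈ meanZero) (hs : AddSubgroup.closure (jumps μ) = ⊤) :
    AddSubmonoid.closure (jumps μ) = ⊤ := by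
  obtain ⟨c, hc, hc0⟩ := exists_jump_ne_zero hs
  obtain ⟨a, ha, ha0⟩ := exists_jump_pos h0 hc hc0
  obtain ⟨b, hb, hb0⟩ := exists_jump_neg h0 hc hc0
  have hneg : ∀ s ∈ jumps μ, -s ∈ AddSubmonoid.closure (jumps μ) := by
    intro s hs'
    have hsm := AddSubmonoid.subset_closure (M := ℤ) hs'
    rcases lt_trichotomy s 0 with h | h | h
    · have e : -s = (-s).toNat • a + (a - 1).toNat • s := by
        simp only [nsmul_eq_mul]
        rw [Int.toNat_of_nonneg (by omega), Int.toNat_of_nonneg (by omega)]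
        ring
      rw [e]
      exact add_mem (nsmul_mem (AddSubmonoid.subset_closure ha) _) (nsmul_mem hsm _)
    · simp [h]
    · have e : -s = s.toNat • b + (-b - 1).toNat • s := by
        simp only [nsmul_eq_mul]
        rw [Int.toNat_of_nonneg (by omega), Int.toNat_of_nonneg (by omega)]
        ring
      rw [e]
      exact add_mem (nsmul_mem (AddSubmonoid.subset_closure hb) _) (nsmul_mem hsm _)
  have hle : AddSubgroup.closure (jumps μ) ≤
      { AddSubmonoid.closure (jumps μ) with
        neg_mem' := by
          intro x hx
          change -x ∈ AddSubmonoid.closure (jumps μ)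
          induction hx using AddSubmonoid.closure_induction with
          | mem x hx => exact hneg x hx
          | zero => simp
          | add x y _ _ hx hy => rw [neg_add]; exact add_mem hx hy } :=
    (AddSubgroup.closure_le _).2 AddSubmonoid.subset_closure
  rw [hs] at hle
  exact eq_top_iff.2 fun x _ => hle (AddSubgroup.mem_top x)

/-- Almost surely, the walk is recurrent if it visits some site infinitely often. -/
lemma ae_recurrent_of_visitedIO {ω : Env} {μ : M1} {M : ℕ} (hω : ∀ y j, M ≤ j → ω y j = μ)
    (hs : AddSubmonoid.closure (jumps μ) = ⊤) (x : ℤ) :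
    ∀ᵐ X ∂(quenched ω x), ∀ y, X ∈ visitedIO y → X ∈ recurrent := by
  have h : ∀ᵐ X ∂(quenched ω x), ∀ (z : jumps μ) (y : ℤ), X ∈ visitedIO y →
      X ∈ visitedIO (y + z.1) :=
    ae_all_iff.2 fun z => ae_all_iff.2 fun y => ae_visitedIO_add (hω y) z.2 x
  filter_upwards [h] with X hX y hy y'
  have hz : ∀ z ∈ AddSubmonoid.closure (jumps μ), ∀ y, X ∈ visitedIO y → X ∈ visitedIO (y + z) := by
    intro z hz
    induction hz using AddSubmonoid.closure_induction with
    | mem z hz => exact hX ⟨z, hz⟩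
    | zero => intro y hy; rwa [add_zero]
    | add a b _ _ iha ihb => intro y hy; rw [← add_assoc]; exact ihb _ (iha _ hy)
  have := hz (y' - y) (hs ▸ AddSubmonoid.mem_top _) y hy
  rwa [add_sub_cancel] at this

/-! ### Controlled walks in a window -/

lemma multiset_sum_nonpos {s : Multiset ℤ} (h : ∀ z ∈ s, z ≤ 0) : s.sum ≤ 0 := by
  induction s using Multiset.induction with
  | empty => simp
  | cons a s ih =>
    rw [Multiset.sum_cons]
    have h1 := h a (Multiset.mem_cons_self a s)
    have h2 := ih fun z hz => h z (Multiset.mem_cons_of_mem hz)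
    omega

/-- Jumps of size at most `B` can be reordered such that the walk stays in a window of width
`2 * B`: if none of the remaining jumps stays in the window, then they all have the same sign. -/
lemma window_connected {S : Set ℤ} {B : ℕ} (hB : ∀ s ∈ S, |s| ≤ B) {u v : ℤ} (huv : u + 2 * B ≤ v)
    (s : Multiset ℤ) (hs : ∀ z ∈ s, z ∈ S) (p : ℤ) (hp : p ∈ Icc u v) (hq : p + s.sum ∈ Icc u v) :
    Relation.ReflTransGen (fun a b => a ∈ Icc u v ∧ b ∈ Icc u v ∧ b - a ∈ S) p (p + s.sum) := by
  induction hn : s.card generalizing s p with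
  | zero =>
    rw [Multiset.card_eq_zero] at hn
    subst hn
    simpa using Relation.ReflTransGen.refl
  | succ n ih =>
    have hex : ∃ z ∈ s, p + z ∈ Icc u v := by
      by_contra! hno
      obtain ⟨z, hz⟩ := Multiset.card_pos_iff_exists_mem.1 (by omega : 0 < s.card)
      have hzB := abs_le.1 (hB z (hs z hz))
      have hzn := hno z hz
      simp only [mem_Icc, not_and_or, not_le] at hzn hp hq
      rcases le_or_gt z 0 with h0 | h0
      · -- all jumps are negative, so that their sum leads below the window
        have hall : ∀ w ∈ s, w ≤ 0 := by
          intro w hw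
          by_contra! hw0
          have hwB := abs_le.1 (hB w (hs w hw))
          have hwn := hno w hw
          simp only [mem_Icc, not_and_or, not_le] at hwn
          omega
        have h1 : s.sum = z + (s.erase z).sum := by
          rw [← Multiset.sum_cons, Multiset.cons_erase hz]
        have h2 : (s.erase z).sum ≤ 0 :=
          multiset_sum_nonpos fun w hw => hall w (Multiset.mem_of_mem_erase hw)
        omega
      · have hall : ∀ w ∈ s, 0 ≤ w := by
          intro w hw
          by_contra! hw0
          have hwB := abs_le.1 (hB w (hs w hw))
          have hwn := hno w hw
          simp only [mem_Icc, not_and_or, not_le] at hwn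
          omega
        have h1 : s.sum = z + (s.erase z).sum := by
          rw [← Multiset.sum_cons, Multiset.cons_erase hz]
        have h2 : 0 ≤ (s.erase z).sum :=
          Multiset.sum_nonneg fun w hw => hall w (Multiset.mem_of_mem_erase hw)
        omega
    obtain ⟨z, hz, hpz⟩ := hex
    have h1 : s.sum = z + (s.erase z).sum := by
      rw [← Multiset.sum_cons, Multiset.cons_erase hz]
    have e : p + s.sum = p + z + (s.erase z).sum := by rw [h1, add_assoc]
    have := ih (s.erase z) (fun w hw => hs w (Multiset.mem_of_mem_erase hw)) (p + z) hpz
      (e ▸ hq) (by rw [Multiset.card_erase_of_mem hz, hn]; rfl)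
    rw [e]
    exact Relation.ReflTransGen.head ⟨hp, hpz, by simpa using hs z hz⟩ this

/-- Any two sites of a window of width `2 * B` are connected by jumps that stay in the window. -/
lemma window_path {S : Set ℤ} {B : ℕ} (hB : ∀ s ∈ S, |s| ≤ B) (hS : AddSubmonoid.closure S = ⊤)
    {u v : ℤ} (huv : u + 2 * B ≤ v) {p q : ℤ} (hp : p ∈ Icc u v) (hq : q ∈ Icc u v) :
    Relation.ReflTransGen (fun a b => a ∈ Icc u v ∧ b ∈ Icc u v ∧ b - a ∈ S) p q := by
  obtain ⟨s, hs, hsum⟩ := AddSubmonoid.exists_multiset_of_mem_closure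
    (hS ▸ AddSubmonoid.mem_top (q - p) : q - p ∈ AddSubmonoid.closure S)
  have := window_connected hB huv s hs p hp (by rw [hsum]; simpa using hq)
  rwa [hsum, add_sub_cancel] at this

/-- The event that the walk stays in `[0, W]` until it jumps to `W + 1`, and that every site `v` of
`[0, W]` has been visited at least `c v` times before. -/
def eatUp (W : ℤ) (c : ℤ → ℕ) : Set Path :=
  {X | ∃ σ, (∀ i < σ, X i ∈ Icc 0 W) ∧ X σ = W + 1 ∧ ∀ v ∈ Icc 0 W, c v ≤ visitsBefore X σ v}

lemma eatUp_eq (W : ℤ) (c : ℤ → ℕ) : eatUp W c = ⋃ σ, ((⋂ i, ⋂ (_ : i < σ),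
    (fun X : Path => X i) ⁻¹' Icc 0 W) ∩ ({X : Path | X σ = W + 1} ∩
      ⋂ v, ⋂ (_ : v ∈ Icc 0 W), {X : Path | c v ≤ visitsBefore X σ v})) := by
  ext X
  simp [eatUp]

lemma measurableSet_eatUp (W : ℤ) (c : ℤ → ℕ) : MeasurableSet (eatUp W c) := by
  rw [eatUp_eq]
  refine MeasurableSet.iUnion fun σ => (MeasurableSet.iInter fun i => MeasurableSet.iInter fun _ =>
    measurable_pi_apply i MeasurableSet.of_discrete).inter ((measurableSet_apply_eq _ _).inter
      (MeasurableSet.iInter fun v => MeasurableSet.iInter fun _ =>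
        measurableSet_le measurable_const (measurable_visitsBefore _ _)))

lemma eat_eq_self {ω : Env} {x : ℤ} {μ : M1} (h : ∀ j, ω x j = μ) : eat ω x = ω := by
  funext y j
  by_cases hy : x = y
  · subst hy; rw [eat_self, h, h]
  · rw [eat_of_ne ω hy]

/-- If the cookies in `[0, W]` that differ from `μ` allow bounded jumps in both directions, then all
of them can be eaten before the walk leaves `[0, W]`: use up cookies whenever there is one at the
present site, and otherwise move by jumps of `μ` to a site with cookies. -/
lemma eatUp_pos {μ : M1} {B : ℕ} (hB : ∀ s ∈ jumps μ, |s| ≤ B)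
    (hS : AddSubmonoid.closure (jumps μ) = ⊤) {a : ℤ} (ha : a ∈ jumps μ) (ha0 : 0 < a)
    {C : ℕ} {W : ℤ} (hWB : 2 * B ≤ W) (hWC : 2 * C ≤ W) (n : ℕ) {ω : Env} {c : ℤ → ℕ}
    (hn : ∑ v ∈ Finset.Icc 0 W, c v = n)
    (hμ : ∀ v ∈ Icc 0 W, ∀ j, c v ≤ j → ω v j = μ)
    (hl : ∀ v ∈ Icc 0 W, ∀ j < c v, ∃ l : ℤ, 0 ≤ l ∧ l ≤ C ∧ -l ∈ jumps (ω v j))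
    (hr : ∀ v ∈ Icc 0 W, ∀ j < c v, ∃ l : ℤ, 0 ≤ l ∧ l ≤ C ∧ l ∈ jumps (ω v j))
    {x : ℤ} (hx : x ∈ Icc 0 W) : 0 < quenched ω x (eatUp W c) := by
  -- a `μ`-jump within the window from a site without cookies
  have hmove : ∀ {ω : Env} {c : ℤ → ℕ}, (∀ v ∈ Icc 0 W, ∀ j, c v ≤ j → ω v j = μ) → ∀ {p q : ℤ},
      p ∈ Icc 0 W → c p = 0 → q ∈ Icc 0 W → q - p ∈ jumps μ → 0 < quenched ω q (eatUp W c) →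
      0 < quenched ω p (eatUp W c) := by
    intro ω c hμ p q hp hcp hq hpq hpos
    have hpμ : ∀ j, ω p j = μ := fun j => hμ p hp j (by omega)
    rw [quenched_pos_iff (measurableSet_eatUp W c)]
    refine ⟨q - p, by rw [hpμ]; exact hpq, ?_⟩
    rw [eat_eq_self hpμ, add_sub_cancel]
    refine lt_of_lt_of_le hpos (measure_mono ?_)
    rintro Y ⟨σ, h1, h2, h3⟩
    refine ⟨σ + 1, fun i hi => ?_, h2, fun w hw => ?_⟩
    · cases i with
      | zero => exact hp
      | succ i => exact h1 i (by omega)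
    · have := h3 w hw
      rw [visitsBefore_cons_succ]
      omega
  induction n generalizing ω c x with
  | zero =>
    have hc : ∀ v ∈ Icc 0 W, c v = 0 := fun v hv =>
      Finset.sum_eq_zero_iff.1 hn v (Finset.mem_Icc.2 hv)
    have haB := abs_le.1 (hB a ha)
    have hend : W + 1 - a ∈ Icc 0 W := by constructor <;> omega
    induction window_path hB hS (u := 0) (v := W) (by omega) hx hend using
      Relation.ReflTransGen.head_induction_on with
    | refl =>
      rw [quenched_pos_iff (measurableSet_eatUp W c)]
      refine ⟨a, ?_, ?_⟩
      · rw [hμ _ hend 0 (by rw [hc _ hend])]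
        exact ha
      · have hsub : {Y : Path | Y 0 = W + 1 - a + a} ⊆ cons (W + 1 - a) ⁻¹' eatUp W c := by
          intro Y hY
          refine ⟨1, fun i hi => ?_, ?_, fun v hv => ?_⟩
          · obtain rfl : i = 0 := by omega
            exact hend
          · simpa using hY
          · rw [hc v hv]; exact Nat.zero_le _
        refine lt_of_lt_of_le ?_ (measure_mono hsub)
        rw [mem_ae_iff_prob_eq_one (measurableSet_apply_eq _ _) |>.1 (ae_start _ _)]
        exact one_pos
    | head h _ ih =>
      obtain ⟨hp, hq, hpq⟩ := h
      exact hmove hμ hp (hc _ hp) hq hpq (ih hq)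
  | succ n ih =>
    obtain ⟨v, hv, hcv⟩ : ∃ v ∈ Icc 0 W, 0 < c v := by
      by_contra! h
      rw [Finset.sum_eq_zero fun v hv => by simpa using h v (Finset.mem_Icc.1 hv)] at hn
      omega
    -- at a site with cookies, eat one
    have heat : ∀ p ∈ Icc 0 W, 0 < c p → 0 < quenched ω p (eatUp W c) := by
      intro p hp hcp
      obtain ⟨z, hz, hpz⟩ : ∃ z ∈ jumps (ω p 0), p + z ∈ Icc 0 W := by
        have hp1 := hp.1
        have hp2 := hp.2
        rcases le_or_gt (C : ℤ) p with h | h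
        · obtain ⟨l, hl0, hlC, hlj⟩ := hl p hp 0 hcp
          exact ⟨-l, hlj, by constructor <;> omega⟩
        · obtain ⟨l, hl0, hlC, hlj⟩ := hr p hp 0 hcp
          exact ⟨l, hlj, by constructor <;> omega⟩
      have hupd : ∀ {T : M1 → Prop}, (∀ v ∈ Icc 0 W, ∀ j < c v, T (ω v j)) → ∀ v ∈ Icc 0 W,
          ∀ j < Function.update c p (c p - 1) v, T (eat ω p v j) := by
        intro T hT w hw j hj
        by_cases hwp : w = p
        · subst hwp
          rw [Function.update_self] at hj
          rw [eat_self]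
          exact hT w hw _ (by omega)
        · rw [Function.update_of_ne hwp] at hj
          rw [eat_of_ne _ (Ne.symm hwp)]
          exact hT w hw _ hj
      rw [quenched_pos_iff (measurableSet_eatUp W c)]
      refine ⟨z, hz, ?_⟩
      refine lt_of_lt_of_le (ih (c := Function.update c p (c p - 1)) ?_ ?_
        (hupd (T := fun ν => ∃ l : ℤ, 0 ≤ l ∧ l ≤ C ∧ -l ∈ jumps ν) hl)
        (hupd (T := fun ν => ∃ l : ℤ, 0 ≤ l ∧ l ≤ C ∧ l ∈ jumps ν) hr) hpz) (measure_mono ?_)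
      · rw [Finset.sum_update_of_mem (Finset.mem_Icc.2 hp)]
        rw [← Finset.add_sum_erase _ _ (Finset.mem_Icc.2 hp), ← Finset.sdiff_singleton_eq_erase]
          at hn
        omega
      · intro w hw j hj
        by_cases hwp : w = p
        · subst hwp
          rw [Function.update_self] at hj
          rw [eat_self]
          exact hμ w hw _ (by omega)
        · rw [Function.update_of_ne hwp] at hj
          rw [eat_of_ne _ (Ne.symm hwp)]
          exact hμ w hw _ hj
      · rintro Y ⟨σ, h1, h2, h3⟩
        refine ⟨σ + 1, fun i hi => ?_, h2, fun w hw => ?_⟩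
        · cases i with
          | zero => exact hp
          | succ i => exact h1 i (by omega)
        · have := h3 w hw
          rw [visitsBefore_cons_succ]
          by_cases hwp : w = p
          · subst hwp
            rw [Function.update_self] at this
            rw [if_pos rfl]
            omega
          · rw [Function.update_of_ne hwp] at this
            omega
    induction window_path hB hS (u := 0) (v := W) (by omega) hx hv using
      Relation.ReflTransGen.head_induction_on with
    | refl => exact heat v hv hcv
    | @head p q h _ ih' =>
      obtain ⟨hp, hq, hpq⟩ := h
      rcases Nat.eq_zero_or_pos (c p) with h0 | h0
      · exact hmove hμ hp h0 hq hpq (ih' hq)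
      · exact heat p hp h0

/-- The trajectories that stay in `[-N, ∞)`, are in `[0, ∞)` from time `n` on, and never jump from
`(-∞, -W)` to `[0, ∞)`. -/
def upcrossing (N W : ℤ) (n : ℕ) : Set Path :=
  {X | (∀ i, -N ≤ X i) ∧ (∀ i, n ≤ i → 0 ≤ X i) ∧ ∀ i, ¬(X i < -W ∧ 0 ≤ X (i + 1))}

lemma measurableSet_upcrossing (N W : ℤ) (n : ℕ) : MeasurableSet (upcrossing N W n) := by
  have h : upcrossing N W n = (⋂ i, (fun X : Path => X i) ⁻¹' Ici (-N)) ∩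
      ((⋂ i, ⋂ (_ : n ≤ i), (fun X : Path => X i) ⁻¹' Ici 0) ∩
        ⋂ i, ((fun X : Path => X i) ⁻¹' Iio (-W) ∩ (fun X : Path => X (i + 1)) ⁻¹' Ici 0)ᶜ) := by
    ext X
    simp [upcrossing]
  have hm : ∀ (i : ℕ) (s : Set ℤ), MeasurableSet ((fun X : Path => X i) ⁻¹' s) := fun i s =>
    measurable_pi_apply i MeasurableSet.of_discrete
  rw [h]
  exact (MeasurableSet.iInter fun i => hm i _).inter
    ((MeasurableSet.iInter fun i => MeasurableSet.iInter fun _ => hm i _).inter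
      (MeasurableSet.iInter fun i => ((hm i _).inter (hm (i + 1) _)).compl))

/-- Replacement of the environment on the negative half-line: if the walk in `ω` can finally stay
in `[0, ∞)` and enters `[0, ∞)` only from sites in `[-W, 0)`, where all cookies equal `μ`, then the
walk in an environment `ω'` that equals `ω` on `[0, ∞)` and `μ` on a sufficiently large interval
`[-N, 0)` can stay in `[-N, ∞)`. The walk in `ω'` imitates the steps from `[0, ∞)` and the entries
into `[0, ∞)`, and replaces the other steps by paths of `μ`-jumps in `[-N, 0)`. -/
lemma confined_pos_of_upcrossing {μ : M1} {B : ℕ} (hB : ∀ s ∈ jumps μ, |s| ≤ B)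
    (hS : AddSubmonoid.closure (jumps μ) = ⊤) {N W : ℤ} (hN : 2 * B + 1 ≤ N) (n : ℕ) {ω ω' : Env}
    (hωω' : ∀ y, 0 ≤ y → ω y = ω' y) (hω : ∀ y, -W ≤ y → y < 0 → ∀ j, ω y j = μ)
    (hω' : ∀ y, -N ≤ y → y < 0 → ∀ j, ω' y j = μ) {x : ℤ} (hx : -N ≤ x)
    (hpos : 0 < quenched ω x (upcrossing N W n)) :
    0 < quenched ω' x (confined (Ici (-N))) := by
  have hcons : ∀ {x : ℤ}, -N ≤ x → confined (Ici (-N)) ⊆ cons x ⁻¹' confined (Ici (-N)) := by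
    intro x hx Y hY i
    cases i with
    | zero => exact hx
    | succ i => exact hY i
  induction n generalizing ω ω' x with
  | zero =>
    refine lt_of_lt_of_le hpos ?_
    calc quenched ω x (upcrossing N W 0) ≤ quenched ω x (confined (Ici 0)) :=
          measure_mono fun X hX i => hX.2.1 i (Nat.zero_le _)
      _ = quenched ω' x (confined (Ici 0)) := quenched_confined_congr (fun y hy => hωω' y hy) x
      _ ≤ quenched ω' x (confined (Ici (-N))) := measure_mono fun X hX i => by
          have := hX i
          simp only [mem_Ici] at *
          omega
  | succ n ih =>
    obtain ⟨z, hz, hpz⟩ := (quenched_pos_iff (measurableSet_upcrossing N W (n + 1))).1 hpos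
    have hpz' : 0 < quenched (eat ω x) (x + z) (upcrossing N W n) := by
      refine lt_of_lt_of_le hpz (measure_mono ?_)
      rintro Y ⟨h1, h2, h3⟩
      exact ⟨fun i => h1 (i + 1), fun i hi => h2 (i + 1) (by omega), fun i => h3 (i + 1)⟩
    obtain ⟨Y, hY, hY0⟩ : ∃ Y, Y ∈ cons x ⁻¹' upcrossing N W (n + 1) ∧ Y 0 = x + z := by
      by_contra! h
      refine hpz.ne' (measure_mono_null (fun Y hY => ?_) (ae_iff.1 (ae_start _ _)))
      exact h Y hY
    have hxz : -N ≤ x + z := hY0 ▸ hY.1 1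
    have hxz' : ¬(x < -W ∧ 0 ≤ x + z) := hY0 ▸ hY.2.2 0
    have heat : ∀ {ω : Env} {L : ℤ}, (∀ y, -L ≤ y → y < 0 → ∀ j, ω y j = μ) → ∀ y, -L ≤ y →
        y < 0 → ∀ j, eat ω x y j = μ := by
      intro ω L h y hy hy0 j
      rw [eat_apply]
      exact h y hy hy0 _
    rcases le_or_gt 0 x with hx0 | hx0
    · rw [quenched_pos_iff (measurableSet_confined _)]
      refine ⟨z, hωω' x hx0 ▸ hz, lt_of_lt_of_le (ih ?_ (heat hω) (heat hω') hxz hpz')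
        (measure_mono (hcons hx))⟩
      intro y hy
      funext j
      rw [eat_apply, eat_apply, hωω' y hy]
    rcases lt_or_ge (x + z) 0 with hz0 | hz0
    · have hq : 0 < quenched ω' (x + z) (confined (Ici (-N))) := by
        refine ih ?_ (heat hω) hω' hxz hpz'
        intro y hy
        rw [eat_of_ne ω (by omega), hωω' y hy]
      have hpath := window_path hB hS (u := -N) (v := -1) (by omega) (p := x) (q := x + z)
        ⟨hx, by omega⟩ ⟨hxz, by omega⟩
      clear hpos hz hpz hpz' hY hY0 hxz hxz' heat hz0 hx0
      generalize x + z = y at hpath hq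
      induction hpath using Relation.ReflTransGen.head_induction_on with
      | refl => exact hq
      | @head p q h _ ih' =>
        obtain ⟨hp, hq', hpq⟩ := h
        have hpμ : ∀ j, ω' p j = μ := hω' p hp.1 (by have := hp.2; omega)
        rw [quenched_pos_iff (measurableSet_confined _)]
        refine ⟨q - p, by rw [hpμ]; exact hpq, ?_⟩
        rw [eat_eq_self hpμ, add_sub_cancel]
        exact lt_of_lt_of_le (ih' hq'.1) (measure_mono (hcons hp.1))
    · rw [quenched_pos_iff (measurableSet_confined _)]
      have e := hω x (by omega) hx0 0
      refine ⟨z, ?_, lt_of_lt_of_le (ih ?_ (heat hω) (heat hω') hxz hpz')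
        (measure_mono (hcons hx))⟩
      · rw [hω' x hx hx0 0, ← e]
        exact hz
      · intro y hy
        rw [eat_of_ne _ (by omega), eat_of_ne _ (by omega), hωω' y hy]

/-! ### Independent environments -/

/-- The environment that equals `ω'` on `(-∞, k)` and the translate of `ω` on `[k, ∞)`. -/
def splice (k : ℤ) (ω' ω : Env) : Env := fun y => if y < k then ω' y else ω (y - k)

lemma splice_of_lt {k y : ℤ} (h : y < k) (ω' ω : Env) : splice k ω' ω y = ω' y := if_pos h

lemma splice_of_le {k y : ℤ} (h : k ≤ y) (ω' ω : Env) : splice k ω' ω y = ω (y - k) :=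
  if_neg (not_lt.2 h)

lemma measurable_splice (k : ℤ) : Measurable fun p : Env × Env => splice k p.1 p.2 := by
  refine measurable_pi_lambda _ fun y => ?_
  unfold splice
  split_ifs <;> fun_prop

/-- The cookie stacks at different sites are independent and identically distributed. -/
def IsIID (η : Measure Env) : Prop :=
  η = Measure.infinitePi fun _ : ℤ => η.map fun ω => ω 0

lemma Assumptions.isIID {η : Measure Env} [IsProbabilityMeasure η] {M : ℕ} {μ : M1}
    (h : Assumptions η M μ) : IsIID η := by
  have h1 := h.indep.map_fun_eq_infinitePi_map fun x => measurable_pi_apply x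
  rw [Measure.map_id'] at h1
  unfold IsIID
  conv_lhs => rw [h1]
  congr 1
  funext x
  exact (h.ident x).map_eq

lemma IsIID.measure_pi {η : Measure Env} [IsProbabilityMeasure η] (h : IsIID η) (s : Finset ℤ)
    {t : ℤ → Set (ℕ → M1)} (ht : ∀ y, MeasurableSet (t y)) :
    η (Set.pi s t) = ∏ y ∈ s, η.map (fun ω => ω 0) (t y) := by
  have : IsProbabilityMeasure (η.map fun ω : Env => ω 0) :=
    Measure.isProbabilityMeasure_map (measurable_pi_apply 0).aemeasurable
  conv_lhs => rw [h]
  exact Measure.infinitePi_pi _ fun y _ => ht y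

/-- An i.i.d. environment keeps its law when an independent copy replaces it on a half-line. -/
lemma IsIID.map_splice {η : Measure Env} [IsProbabilityMeasure η] (h : IsIID η) (k : ℤ) :
    (η.prod η).map (fun p => splice k p.1 p.2) = η := by
  have : IsProbabilityMeasure (η.map fun ω : Env => ω 0) :=
    Measure.isProbabilityMeasure_map (measurable_pi_apply 0).aemeasurable
  conv_rhs => rw [h]
  refine Measure.eq_infinitePi _ fun s t ht => ?_
  rw [Measure.map_apply (measurable_splice k)
    (MeasurableSet.pi s.countable_toSet fun y _ => ht y)]
  have hpre : (fun p : Env × Env => splice k p.1 p.2) ⁻¹' Set.pi s t =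
      Set.pi (s.filter fun y => y < k : Finset ℤ) t ×ˢ
      Set.pi ((s.filter fun y => ¬ y < k).image fun y => y - k : Finset ℤ) fun y => t (y + k) := by
    ext p
    simp only [mem_preimage, Set.mem_pi, Finset.mem_coe, mem_prod, Finset.mem_filter,
      Finset.mem_image, forall_exists_index, and_imp]
    constructor
    · intro hp
      refine ⟨fun y hy hk => ?_, ?_⟩
      · simpa [splice_of_lt hk] using hp y hy
      · rintro _ y hy hk rfl
        simpa [splice_of_le (not_lt.1 hk)] using hp y hy
    · rintro ⟨h1, h2⟩ y hy
      rcases lt_or_ge y k with hk | hk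
      · simpa [splice_of_lt hk] using h1 y hy hk
      · simpa [splice_of_le hk] using h2 (y - k) y hy (not_lt.2 hk) rfl
  rw [hpre, Measure.prod_prod, h.measure_pi _ ht, h.measure_pi _ fun y => ht (y + k),
    Finset.prod_image (by simp)]
  simp only [sub_add_cancel]
  exact Finset.prod_filter_mul_prod_filter_not s _ _

lemma IsIID.map_shiftBy {η : Measure Env} [IsProbabilityMeasure η] (h : IsIID η) (k : ℤ) :
    η.map (shiftBy k) = η := by
  have : IsProbabilityMeasure (η.map fun ω : Env => ω 0) :=
    Measure.isProbabilityMeasure_map (measurable_pi_apply 0).aemeasurable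
  conv_rhs => rw [h]
  refine Measure.eq_infinitePi _ fun s t ht => ?_
  rw [Measure.map_apply (measurable_shiftBy k)
    (MeasurableSet.pi s.countable_toSet fun y _ => ht y)]
  have hpre : shiftBy k ⁻¹' Set.pi s t =
      Set.pi (s.image fun y => y + k : Finset ℤ) fun y => t (y - k) := by
    ext p
    simp only [mem_preimage, Set.mem_pi, Finset.mem_coe, Finset.mem_image, forall_exists_index,
      and_imp]
    constructor
    · rintro hp _ y hy rfl
      simpa [shiftBy] using hp y hy
    · intro hp y hy
      simpa [shiftBy] using hp (y + k) y hy rfl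
  rw [hpre, h.measure_pi _ fun y => ht (y - k), Finset.prod_image (by simp)]
  simp

lemma IsIID.lintegral_splice {η : Measure Env} [IsProbabilityMeasure η] (h : IsIID η) (k : ℤ)
    {Φ : Env → ℝ≥0∞} (hΦ : Measurable Φ) :
    ∫⁻ ω, Φ ω ∂η = ∫⁻ ω', ∫⁻ ω, Φ (splice k ω' ω) ∂η ∂η := by
  conv_lhs => rw [← h.map_splice k]
  have hm : Measurable fun p : Env × Env => Φ (splice k p.1 p.2) := hΦ.comp (measurable_splice k)
  rw [lintegral_map hΦ (measurable_splice k), lintegral_prod _ hm.aemeasurable]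

/-- Laws of (environment, starting point) that resemble the law at the time of a first entrance into
`[0, ∞)` of the walk in an environment with law `η`: the walk starts in `[0, ∞)`, the stacks in
`[0, ∞)` are fresh, that is, independent of everything else and distributed as under `η`, and each
single stack is obtained from a stack under `η` by removal of at most `M` cookies. The last property
is expressed by an inequality of measures, which is stable under weak limits. -/
structure Admissible (η : Measure Env) (M : ℕ) (α : Measure (Env × ℤ)) : Prop where
  prob : IsProbabilityMeasure α
  nonneg : ∀ᵐ p ∂α, 0 ≤ p.2
  fresh : ∀ Φ : Env × ℤ → ℝ≥0∞, Measurable Φ →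
    ∫⁻ p, Φ p ∂α = ∫⁻ p, ∫⁻ ω, Φ (splice 0 p.1 ω, p.2) ∂η ∂α
  dominated : ∀ (y : ℤ) (S : Set (ℕ → M1)), MeasurableSet S →
    α {p | p.1 y ∈ S} ≤ ∑ l ∈ Finset.range (M + 1), η {ω | (fun j => ω 0 (l + j)) ∈ S}

lemma splice_splice {k : ℤ} (hk : 0 ≤ k) (ω₁ ω₂ ω₃ : Env) :
    splice 0 ω₁ (splice k ω₂ ω₃) = splice k (splice 0 ω₁ ω₂) ω₃ := by
  funext y
  rcases lt_or_ge y 0 with h | h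
  · rw [splice_of_lt h, splice_of_lt (by omega), splice_of_lt h]
  · rw [splice_of_le h, sub_zero]
    rcases lt_or_ge y k with h' | h'
    · rw [splice_of_lt h', splice_of_lt h', splice_of_le h, sub_zero]
    · rw [splice_of_le h', splice_of_le h']

variable {η : Measure Env} {M : ℕ} {α : Measure (Env × ℤ)}

/-- The stacks in `[k, ∞)` are fresh for every `k ≥ 0`. -/
lemma Admissible.fresh_at [IsProbabilityMeasure η] (hα : Admissible η M α) (hη : IsIID η) {k : ℤ}
    (hk : 0 ≤ k) {Φ : Env × ℤ → ℝ≥0∞} (hΦ : Measurable Φ) :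
    ∫⁻ p, Φ p ∂α = ∫⁻ p, ∫⁻ ω, Φ (splice k p.1 ω, p.2) ∂η ∂α := by
  have hm : Measurable fun q : (Env × ℤ) × Env => Φ (splice k q.1.1 q.2, q.1.2) :=
    hΦ.comp (((measurable_splice k).comp
      ((measurable_fst.comp measurable_fst).prodMk measurable_snd)).prodMk
        (measurable_snd.comp measurable_fst))
  rw [hα.fresh _ hm.lintegral_prod_right', hα.fresh Φ hΦ]
  refine lintegral_congr fun p => ?_
  rw [hη.lintegral_splice k]
  · simp only [splice_splice hk]
  · exact hΦ.comp (((measurable_splice 0).comp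
      (measurable_const.prodMk measurable_id)).prodMk measurable_const)

/-- The part of the environment in `(-∞, k)` and the starting point are independent of the part of
the environment in `[k, ∞)`. -/
lemma Admissible.lintegral_mul [IsProbabilityMeasure η] (hα : Admissible η M α) (hη : IsIID η)
    {k : ℤ} (hk : 0 ≤ k) {F : Env × ℤ → ℝ≥0∞} (hF : Measurable F)
    (hFdep : ∀ ω ω' x, (∀ y < k, ω y = ω' y) → F (ω, x) = F (ω', x)) {H : Env → ℝ≥0∞}
    (hH : Measurable H) (hHdep : ∀ ω ω', (∀ y, 0 ≤ y → ω y = ω' y) → H ω = H ω') :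
    ∫⁻ p, F p * H (shiftBy k p.1) ∂α = (∫⁻ p, F p ∂α) * ∫⁻ ω, H ω ∂η := by
  have hm : Measurable fun p : Env × ℤ => F p * H (shiftBy k p.1) :=
    hF.mul (hH.comp ((measurable_shiftBy k).comp measurable_fst))
  rw [hα.fresh_at hη hk hm]
  have h : ∀ p : Env × ℤ, ∀ ω, F (splice k p.1 ω, p.2) * H (shiftBy k (splice k p.1 ω)) =
      F p * H ω := by
    intro p ω
    rw [hFdep (splice k p.1 ω) p.1 p.2 fun y hy => splice_of_lt hy _ _,
      hHdep (shiftBy k (splice k p.1 ω)) ω fun y hy => ?_]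
    unfold shiftBy
    rw [splice_of_le (by omega), add_sub_cancel_right]
  simp_rw [h]
  simp_rw [lintegral_const_mul _ hH]
  rw [lintegral_mul_const _ hF]

/-- The law of the environment in `[k, ∞)` under an admissible law. -/
lemma Admissible.lintegral_shiftBy [IsProbabilityMeasure η] (hα : Admissible η M α) (hη : IsIID η)
    {k : ℤ} (hk : 0 ≤ k) {H : Env → ℝ≥0∞}
    (hH : Measurable H) (hHdep : ∀ ω ω', (∀ y, 0 ≤ y → ω y = ω' y) → H ω = H ω') :
    ∫⁻ p, H (shiftBy k p.1) ∂α = ∫⁻ ω, H ω ∂η := by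
  have := hα.prob
  simpa using hα.lintegral_mul hη hk (F := fun _ => 1) measurable_const (fun _ _ _ _ => rfl) hH
    hHdep

lemma fromZero_eq_map [SFinite η] : fromZero η = η.map fun ω => (ω, (0 : ℤ)) :=
  Measure.prod_dirac 0

lemma admissible_fromZero [IsProbabilityMeasure η] (hη : IsIID η) :
    Admissible η M (fromZero η) where
  prob := by unfold fromZero; infer_instance
  nonneg := by
    have hm : MeasurableSet {p : Env × ℤ | 0 ≤ p.2} := measurable_snd measurableSet_Ici
    rw [fromZero_eq_map, ae_map_iff measurable_prodMk_right.aemeasurable hm]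
    exact ae_of_all _ fun _ => le_rfl
  fresh Φ hΦ := by
    have hm : Measurable fun q : (Env × ℤ) × Env => Φ (splice 0 q.1.1 q.2, q.1.2) :=
      hΦ.comp (((measurable_splice 0).comp
        ((measurable_fst.comp measurable_fst).prodMk measurable_snd)).prodMk
          (measurable_snd.comp measurable_fst))
    rw [fromZero_eq_map, lintegral_map hΦ measurable_prodMk_right,
      lintegral_map hm.lintegral_prod_right' measurable_prodMk_right]
    exact hη.lintegral_splice 0 (Φ := fun ω => Φ (ω, 0)) (hΦ.comp measurable_prodMk_right)
  dominated y S hS := by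
    have hm : MeasurableSet {p : Env × ℤ | p.1 y ∈ S} :=
      ((measurable_pi_apply y).comp measurable_fst) hS
    have hm0 : MeasurableSet {ω : Env | ω 0 ∈ S} := (measurable_pi_apply 0) hS
    rw [fromZero_eq_map, Measure.map_apply measurable_prodMk_right hm]
    refine le_trans (le_of_eq ?_) (Finset.single_le_sum (fun _ _ => zero_le)
      (Finset.mem_range.2 (Nat.succ_pos M)))
    conv_rhs => rw [← hη.map_shiftBy y]
    simp only [zero_add]
    rw [Measure.map_apply (measurable_shiftBy y) hm0]
    simp [shiftBy]

/-! ### Averaged laws -/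

lemma averaged_apply (α : Measure (Env × ℤ)) {A : Set Path} (hA : MeasurableSet A) :
    averaged α A = ∫⁻ p, quenched p.1 p.2 A ∂α :=
  Measure.bind_apply hA walkKernel.measurable.aemeasurable

lemma lintegral_averaged (α : Measure (Env × ℤ)) {F : Path → ℝ≥0∞} (hF : Measurable F) :
    ∫⁻ X, F X ∂(averaged α) = ∫⁻ p, ∫⁻ X, F X ∂(quenched p.1 p.2) ∂α :=
  Measure.lintegral_bind walkKernel.measurable.aemeasurable hF.aemeasurable

instance (α : Measure (Env × ℤ)) [IsProbabilityMeasure α] : IsProbabilityMeasure (averaged α) := by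
  unfold averaged; infer_instance

lemma measurable_quenched_apply {A : Set Path} (hA : MeasurableSet A) :
    Measurable fun p : Env × ℤ => quenched p.1 p.2 A :=
  (Measure.measurable_coe hA).comp measurable_quenched

lemma averaged_eq_zero_iff (α : Measure (Env × ℤ)) {A : Set Path} (hA : MeasurableSet A) :
    averaged α A = 0 ↔ ∀ᵐ p ∂α, quenched p.1 p.2 A = 0 := by
  rw [averaged_apply α hA, lintegral_eq_zero_iff (measurable_quenched_apply hA)]
  rfl

/-! ### Moments of the cookies -/

/-- Distributions on `ℤ` whose positive part has a finite mean, which is at least the mean of the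
negative part. This is `meanNonneg`, expressed by integrals in `ℝ≥0∞`. -/
def upward : Set M1 :=
  {ν | ∫⁻ z : ℤ, (z.toNat : ℝ≥0∞) ∂(ν : Measure ℤ) < ∞ ∧
    ∫⁻ z : ℤ, ((-z).toNat : ℝ≥0∞) ∂(ν : Measure ℤ) ≤ ∫⁻ z : ℤ, (z.toNat : ℝ≥0∞) ∂(ν : Measure ℤ)}

lemma ofReal_intCast (z : ℤ) : ENNReal.ofReal (z : ℝ) = (z.toNat : ℝ≥0∞) := by
  rcases le_total 0 z with h | h
  · lift z to ℕ using h
    simp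
  · rw [Int.toNat_of_nonpos h, ENNReal.ofReal_of_nonpos (by exact_mod_cast h)]
    simp

lemma toNat_le_enorm (z : ℤ) : (z.toNat : ℝ≥0∞) ≤ ‖(z : ℝ)‖ₑ := by
  rw [← ofReal_intCast]
  exact Real.ofReal_le_enorm _

lemma mem_upward {ν : M1} (h : ν ∈ meanNonneg) : ν ∈ upward := by
  obtain ⟨hi, h0⟩ := h
  have hp : ∫⁻ z : ℤ, (z.toNat : ℝ≥0∞) ∂(ν : Measure ℤ) < ∞ :=
    (lintegral_mono fun z => toNat_le_enorm z).trans_lt hi.2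
  have hn : ∫⁻ z : ℤ, ((-z).toNat : ℝ≥0∞) ∂(ν : Measure ℤ) < ∞ := by
    refine (lintegral_mono fun z => ?_).trans_lt hi.2
    simpa using toNat_le_enorm (-z)
  refine ⟨hp, ?_⟩
  unfold drift at h0
  rw [integral_eq_lintegral_pos_part_sub_lintegral_neg_part hi] at h0
  have e : ∀ z : ℤ, ENNReal.ofReal (-(z : ℝ)) = ((-z).toNat : ℝ≥0∞) := fun z => by
    rw [← ofReal_intCast]; push_cast; rfl
  simp_rw [ofReal_intCast, e] at h0
  exact (ENNReal.toReal_le_toReal hn.ne hp.ne).1 (by linarith)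

lemma measurable_lintegral_M1 (φ : ℤ → ℝ≥0∞) :
    Measurable fun ν : M1 => ∫⁻ z, φ z ∂(ν : Measure ℤ) :=
  (Measure.measurable_lintegral (measurable_of_countable φ)).comp measurable_subtype_coe

lemma measurableSet_upward : MeasurableSet upward :=
  (measurableSet_lt (measurable_lintegral_M1 _) measurable_const).inter
    (measurableSet_le (measurable_lintegral_M1 _) (measurable_lintegral_M1 _))

/-- Environments all of whose cookies have upward drift, with at most `M` cookies per site that
differ from `μ`. -/
def niceEnv (M : ℕ) (μ : M1) : Set Env :=
  {ω | ∀ y, (∀ j, ω y j ∈ upward) ∧ ∀ j, M ≤ j → ω y j = μ}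

variable {μ : M1}

lemma Assumptions.mem_upward (hA : Assumptions η M μ) : μ ∈ upward :=
  ExcitedWalk.mem_upward ⟨hA.mean_zero.1, hA.mean_zero.2.ge⟩

lemma Assumptions.ae_upward (hA : Assumptions η M μ) : ∀ᵐ ω ∂η, ∀ y j, ω y j ∈ upward := by
  filter_upwards [hA.mem_envSet] with ω hω y j
  rcases lt_or_ge j M with h | h
  · exact ExcitedWalk.mem_upward ((hω y).1 j h)
  · rw [(hω y).2 j h]
    exact hA.mem_upward

lemma Admissible.ae_niceEnv (hα : Admissible η M α) (hA : Assumptions η M μ) :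
    ∀ᵐ p ∂α, p.1 ∈ niceEnv M μ := by
  rw [show (fun p : Env × ℤ => p.1 ∈ niceEnv M μ) =
    fun p : Env × ℤ => ∀ y, (∀ j, p.1 y j ∈ upward) ∧ ∀ j, M ≤ j → p.1 y j = μ from rfl,
    ae_all_iff]
  intro y
  have hS : MeasurableSet {s : ℕ → M1 | (∀ j, s j ∈ upward) ∧ ∀ j, M ≤ j → s j = μ} := by
    have h1 : MeasurableSet {s : ℕ → M1 | ∀ j, s j ∈ upward} := by
      rw [ofPred_forall]
      exact MeasurableSet.iInter fun j => measurable_pi_apply j measurableSet_upward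
    have h2 : MeasurableSet {s : ℕ → M1 | ∀ j, M ≤ j → s j = μ} := by
      simp_rw [ofPred_forall]
      exact MeasurableSet.iInter fun j => MeasurableSet.iInter fun _ =>
        (measurable_pi_apply j : Measurable fun s : ℕ → M1 => s j) (measurableSet_singleton μ)
    exact h1.inter h2
  have h := hα.dominated y _ hS.compl
  rw [Finset.sum_eq_zero, nonpos_iff_eq_zero] at h
  · exact h
  · intro l _
    have : ∀ᵐ ω ∂η, (∀ j, ω 0 (l + j) ∈ upward) ∧ ∀ j, M ≤ j → ω 0 (l + j) = μ := by
      filter_upwards [hA.ae_upward, hA.mem_envSet] with ω h1 h2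
      exact ⟨fun j => h1 0 _, fun j hj => (h2 0).2 _ (by omega)⟩
    exact this

/-- The sum over `l ≤ M` and `j < M` of the averaged step distributions of the `j`-th cookies left
after removal of `l` cookies. -/
def intensity (η : Measure Env) (M : ℕ) : Measure ℤ :=
  ∑ l ∈ Finset.range (M + 1), ∑ j ∈ Finset.range M, η.bind fun ω => (ω 0 (l + j) : Measure ℤ)

lemma measurable_cookie (y : ℤ) (j : ℕ) : Measurable fun ω : Env => (ω y j : Measure ℤ) :=
  measurable_subtype_coe.comp ((measurable_pi_apply j).comp (measurable_pi_apply y))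

lemma lintegral_intensity (φ : ℤ → ℝ≥0∞) :
    ∫⁻ z, φ z ∂(intensity η M) = ∑ l ∈ Finset.range (M + 1), ∑ j ∈ Finset.range M,
      ∫⁻ ω, ∫⁻ z, φ z ∂(ω 0 (l + j) : Measure ℤ) ∂η := by
  unfold intensity
  rw [lintegral_finsetSum_measure]
  refine Finset.sum_congr rfl fun l _ => ?_
  rw [lintegral_finsetSum_measure]
  refine Finset.sum_congr rfl fun j _ => ?_
  exact Measure.lintegral_bind (measurable_cookie 0 (l + j)).aemeasurable
    (measurable_of_countable φ).aemeasurable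

lemma Admissible.lintegral_stack_le (hα : Admissible η M α) (y : ℤ) {g : (ℕ → M1) → ℝ≥0∞}
    (hg : Measurable g) :
    ∫⁻ p, g (p.1 y) ∂α ≤ ∑ l ∈ Finset.range (M + 1), ∫⁻ ω, g (fun j => ω 0 (l + j)) ∂η := by
  have hm : ∀ l, Measurable fun ω : Env => fun j => ω 0 (l + j) := fun l => by fun_prop
  have hy : Measurable fun p : Env × ℤ => p.1 y := by fun_prop
  have h : α.map (fun p => p.1 y) ≤
      ∑ l ∈ Finset.range (M + 1), η.map fun ω j => ω 0 (l + j) := by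
    refine Measure.le_iff.2 fun S hS => ?_
    rw [Measure.map_apply hy hS, Measure.finsetSum_apply]
    refine (hα.dominated y S hS).trans (le_of_eq (Finset.sum_congr rfl fun l _ => ?_))
    rw [Measure.map_apply (hm l) hS]
    rfl
  rw [← lintegral_map hg hy]
  refine (lintegral_mono' h le_rfl).trans (le_of_eq ?_)
  rw [lintegral_finsetSum_measure]
  exact Finset.sum_congr rfl fun l _ => lintegral_map hg (hm l)

lemma Admissible.lintegral_cookies_le (hα : Admissible η M α) (y : ℤ) (φ : ℤ → ℝ≥0∞) :
    ∫⁻ p, ∑ j ∈ Finset.range M, ∫⁻ z, φ z ∂(p.1 y j : Measure ℤ) ∂α ≤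
      ∫⁻ z, φ z ∂(intensity η M) := by
  have hg : ∀ j, Measurable fun s : ℕ → M1 => ∫⁻ z, φ z ∂(s j : Measure ℤ) := fun j =>
    (measurable_lintegral_M1 φ).comp (measurable_pi_apply j)
  refine (hα.lintegral_stack_le y (g := fun s => ∑ j ∈ Finset.range M,
    ∫⁻ z, φ z ∂(s j : Measure ℤ)) (Finset.measurable_sum _ fun j _ => hg j)).trans (le_of_eq ?_)
  rw [lintegral_intensity]
  refine Finset.sum_congr rfl fun l _ => ?_
  exact lintegral_finsetSum _ fun j _ =>
    (hg j).comp (by fun_prop : Measurable fun ω : Env => fun j => ω 0 (l + j))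

lemma Assumptions.lintegral_intensity_lt_top [IsProbabilityMeasure η] (hA : Assumptions η M μ) :
    ∫⁻ z : ℤ, (z.toNat : ℝ≥0∞) ∂(intensity η M) < ∞ := by
  rw [lintegral_intensity]
  refine ENNReal.sum_lt_top.2 fun l _ => ENNReal.sum_lt_top.2 fun j _ => ?_
  rcases lt_or_ge (l + j) M with h | h
  · refine lt_of_le_of_lt (lintegral_mono fun ω => ?_) hA.moment
    refine le_trans (lintegral_mono fun z => toNat_le_enorm z) ?_
    exact Finset.single_le_sum (f := fun j => ∫⁻ z : ℤ, ‖(z : ℝ)‖ₑ ∂(ω 0 j : Measure ℤ))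
      (fun _ _ => zero_le) (Finset.mem_range.2 h)
  · have : (fun ω : Env => ∫⁻ z : ℤ, (z.toNat : ℝ≥0∞) ∂(ω 0 (l + j) : Measure ℤ)) =ᵐ[η]
        fun _ => ∫⁻ z : ℤ, (z.toNat : ℝ≥0∞) ∂(μ : Measure ℤ) := by
      filter_upwards [hA.mem_envSet] with ω hω
      rw [(hω 0).2 _ h]
    rw [lintegral_congr_ae this]
    simpa using hA.mem_upward.1

/-- The expected excess of the jumps over `s`, summed over the cookies of a stack. It bounds the
probability that the walk ever jumps from `(-∞, k)` to `[k + s, ∞)`. -/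
def excess (η : Measure Env) (M : ℕ) (s : ℤ) : ℝ≥0∞ :=
  ∫⁻ z : ℤ, ((z - s).toNat : ℝ≥0∞) ∂(intensity η M)

lemma excess_antitone : Antitone (excess η M) := by
  intro s t hst
  refine lintegral_mono fun z => ?_
  exact Nat.cast_le.2 (Int.toNat_le_toNat (by omega))

lemma excess_zero_lt_top [IsProbabilityMeasure η] (hA : Assumptions η M μ) :
    excess η M 0 < ∞ := by
  simpa [excess] using hA.lintegral_intensity_lt_top

lemma tendsto_excess [IsProbabilityMeasure η] (hA : Assumptions η M μ) :
    Tendsto (fun n : ℕ => excess η M n) atTop (𝓝 0) := by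
  have h := tendsto_lintegral_of_dominated_convergence (μ := intensity η M)
    (F := fun (n : ℕ) (z : ℤ) => ((z - n).toNat : ℝ≥0∞)) (f := fun _ => 0)
    (fun z => (z.toNat : ℝ≥0∞)) (fun n => measurable_of_countable _)
    (fun n => ae_of_all _ fun z => Nat.cast_le.2 (Int.toNat_le_toNat (by omega)))
    hA.lintegral_intensity_lt_top.ne
    (ae_of_all _ fun z => by
      refine tendsto_const_nhds.congr' ?_
      filter_upwards [eventually_ge_atTop z.toNat] with n hn
      rw [Int.toNat_of_nonpos (by omega)]
      simp)
  simpa [excess] using h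

lemma exists_excess_lt [IsProbabilityMeasure η] (hA : Assumptions η M μ) {ε : ℝ≥0∞} (hε : 0 < ε)
    (n₀ : ℕ) : ∃ n : ℕ, n₀ ≤ n ∧ excess η M n < ε := by
  obtain ⟨n, h1, h2⟩ := ((eventually_ge_atTop n₀).and
    ((tendsto_excess hA).eventually (gt_mem_nhds hε))).exists
  exact ⟨n, h1, h2⟩

lemma Admissible.lintegral_cookieSum_le (hα : Admissible η M α) (hA : Assumptions η M μ)
    {B : ℕ} (hB : ∀ s ∈ jumps μ, |s| ≤ B) {f : ℤ → ℤ → ℝ≥0∞}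
    (hf : ∀ y z : ℤ, z ≤ B → f y (y + z) = 0) :
    ∫⁻ p, cookieSum f p.1 ∂α ≤ ∑' y, ∫⁻ z, f y (y + z) ∂(intensity η M) := by
  have h : ∀ᵐ p ∂α, cookieSum f p.1 =
      ∑' y, ∑ j ∈ Finset.range M, ∫⁻ z, f y (y + z) ∂(p.1 y j : Measure ℤ) := by
    filter_upwards [hα.ae_niceEnv hA] with p hp
    refine tsum_congr fun y => tsum_eq_sum fun j hj => ?_
    rw [(hp y).2 j (by simpa using hj), lintegral_congr_ae (g := fun _ => 0)]
    · simp
    · filter_upwards [ae_mem_jumps μ] with z hz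
      exact hf y z ((le_abs_self z).trans (hB z hz))
  rw [lintegral_congr_ae h, lintegral_tsum]
  · exact ENNReal.tsum_le_tsum fun y => hα.lintegral_cookies_le y fun z => f y (y + z)
  · intro y
    refine (Finset.measurable_sum _ fun j _ => ?_).aemeasurable
    exact (measurable_lintegral_M1 _).comp
      ((measurable_pi_apply j).comp ((measurable_pi_apply y).comp measurable_fst))

/-- The indicator function of the jumps from `(-∞, k)` to `[k + s, ∞)`. -/
def longJump (k s y y' : ℤ) : ℝ≥0∞ := if y < k ∧ k + s ≤ y' then 1 else 0

/-- A jump `z` crosses in this way from exactly `(z - s)⁺` sites. -/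
lemma tsum_lintegral_longJump (ρ : Measure ℤ) (k s : ℤ) :
    ∑' y : ℤ, ∫⁻ z, longJump k s y (y + z) ∂ρ = ∫⁻ z : ℤ, ((z - s).toNat : ℝ≥0∞) ∂ρ := by
  unfold longJump
  rw [← lintegral_tsum fun y => (measurable_of_countable _).aemeasurable]
  refine lintegral_congr fun z => ?_
  rw [tsum_eq_sum (s := Finset.Ico (k + s - z) k)]
  · rw [Finset.sum_congr rfl fun y hy => if_pos ?_]
    · simp only [Finset.sum_const, Int.card_Ico, nsmul_eq_mul, mul_one]
      congr 2
      ring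
    · rw [Finset.mem_Ico] at hy
      omega
  · intro y hy
    rw [Finset.mem_Ico] at hy
    exact if_neg (by omega)

/-- A bound on the expected number of jumps from `(-∞, k)` to `[k + s, ∞)`, since `cookieSum` counts
the jumps as if every cookie were used. If `s ≥ B` then the cookies equal to `μ` do not contribute,
so that at most `M` cookies per site do. -/
lemma Admissible.lintegral_cookieSum_longJump_le (hα : Admissible η M α) (hA : Assumptions η M μ)
    {B : ℕ} (hB : ∀ s ∈ jumps μ, |s| ≤ B) (k : ℤ) {s : ℤ} (hs : B ≤ s) :
    ∫⁻ p, cookieSum (longJump k s) p.1 ∂α ≤ excess η M s := by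
  refine (hα.lintegral_cookieSum_le hA hB fun y z hz => if_neg (by omega)).trans (le_of_eq ?_)
  exact tsum_lintegral_longJump _ k s

/-! ### The walk stopped at the exit from an interval -/

open Classical in
/-- The position at time `n` of the walk stopped at the first exit from `I`. -/
def stopped (I : Set ℤ) : ℕ → Path → ℤ
  | 0, X => X 0
  | n + 1, X => if X 0 ∈ I then stopped I n fun i => X (i + 1) else X 0

lemma stopped_succ_cons_of_mem {I : Set ℤ} {x : ℤ} (h : x ∈ I) (n : ℕ) (Y : Path) :
    stopped I (n + 1) (cons x Y) = stopped I n Y := if_pos h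

lemma stopped_cons_of_notMem {I : Set ℤ} {x : ℤ} (h : x ∉ I) (n : ℕ) (Y : Path) :
    stopped I n (cons x Y) = x := by
  cases n
  · rfl
  · exact if_neg h

lemma measurable_stopped (I : Set ℤ) (n : ℕ) : Measurable (stopped I n) := by
  induction n with
  | zero => exact measurable_pi_apply 0
  | succ n ih =>
    refine Measurable.ite ?_ (ih.comp (by fun_prop)) (measurable_pi_apply 0)
    exact (measurable_pi_apply 0 : Measurable fun X : Path => X 0) MeasurableSet.of_discrete

lemma stopped_eq {I : Set ℤ} (n : ℕ) {X : Path} (h : ∀ i < n, X i ∈ I) : stopped I n X = X n := by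
  induction n generalizing X with
  | zero => rfl
  | succ n ih =>
    rw [stopped, if_pos (h 0 n.succ_pos)]
    exact ih fun i hi => h (i + 1) (by omega)

lemma stopped_succ_of_notMem {I : Set ℤ} (n : ℕ) {X : Path} (h : stopped I n X ∉ I) :
    stopped I (n + 1) X = stopped I n X := by
  induction n generalizing X with
  | zero => exact if_neg h
  | succ n ih =>
    by_cases h0 : X 0 ∈ I
    · have e : ∀ m, stopped I (m + 1) X = stopped I m fun i => X (i + 1) := fun m => if_pos h0
      rw [e n] at h
      rw [e (n + 1), e n]
      exact ih h
    · have e : ∀ m, stopped I (m + 1) X = X 0 := fun m => if_neg h0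
      rw [e, e]

lemma apply_stopped_le {I : Set ℤ} (φ : ℤ → ℝ≥0∞) (n : ℕ) (X : Path) :
    φ (stopped I n X) ≤
      φ (X 0) + ∑' i, I.indicator (fun _ => φ (X (i + 1))) (X i) := by
  induction n generalizing X with
  | zero => exact le_self_add
  | succ n ih =>
    rw [stopped]
    split_ifs with h
    · refine (ih _).trans ?_
      rw [tsum_eq_zero_add' (f := fun i => I.indicator (fun _ => φ (X (i + 1))) (X i))
        ENNReal.summable, indicator_of_mem h]
      exact le_add_self
    · exact le_self_add

lemma measurable_toNat_comp {g : Path → ℤ} (hg : Measurable g) :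
    Measurable fun X => ((g X).toNat : ℝ≥0∞) :=
  (measurable_of_countable fun z : ℤ => (z.toNat : ℝ≥0∞)).comp hg

/-- One step with a cookie of upward drift does not decrease the mean. -/
lemma lintegral_step {ν : M1} (h : ν ∈ upward) (x : ℤ) :
    ∫⁻ z : ℤ, ((-(x + z)).toNat : ℝ≥0∞) ∂(ν : Measure ℤ) + x.toNat ≤
      ∫⁻ z : ℤ, ((x + z).toNat : ℝ≥0∞) ∂(ν : Measure ℤ) + (-x).toNat := by
  have hp : ∀ z : ℤ, ((-(x + z)).toNat : ℝ≥0∞) + x.toNat + z.toNat =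
      (x + z).toNat + (-x).toNat + (-z).toNat := fun z => by
    have : (-(x + z)).toNat + x.toNat + z.toNat = (x + z).toNat + (-x).toNat + (-z).toNat := by
      omega
    exact_mod_cast this
  have hi := lintegral_congr (μ := (ν : Measure ℤ)) hp
  have hm : ∀ g : ℤ → ℝ≥0∞, Measurable g := fun g => measurable_of_countable g
  rw [lintegral_add_left (hm _), lintegral_add_left (hm _), lintegral_add_left (hm _),
    lintegral_add_left (hm _)] at hi
  simp only [lintegral_const, measure_univ, mul_one] at hi
  refine (ENNReal.add_le_add_iff_right h.1.ne).1 ?_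
  rw [hi]
  exact add_le_add le_rfl h.2

lemma lintegral_toNat_add_lt_top {ν : M1} (h : ν ∈ upward) (x : ℤ) :
    ∫⁻ z : ℤ, ((x + z).toNat : ℝ≥0∞) ∂(ν : Measure ℤ) < ∞ := by
  have hle : ∫⁻ z : ℤ, ((x + z).toNat : ℝ≥0∞) ∂(ν : Measure ℤ) ≤
      ∫⁻ z : ℤ, ((x.toNat : ℝ≥0∞) + z.toNat) ∂(ν : Measure ℤ) := by
    refine lintegral_mono fun z => ?_
    have : (x + z).toNat ≤ x.toNat + z.toNat := by omega
    simpa using Nat.cast_le (α := ℝ≥0∞).2 this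
  refine hle.trans_lt ?_
  rw [lintegral_add_left measurable_const]
  simpa using h.1

/-- Optional stopping: the mean of the stopped walk is at least its starting point. Positive and
negative parts are kept apart, so that no integrability is needed. -/
lemma lintegral_stopped (I : Set ℤ) (n : ℕ) {ω : Env} (hω : ∀ y j, ω y j ∈ upward) (x : ℤ) :
    ∫⁻ X, ((-stopped I n X).toNat : ℝ≥0∞) ∂(quenched ω x) + x.toNat ≤
      ∫⁻ X, ((stopped I n X).toNat : ℝ≥0∞) ∂(quenched ω x) + (-x).toNat := by
  have hm1 : ∀ n, Measurable fun X => ((-stopped I n X).toNat : ℝ≥0∞) := fun n =>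
    measurable_toNat_comp (measurable_stopped I n).neg
  have hm2 : ∀ n, Measurable fun X => ((stopped I n X).toNat : ℝ≥0∞) := fun n =>
    measurable_toNat_comp (measurable_stopped I n)
  by_cases hx : x ∈ I
  swap
  · rw [lintegral_quenched ω x (hm1 n), lintegral_quenched ω x (hm2 n)]
    simp only [stopped_cons_of_notMem hx, lintegral_const, measure_univ, mul_one]
    rw [add_comm]
  induction n generalizing ω x with
  | zero =>
    have e1 : ∀ᵐ X ∂(quenched ω x), stopped I 0 X = x := ae_start ω x
    have e2 : (fun X => ((-stopped I 0 X).toNat : ℝ≥0∞)) =ᵐ[quenched ω x]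
        fun _ => ((-x).toNat : ℝ≥0∞) := by
      filter_upwards [e1] with X hX; rw [hX]
    have e3 : (fun X => ((stopped I 0 X).toNat : ℝ≥0∞)) =ᵐ[quenched ω x]
        fun _ => (x.toNat : ℝ≥0∞) := by
      filter_upwards [e1] with X hX; rw [hX]
    rw [lintegral_congr_ae e2, lintegral_congr_ae e3]
    simp [add_comm]
  | succ n ih =>
    have heat : ∀ y j, eat ω x y j ∈ upward := fun y j => by rw [eat_apply]; exact hω _ _
    have ih' : ∀ z : ℤ, ∫⁻ X, ((-stopped I n X).toNat : ℝ≥0∞) ∂(quenched (eat ω x) (x + z)) +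
        (x + z).toNat ≤ ∫⁻ X, ((stopped I n X).toNat : ℝ≥0∞) ∂(quenched (eat ω x) (x + z)) +
          (-(x + z)).toNat := by
      intro z
      by_cases hz : x + z ∈ I
      · exact ih heat _ hz
      · rw [lintegral_quenched _ _ (hm1 n), lintegral_quenched _ _ (hm2 n)]
        simp only [stopped_cons_of_notMem hz, lintegral_const, measure_univ, mul_one]
        rw [add_comm]
    rw [lintegral_quenched ω x (hm1 _), lintegral_quenched ω x (hm2 _)]
    simp only [stopped_succ_cons_of_mem hx]
    have h1 := lintegral_mono (μ := (ω x 0 : Measure ℤ)) ih'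
    rw [lintegral_add_left (measurable_of_countable _),
      lintegral_add_left (measurable_of_countable _)] at h1
    have h2 := lintegral_step (hω x 0) x
    have hp := (lintegral_toNat_add_lt_top (hω x 0) x).ne
    have hq : ∫⁻ z : ℤ, ((-(x + z)).toNat : ℝ≥0∞) ∂(ω x 0 : Measure ℤ) ≠ ∞ := by
      refine (lt_of_le_of_lt (le_self_add.trans h2) ?_).ne
      exact ENNReal.add_lt_top.2 ⟨hp.lt_top, ENNReal.natCast_lt_top _⟩
    refine (ENNReal.add_le_add_iff_right (ENNReal.add_ne_top.2 ⟨hp, hq⟩)).1 ?_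
    calc _ = (∫⁻ z : ℤ, (∫⁻ Y, ((-stopped I n Y).toNat : ℝ≥0∞) ∂(quenched (eat ω x) (x + z)))
            ∂(ω x 0 : Measure ℤ) + ∫⁻ z : ℤ, ((x + z).toNat : ℝ≥0∞) ∂(ω x 0 : Measure ℤ)) +
          (∫⁻ z : ℤ, ((-(x + z)).toNat : ℝ≥0∞) ∂(ω x 0 : Measure ℤ) + x.toNat) := by ring
      _ ≤ _ := add_le_add h1 h2
      _ = _ := by ring

/-- The probability of leaving `(-L, k)` to the left: the mean of the position at the exit from
`(-L, k)` is nonnegative, so that this probability is bounded by the mean positive part over `L`. -/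
lemma quenched_stopped_le {ω : Env} (hω : ∀ y j, ω y j ∈ upward) (k L : ℤ) (B n : ℕ)
    {x : ℤ} (hx0 : 0 ≤ x) (hxk : x < k) :
    (L.toNat : ℝ≥0∞) * quenched ω x {X | stopped (Ioo (-L) k) n X ≤ -L} ≤ (k.toNat + B : ℕ) +
      cookieSum (fun y y' => if y ∈ Ioo (-L) k then ((y' - k - B).toNat : ℝ≥0∞) else 0) ω := by
  classical
  set I := Ioo (-L) k
  have hs := lintegral_stopped I n hω x
  have hm : Measurable fun X => ((-stopped I n X).toNat : ℝ≥0∞) :=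
    measurable_toNat_comp (measurable_stopped I n).neg
  have h1 : (L.toNat : ℝ≥0∞) * quenched ω x {X | stopped I n X ≤ -L} ≤
      ∫⁻ X, ((-stopped I n X).toNat : ℝ≥0∞) ∂(quenched ω x) := by
    refine le_trans ?_ (mul_meas_ge_le_lintegral hm (L.toNat : ℝ≥0∞))
    gcongr
    intro h
    exact Nat.cast_le.2 (Int.toNat_le_toNat (le_neg_of_le_neg h))
  have h2 : ∫⁻ X, ((stopped I n X).toNat : ℝ≥0∞) ∂(quenched ω x) ≤ (k.toNat + B : ℕ) +
      cookieSum (fun y y' => if y ∈ I then ((y' - k - B).toNat : ℝ≥0∞) else 0) ω := by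
    calc ∫⁻ X, ((stopped I n X).toNat : ℝ≥0∞) ∂(quenched ω x)
        ≤ ∫⁻ X, ((k.toNat + B : ℕ) + ∑' i, (if X i ∈ I then ((X (i + 1) - k - B).toNat : ℝ≥0∞)
          else 0)) ∂(quenched ω x) := by
          refine lintegral_mono_ae ?_
          filter_upwards [ae_start ω x] with X hX
          have h := apply_stopped_le (I := I) (fun y => ((y - k - B).toNat : ℝ≥0∞)) n X
          rw [hX, Int.toNat_of_nonpos (by omega : x - k - B ≤ 0), Nat.cast_zero, zero_add] at h
          simp only [indicator_apply] at h
          refine le_trans ?_ (add_le_add le_rfl h)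
          have : (stopped I n X).toNat ≤ k.toNat + B + (stopped I n X - k - B).toNat := by omega
          exact_mod_cast this
      _ ≤ _ := by
          rw [lintegral_add_left measurable_const]
          simp only [lintegral_const, measure_univ, mul_one]
          gcongr
          exact lintegral_jumps_le (fun y y' => if y ∈ I then ((y' - k - B).toNat : ℝ≥0∞) else 0)
            ω x
  refine h1.trans (le_trans ?_ h2)
  rw [Int.toNat_of_nonpos (by omega : -x ≤ 0)] at hs
  simpa using le_self_add.trans hs

lemma Assumptions.exists_bound (hA : Assumptions η M μ) : ∃ B : ℕ, ∀ s ∈ jumps μ, |s| ≤ B := by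
  obtain ⟨B, hB⟩ := hA.bounded
  refine ⟨B, fun s hs => ?_⟩
  by_contra h
  have h1 : (μ : Measure ℤ) (Icc (-(B : ℤ)) B)ᶜ = 0 :=
    (prob_compl_eq_zero_iff MeasurableSet.of_discrete).2 hB
  have h2 : ({s} : Set ℤ) ⊆ (Icc (-(B : ℤ)) B)ᶜ := by
    rintro _ rfl h'
    exact h (abs_le.2 h')
  exact (ne_of_gt hs) (measure_mono_null h2 h1)

lemma Assumptions.closure_jumps (hA : Assumptions η M μ) :
    AddSubmonoid.closure (jumps μ) = ⊤ :=
  ExcitedWalk.closure_jumps hA.mean_zero hA.span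

lemma measurableSet_recurrent : MeasurableSet recurrent := by
  have : recurrent = ⋂ y, visitedIO y := by
    ext X; simp [recurrent, visitedIO]
  rw [this]
  exact MeasurableSet.iInter fun y => measurableSet_visitedIO y

lemma measurableSet_transientRight : MeasurableSet transientRight := by
  have : transientRight = ⋂ b : ℤ, ⋃ N : ℕ, ⋂ n : ℕ, ⋂ (_ : N ≤ n), {X : Path | b ≤ X n} := by
    ext X; simp [transientRight, tendsto_atTop, eventually_atTop]
  rw [this]
  refine MeasurableSet.iInter fun b => MeasurableSet.iUnion fun N => MeasurableSet.iInter fun n =>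
    MeasurableSet.iInter fun _ => ?_
  exact measurableSet_le measurable_const (measurable_pi_apply n)

lemma measurableSet_limsupTop : MeasurableSet limsupTop := by
  have : limsupTop = ⋂ b : ℤ, ⋂ N : ℕ, ⋃ n : ℕ, ⋃ (_ : N ≤ n), {X : Path | b ≤ X n} := by
    ext X; simp [limsupTop, frequently_atTop]
  rw [this]
  refine MeasurableSet.iInter fun b => MeasurableSet.iInter fun N => MeasurableSet.iUnion fun n =>
    MeasurableSet.iUnion fun _ => ?_
  exact measurableSet_le measurable_const (measurable_pi_apply n)

lemma Admissible.ae_recurrent_of_visitedIO (hα : Admissible η M α) (hA : Assumptions η M μ) :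
    ∀ᵐ X ∂(averaged α), ∀ y, X ∈ visitedIO y → X ∈ recurrent := by
  have hm : MeasurableSet ((⋃ y, visitedIO y) \ recurrent) :=
    (MeasurableSet.iUnion measurableSet_visitedIO).diff measurableSet_recurrent
  have h0 : averaged α ((⋃ y, visitedIO y) \ recurrent) = 0 := by
    rw [averaged_eq_zero_iff α hm]
    filter_upwards [hα.ae_niceEnv hA] with p hp
    refine measure_mono_null ?_ (ExcitedWalk.ae_recurrent_of_visitedIO
      (fun y j hj => (hp y).2 j hj) hA.closure_jumps p.2)
    rintro X ⟨hX, hX'⟩ h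
    obtain ⟨y, hy⟩ := mem_iUnion.1 hX
    exact hX' (h y hy)
  filter_upwards [measure_eq_zero_iff_ae_notMem.1 h0] with X hX y hy
  by_contra h
  exact hX ⟨mem_iUnion.2 ⟨y, hy⟩, h⟩

lemma exists_visitedIO_of_frequently {X : Path} {I : Set ℤ} (hI : I.Finite)
    (h : ∃ᶠ n in atTop, X n ∈ I) : ∃ y, X ∈ visitedIO y := by
  by_contra hc
  push Not at hc
  refine Nat.frequently_atTop_iff_infinite.1 h ?_
  have : {n | X n ∈ I} = ⋃ y ∈ I, {n | X n = y} := by ext n; simp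
  rw [this]
  exact hI.biUnion fun y _ => not_infinite.1 (hc y)

/-- The expected overshoot over `k + B`, summed over the jumps from `(-L, k)`: the jump from `y`
contributes at most `excess η M (k - y)`. -/
lemma Admissible.lintegral_excess_le (hα : Admissible η M α) (hA : Assumptions η M μ)
    {B : ℕ} (hB : ∀ s ∈ jumps μ, |s| ≤ B) (k L : ℤ) :
    ∫⁻ p, cookieSum (fun y y' => if y ∈ Ioo (-L) k then ((y' - k - B).toNat : ℝ≥0∞) else 0) p.1 ∂α
      ≤ ∑ m ∈ Finset.range (k + L).toNat, excess η M m := by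
  refine (hα.lintegral_cookieSum_le hA hB fun y z hz => ?_).trans ?_
  · split_ifs with h
    · rw [Int.toNat_of_nonpos (by have := h.2; omega), Nat.cast_zero]
    · rfl
  · have h0 : ∀ y ∉ Finset.Ioo (-L) k, ∫⁻ z, (if y ∈ Ioo (-L) k then
        ((y + z - k - B).toNat : ℝ≥0∞) else 0) ∂(intensity η M) = 0 := by
      intro y hy
      simp only [Finset.mem_Ioo] at hy
      simp only [mem_Ioo, hy, if_false, lintegral_zero]
    rw [tsum_eq_sum h0]
    have h1 : ∑ y ∈ Finset.Ioo (-L) k, ∫⁻ z, (if y ∈ Ioo (-L) k then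
        ((y + z - k - B).toNat : ℝ≥0∞) else 0) ∂(intensity η M) ≤
        ∑ y ∈ Finset.Ioo (-L) k, excess η M (k - y).toNat := by
      refine Finset.sum_le_sum fun y hy => lintegral_mono fun z => ?_
      rw [Finset.mem_Ioo] at hy
      dsimp only
      rw [if_pos (mem_Ioo.2 hy)]
      exact Nat.cast_le.2 (Int.toNat_le_toNat (by omega))
    refine h1.trans ?_
    rw [← Finset.sum_image (f := fun m : ℕ => excess η M m) (g := fun y : ℤ => (k - y).toNat)]
    · refine Finset.sum_le_sum_of_subset fun m hm => ?_
      obtain ⟨y, hy, rfl⟩ := Finset.mem_image.1 hm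
      rw [Finset.mem_Ioo] at hy
      rw [Finset.mem_range]
      omega
    · intro y hy y' hy' h
      simp only [Finset.coe_Ioo, mem_Ioo] at hy hy' h
      omega

/-- Under an admissible law the walk is not bounded from above: a bounded walk visits no site
infinitely often, since otherwise it would be recurrent. Hence it leaves `(-L, k)` to the left for
every `L`, with a probability `t` that does not depend on `L`. By optional stopping, `L * t` is at
most a sum of about `L` terms `excess η M m`, and these tend to `0` as `m → ∞`, so that `t = 0`. -/
lemma Admissible.averaged_bounded [IsProbabilityMeasure η] (hα : Admissible η M α)
    (hA : Assumptions η M μ) (k : ℤ) : averaged α {X | ∀ n, X n < k} = 0 := by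
  obtain ⟨B, hB⟩ := hA.exists_bound
  have hprob := hα.prob
  set E : ℤ → ℕ → Set Path := fun L n => {X | X 0 < k ∧ stopped (Ioo (-L) k) n X ≤ -L}
  have hE : ∀ L n, MeasurableSet (E L n) := fun L n =>
    (measurableSet_lt (measurable_pi_apply 0) measurable_const).inter
      (measurableSet_le (measurable_stopped _ n) measurable_const)
  have key : ∀ L n, (L.toNat : ℝ≥0∞) * averaged α (E L n) ≤ (k.toNat + B : ℕ) +
      ∑ m ∈ Finset.range (k + L).toNat, excess η M m := by
    intro L n
    rw [averaged_apply α (hE L n), ← lintegral_const_mul _ (measurable_quenched_apply (hE L n))]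
    refine le_trans (lintegral_mono_ae (g := fun p => ((k.toNat + B : ℕ) : ℝ≥0∞) + cookieSum
      (fun y y' => if y ∈ Ioo (-L) k then ((y' - k - B).toNat : ℝ≥0∞) else 0) p.1) ?_) ?_
    · filter_upwards [hα.ae_niceEnv hA, hα.nonneg] with p hp hp0
      rcases lt_or_ge p.2 k with h | h
      · refine le_trans ?_ (quenched_stopped_le (fun y j => (hp y).1 j) k L B n hp0 h)
        gcongr
        exact fun X hX => hX.2
      · have : quenched p.1 p.2 (E L n) = 0 := by
          refine measure_mono_null ?_ (ae_start p.1 p.2)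
          intro X hX hX'
          have : X 0 < k := hX.1
          rw [hX'] at this
          omega
        rw [this, mul_zero]
        exact zero_le
    · rw [lintegral_add_left measurable_const]
      simp only [lintegral_const, measure_univ, mul_one]
      gcongr
      exact hα.lintegral_excess_le hA hB k L
  have hunion : ∀ L : ℤ, averaged α {X | ∀ n, X n < k} ≤ ⨆ n, averaged α (E L n) := by
    intro L
    have hmono : Monotone (E L) := by
      refine monotone_nat_of_le_succ fun n X hX => ⟨hX.1, ?_⟩
      rw [stopped_succ_of_notMem n fun h => absurd h.1 (not_lt.2 hX.2)]
      exact hX.2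
    rw [← hmono.measure_iUnion]
    refine measure_mono_ae ?_
    filter_upwards [hα.ae_recurrent_of_visitedIO hA] with X hrec hX
    refine mem_iUnion.2 ?_
    have hout : ∃ n, X n ≤ -L := by
      by_contra hc
      push Not at hc
      obtain ⟨y, hy⟩ := exists_visitedIO_of_frequently (X := X) (finite_Ioo (-L) k)
        (Frequently.of_forall fun n => ⟨hc n, hX n⟩)
      obtain ⟨n, hn⟩ := ((hrec y hy) k).nonempty
      have := hX n
      have : X n = k := hn
      omega
    classical
    refine ⟨Nat.find hout, hX 0, ?_⟩
    rw [stopped_eq]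
    · exact Nat.find_spec hout
    · exact fun i hi => ⟨not_le.1 (Nat.find_min hout hi), hX i⟩
  by_contra hpos
  set t := averaged α {X | ∀ n, X n < k}
  have ht1 : t ≠ ∞ := measure_ne_top _ _
  have hsum : ∀ L : ℤ, (L.toNat : ℝ≥0∞) * t ≤ (k.toNat + B : ℕ) +
      ∑ m ∈ Finset.range (k + L).toNat, excess η M m := by
    intro L
    refine le_trans (mul_le_mul_right (hunion L) _) ?_
    rw [ENNReal.mul_iSup]
    exact iSup_le (key L)
  obtain ⟨m₀, -, hm₀⟩ := exists_excess_lt hA (ENNReal.half_pos hpos) 0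
  -- The bound grows at most like `L * (t / 2)`.
  have hgrow : ∀ N : ℕ, ∑ m ∈ Finset.range N, excess η M m ≤
      m₀ * excess η M 0 + N * (t / 2) := by
    intro N
    calc ∑ m ∈ Finset.range N, excess η M m ≤
        ∑ m ∈ Finset.range N, ((if m < m₀ then excess η M 0 else 0) + t / 2) := by
          refine Finset.sum_le_sum fun m _ => ?_
          split_ifs with h
          · exact (excess_antitone (by omega)).trans le_self_add
          · rw [zero_add]
            exact (excess_antitone (by omega)).trans hm₀.le
      _ ≤ _ := by
          rw [Finset.sum_add_distrib]
          gcongr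
          · rw [← Finset.sum_filter, Finset.sum_const, nsmul_eq_mul]
            gcongr
            refine (Finset.card_le_card (t := Finset.range m₀) fun m hm => ?_).trans_eq
              (Finset.card_range m₀)
            simpa using (Finset.mem_filter.1 hm).2
          · simp
  have hfin : ((k.toNat + B : ℕ) : ℝ≥0∞) + (m₀ * excess η M 0 + k.toNat * (t / 2)) ≠ ∞ := by
    have := (excess_zero_lt_top hA).ne
    finiteness
  obtain ⟨L, hL⟩ := ENNReal.exists_nat_mul_gt (ENNReal.half_pos hpos).ne' hfin
  have h := hsum L
  have h' : ((k + L).toNat : ℝ≥0∞) ≤ k.toNat + L := by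
    have : (k + L).toNat ≤ k.toNat + L := by omega
    exact_mod_cast this
  have h3 : (L : ℝ≥0∞) * (t / 2) + L * (t / 2) ≤
      ((k.toNat + B : ℕ) + (m₀ * excess η M 0 + k.toNat * (t / 2))) + L * (t / 2) := by
    rw [← mul_add, ENNReal.add_halves]
    refine h.trans ?_
    refine (add_le_add le_rfl (hgrow _)).trans ?_
    have := mul_le_mul_left h' (t / 2)
    rw [add_mul] at this
    calc _ ≤ ((k.toNat + B : ℕ) : ℝ≥0∞) + (m₀ * excess η M 0 +
        (k.toNat * (t / 2) + L * (t / 2))) := by gcongr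
      _ = _ := by ring
  have h4 := (ENNReal.add_le_add_iff_right (by finiteness)).1 h3
  exact absurd hL (not_lt.2 h4)

/-! ### Recurrence or transience to the right -/

lemma mem_limsupTop {X : Path} (h : ∀ k : ℕ, ∃ n, (k : ℤ) ≤ X n) : X ∈ limsupTop := by
  intro m
  rw [frequently_atTop]
  intro N
  obtain ⟨n, hn⟩ := h (m.toNat + ∑ i ∈ Finset.range N, (X i).toNat + 1)
  have h0 : 0 ≤ ∑ i ∈ Finset.range N, ((X i).toNat : ℤ) := Finset.sum_nonneg fun _ _ => by omega
  push_cast at hn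
  refine ⟨n, ?_, by omega⟩
  by_contra hc
  have h1 := Finset.single_le_sum (f := fun i => (X i).toNat) (fun _ _ => Nat.zero_le _)
    (Finset.mem_range.2 (not_le.1 hc))
  have h2 : ((X n).toNat : ℤ) ≤ ∑ i ∈ Finset.range N, ((X i).toNat : ℤ) := by exact_mod_cast h1
  omega

lemma Admissible.ae_limsupTop [IsProbabilityMeasure η] (hα : Admissible η M α)
    (hA : Assumptions η M μ) : ∀ᵐ X ∂(averaged α), X ∈ limsupTop := by
  have h : ∀ᵐ X ∂(averaged α), ∀ k : ℕ, X ∉ {X : Path | ∀ n, X n < k} :=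
    ae_all_iff.2 fun k => measure_eq_zero_iff_ae_notMem.1 (hα.averaged_bounded hA k)
  filter_upwards [h] with X hX
  refine mem_limsupTop fun k => ?_
  by_contra hc
  push Not at hc
  exact hX k hc

lemma Admissible.ae_quenched_limsupTop [IsProbabilityMeasure η] (hα : Admissible η M α)
    (hA : Assumptions η M μ) : ∀ᵐ p ∂α, ∀ᵐ X ∂(quenched p.1 p.2), X ∈ limsupTop :=
  (averaged_eq_zero_iff α measurableSet_limsupTop.compl).1 (hα.ae_limsupTop hA)

lemma Admissible.ae_mem_stateSpace [IsProbabilityMeasure η] (hα : Admissible η M α)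
    (hA : Assumptions η M μ) : ∀ᵐ p ∂α, p ∈ stateSpace := by
  filter_upwards [hα.nonneg, hα.ae_quenched_limsupTop hA] with p h0 h
  exact ⟨h0, (prob_compl_eq_zero_iff measurableSet_limsupTop).1 h⟩

lemma measurable_longJump (k s : ℤ) (i : ℕ) :
    Measurable fun X : Path => longJump k s (X i) (X (i + 1)) := by
  refine Measurable.ite ?_ measurable_const measurable_const
  exact (measurableSet_lt (measurable_pi_apply i) measurable_const).inter
    (measurableSet_le measurable_const (measurable_pi_apply (i + 1)))

lemma quenched_longJump_le (ω : Env) (x k s : ℤ) :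
    quenched ω x {X | ∃ i, X i < k ∧ k + s ≤ X (i + 1)} ≤ cookieSum (longJump k s) ω := by
  refine le_trans ?_ (lintegral_jumps_le (longJump k s) ω x)
  refine le_trans ?_ (mul_meas_ge_le_lintegral
    (Measurable.tsum fun i => measurable_longJump k s i) 1)
  rw [one_mul]
  refine measure_mono fun X hX => ?_
  obtain ⟨i, hi⟩ := hX
  refine le_trans ?_ (ENNReal.le_tsum i)
  rw [longJump, if_pos hi]

lemma Admissible.averaged_longJump_le (hα : Admissible η M α) (hA : Assumptions η M μ)
    {B : ℕ} (hB : ∀ s ∈ jumps μ, |s| ≤ B) (k : ℤ) {s : ℤ} (hs : B ≤ s) :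
    averaged α {X | ∃ i, X i < k ∧ k + s ≤ X (i + 1)} ≤ excess η M s := by
  have hm : MeasurableSet {X : Path | ∃ i, X i < k ∧ k + s ≤ X (i + 1)} := by
    rw [ofPred_exists]
    exact MeasurableSet.iUnion fun i =>
      (measurableSet_lt (measurable_pi_apply i) measurable_const).inter
        (measurableSet_le measurable_const (measurable_pi_apply (i + 1)))
  rw [averaged_apply α hm]
  refine le_trans (lintegral_mono fun p => ?_) (hα.lintegral_cookieSum_longJump_le hA hB k hs)
  exact quenched_longJump_le p.1 p.2 k s

lemma Admissible.ae_finite_longJumps [IsProbabilityMeasure η] (hα : Admissible η M α)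
    (hA : Assumptions η M μ) {B : ℕ} (hB : ∀ s ∈ jumps μ, |s| ≤ B) :
    ∀ᵐ X ∂(averaged α), {i | X i < -(B : ℤ) ∧ 0 ≤ X (i + 1)}.Finite := by
  have hm : Measurable fun X : Path => ∑' i, longJump (-(B : ℤ)) B (X i) (X (i + 1)) :=
    Measurable.tsum fun i => measurable_longJump (-(B : ℤ)) B i
  have h : ∫⁻ X, ∑' i, longJump (-(B : ℤ)) B (X i) (X (i + 1)) ∂(averaged α) ≠ ∞ := by
    rw [lintegral_averaged α hm]
    have h1 : ∫⁻ p, cookieSum (longJump (-(B : ℤ)) B) p.1 ∂α < ∞ := by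
      refine (hα.lintegral_cookieSum_longJump_le hA hB (-(B : ℤ)) le_rfl).trans_lt ?_
      exact (excess_antitone (by omega)).trans_lt (excess_zero_lt_top hA)
    refine ne_top_of_le_ne_top h1.ne (lintegral_mono fun p => ?_)
    exact lintegral_jumps_le (longJump (-(B : ℤ)) B) p.1 p.2
  filter_upwards [ae_lt_top hm h] with X hX
  have := ENNReal.finite_const_le_of_tsum_ne_top hX.ne one_ne_zero
  refine this.subset fun i hi => ?_
  have hi' : X i < -B ∧ -(B : ℤ) + B ≤ X (i + 1) := ⟨hi.1, by have := hi.2; omega⟩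
  rw [mem_ofPred_eq, longJump, if_pos hi']

/-- Under an admissible law the walk is recurrent or transient to the right: the walk that visits
no site infinitely often leaves every bounded interval, and does not jump over `[-B, m)` to the
right infinitely often, so that it finally stays above `m`. -/
lemma Admissible.ae_recurrent_or_transientRight [IsProbabilityMeasure η] (hα : Admissible η M α)
    (hA : Assumptions η M μ) :
    ∀ᵐ X ∂(averaged α), X ∈ recurrent ∨ X ∈ transientRight := by
  obtain ⟨B, hB⟩ := hA.exists_bound
  filter_upwards [hα.ae_recurrent_of_visitedIO hA, hα.ae_limsupTop hA,
    hα.ae_finite_longJumps hA hB] with X hrec hlim hfin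
  by_cases hv : ∃ y, X ∈ visitedIO y
  · obtain ⟨y, hy⟩ := hv
    exact Or.inl (hrec y hy)
  right
  refine tendsto_atTop.2 fun m' => ?_
  obtain ⟨m, hm0, hm⟩ : ∃ m : ℤ, 0 ≤ m ∧ m' ≤ m := ⟨max m' 0, le_max_right _ _, le_max_left _ _⟩
  refine Eventually.mono ?_ fun n (hn : m ≤ X n) => hm.trans hn
  have h1 : ∀ᶠ n in atTop, X n ∉ Ico (-(B : ℤ)) m := by
    by_contra hc
    exact hv (exists_visitedIO_of_frequently (finite_Ico (-(B : ℤ)) m)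
      (by simpa [Filter.Frequently] using hc))
  have h2 : ∀ᶠ n in atTop, ¬(X n < -B ∧ 0 ≤ X (n + 1)) := by
    rw [← Nat.cofinite_eq_atTop]
    exact eventually_cofinite.2 (by simpa only [not_not] using hfin)
  obtain ⟨N, hN⟩ := eventually_atTop.1 (h1.and h2)
  refine eventually_atTop.2 ⟨N, fun n hn => ?_⟩
  by_contra hc
  have hlow : ∀ i, X (n + i) < -B := by
    intro i
    induction i with
    | zero =>
      have := (hN n hn).1
      simp only [mem_Ico, not_and, not_lt] at this
      by_contra h'
      exact hc (this (not_lt.1 h'))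
    | succ i ih =>
      have ha := (hN (n + i) (by omega)).2
      by_contra h'
      have h0 : X (n + i + 1) < 0 := by
        by_contra h''
        exact ha ⟨ih, not_lt.1 h''⟩
      have hb := (hN (n + i + 1) (by omega)).1
      simp only [mem_Ico, not_and, not_lt] at hb
      have := hb (not_lt.1 h')
      omega
  obtain ⟨n', hn', hX⟩ := frequently_atTop.1 (hlim 0) n
  have := hlow (n' - n)
  rw [Nat.add_sub_cancel' hn'] at this
  omega

lemma disjoint_recurrent_transientRight : Disjoint recurrent transientRight := by
  rw [Set.disjoint_left]
  intro X hr ht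
  refine hr 0 ?_
  obtain ⟨N, hN⟩ := eventually_atTop.1 (tendsto_atTop.1 ht 1)
  refine (finite_Iio N).subset fun n hn => ?_
  by_contra h
  have := hN n (not_lt.1 h)
  have h0 : X n = 0 := hn
  omega

lemma Admissible.averaged_add [IsProbabilityMeasure η] (hα : Admissible η M α)
    (hA : Assumptions η M μ) : averaged α transientRight + averaged α recurrent = 1 := by
  have := hα.prob
  rw [add_comm, ← measure_union disjoint_recurrent_transientRight measurableSet_transientRight,
    ← prob_compl_eq_zero_iff (measurableSet_recurrent.union measurableSet_transientRight)]
  exact hα.ae_recurrent_or_transientRight hA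

/-! ### First entrances and overshoots -/

/-- The walk enters `[k, ∞)` for the first time, at time `n`. -/
def firstEntrance (k : ℤ) (n : ℕ) : Set Path := {X | (∀ i < n, X i < k) ∧ k ≤ X n}

lemma measurableSet_firstEntrance (k : ℤ) (n : ℕ) : MeasurableSet (firstEntrance k n) := by
  refine MeasurableSet.inter ?_ (measurableSet_le measurable_const (measurable_pi_apply n))
  change MeasurableSet {X : Path | ∀ i < n, X i < k}
  simp_rw [ofPred_forall]
  exact MeasurableSet.iInter fun i => MeasurableSet.iInter fun _ =>
    measurableSet_lt (measurable_pi_apply i) measurable_const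

lemma firstEntrance_unique {k : ℤ} {n m : ℕ} {X : Path} (hn : X ∈ firstEntrance k n)
    (hm : X ∈ firstEntrance k m) : n = m := by
  rcases lt_trichotomy n m with h | h | h
  · exact absurd (hm.1 n h) (not_lt.2 hn.2)
  · exact h
  · exact absurd (hn.1 m h) (not_lt.2 hm.2)

lemma exists_firstEntrance {X : Path} {k : ℤ} (h : ∃ n, k ≤ X n) : ∃ n, X ∈ firstEntrance k n := by
  classical
  exact ⟨Nat.find h, fun i hi => not_le.1 (Nat.find_min h hi), Nat.find_spec h⟩

lemma hitAbove_eq {X : Path} {k : ℤ} {n : ℕ} (h : X ∈ firstEntrance k n) : hitAbove X k = n := by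
  refine le_antisymm (Nat.sInf_le h.2) (le_csInf ⟨n, h.2⟩ fun m hm => ?_)
  by_contra hc
  exact absurd (h.1 m (not_le.1 hc)) (not_lt.2 hm)

/-- The first entrance into `[k, ∞)` leads to `[k + s, ∞)`. -/
def overshoot (k s : ℤ) : Set Path := {X | ∃ n, X ∈ firstEntrance k n ∧ k + s ≤ X n}

lemma measurableSet_overshoot (k s : ℤ) : MeasurableSet (overshoot k s) := by
  unfold overshoot
  rw [ofPred_exists]
  exact MeasurableSet.iUnion fun n => (measurableSet_firstEntrance k n).inter
    (measurableSet_le measurable_const (measurable_pi_apply n))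

/-- An overshoot by `s` is due to the starting point or to a long jump. -/
lemma Admissible.averaged_overshoot_le (hα : Admissible η M α) (hA : Assumptions η M μ)
    {B : ℕ} (hB : ∀ s ∈ jumps μ, |s| ≤ B) (k : ℤ) {s : ℤ} (hs : B ≤ s) :
    averaged α (overshoot k s) ≤ α {p | k + s ≤ p.2} + excess η M s := by
  have hm : MeasurableSet {X : Path | k + s ≤ X 0} :=
    measurableSet_le measurable_const (measurable_pi_apply 0)
  have hm2 : MeasurableSet {p : Env × ℤ | k + s ≤ p.2} :=
    measurableSet_le measurable_const measurable_snd
  have h0 : averaged α {X : Path | k + s ≤ X 0} = α {p | k + s ≤ p.2} := by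
    rw [averaged_apply α hm, ← lintegral_indicator_one hm2]
    refine lintegral_congr fun p => ?_
    by_cases h : k + s ≤ p.2
    · rw [indicator_of_mem (by exact h), Pi.one_apply, ← prob_compl_eq_zero_iff hm]
      refine measure_mono_null ?_ (ae_start p.1 p.2)
      intro X hX hX'
      exact hX (by rw [mem_ofPred_eq, hX']; exact h)
    · rw [indicator_of_notMem (by exact h)]
      refine measure_mono_null ?_ (ae_start p.1 p.2)
      intro X hX hX'
      exact h (by rw [← hX']; exact hX)
  rw [← h0]
  refine le_trans (measure_mono ?_) ((measure_union_le _ _).trans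
    (add_le_add le_rfl (hα.averaged_longJump_le hA hB k hs)))
  rintro X ⟨n, hn, hX⟩
  cases n with
  | zero => exact Or.inl hX
  | succ n => exact Or.inr ⟨n, hn.1 n n.lt_succ_self, hX⟩

/-! ### Independent trials at first entrances -/

/-- The trajectory from time `n` on, seen from `y`. -/
def after (y : ℤ) (n : ℕ) (X : Path) : Path := fun i => X (n + i) - y

lemma measurable_after (y : ℤ) (n : ℕ) : Measurable (after y n) := by
  unfold after; fun_prop

/-- The walk enters `[y, ∞)` at time `n`, at the site `y`. -/
def entranceAt (y : ℤ) (n : ℕ) : Set Path := {X | (∀ i < n, X i < y) ∧ X n = y}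

lemma entranceAt_subset (y : ℤ) (n : ℕ) : entranceAt y n ⊆ firstEntrance y n :=
  fun _ h => ⟨h.1, h.2.ge⟩

lemma measurableSet_entranceAt (y : ℤ) (n : ℕ) : MeasurableSet (entranceAt y n) := by
  refine MeasurableSet.inter ?_ (measurableSet_apply_eq n y)
  change MeasurableSet {X : Path | ∀ i < n, X i < y}
  simp_rw [ofPred_forall]
  exact MeasurableSet.iInter fun i => MeasurableSet.iInter fun _ =>
    measurableSet_lt (measurable_pi_apply i) measurable_const

/-- The walk enters `[y, ∞)` at `y`, and from then on it follows, seen from `y`, a trajectory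
in `A`. -/
def trialAt (y : ℤ) (A : Set Path) : Set Path := ⋃ n, entranceAt y n ∩ after y n ⁻¹' A

lemma measurableSet_trialAt (y : ℤ) {A : Set Path} (hA : MeasurableSet A) :
    MeasurableSet (trialAt y A) :=
  MeasurableSet.iUnion fun n => (measurableSet_entranceAt y n).inter (measurable_after y n hA)

/-- The event `G` is determined by the trajectory up to time `n`. -/
def DeterminedBy (n : ℕ) (G : Set Path) : Prop :=
  ∀ X X' : Path, (∀ i ≤ n, X i = X' i) → (X ∈ G ↔ X' ∈ G)

lemma DeterminedBy.inter {n : ℕ} {G G' : Set Path} (h : DeterminedBy n G)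
    (h' : DeterminedBy n G') : DeterminedBy n (G ∩ G') :=
  fun X X' hX => and_congr (h X X' hX) (h' X X' hX)

lemma DeterminedBy.mono {n m : ℕ} (hnm : n ≤ m) {G : Set Path} (h : DeterminedBy n G) :
    DeterminedBy m G := fun X X' hX => h X X' fun i hi => hX i (hi.trans hnm)

lemma determinedBy_entranceAt (y : ℤ) (n : ℕ) : DeterminedBy n (entranceAt y n) := by
  intro X X' h
  unfold entranceAt
  simp only [mem_ofPred_eq]
  rw [h n le_rfl]
  exact and_congr_left fun _ => forall₂_congr fun i hi => by rw [h i hi.le]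

/-- The Markov property, for an event `G` determined by the trajectory up to time `n` on which the
walk is in `y` at time `n`. -/
lemma quenched_inter_after {n : ℕ} {y : ℤ} {G A : Set Path} (hGm : MeasurableSet G)
    (hG : DeterminedBy n G) (hGy : ∀ X ∈ G, X n = y) (hA : MeasurableSet A) (ω : Env) (x : ℤ) :
    quenched ω x (G ∩ after y n ⁻¹' A) =
      ∫⁻ X in G, quenched (shiftBy y (remaining ω X n)) 0 A ∂(quenched ω x) := by
  rw [quenched_apply_glue n ω x (hGm.inter (measurable_after y n hA)), ← lintegral_indicator hGm]
  refine lintegral_congr fun X => ?_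
  have hag : ∀ Y : Path, Y 0 = X n → ∀ i ≤ n, glue n X Y i = X i := by
    intro Y hY i hi
    rcases hi.lt_or_eq with h | rfl
    · exact glue_of_lt h X Y
    · rw [← hY]
      simpa using glue_add i 0 X Y
  by_cases hX : X ∈ G
  · rw [indicator_of_mem hX, quenched_shiftBy, zero_add,
      Measure.map_apply (measurable_translate y) hA, hGy X hX]
    refine measure_congr ?_
    filter_upwards [ae_start (remaining ω X n) y] with Y hY
    refine propext ?_
    have h1 : glue n X Y ∈ G ↔ X ∈ G := hG _ _ (hag Y (by rw [hY, hGy X hX]))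
    have h2 : after y n (glue n X Y) = translate y Y := by
      funext i; simp only [after, translate, glue_add]
    change (glue n X Y ∈ G ∧ after y n (glue n X Y) ∈ A) ↔ translate y Y ∈ A
    rw [h1, h2]
    simp [hX]
  · rw [indicator_of_notMem hX]
    refine measure_mono_null ?_ (ae_start (remaining ω X n) (X n))
    intro Y hY hY0
    exact hX ((hG _ _ (hag Y hY0)).1 hY.1)

lemma visitsBefore_eq_zero {X : Path} {n : ℕ} {y : ℤ} (h : ∀ i < n, X i ≠ y) :
    visitsBefore X n y = 0 := by
  unfold visitsBefore
  rw [Finset.card_eq_zero, Finset.filter_eq_empty_iff]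
  exact fun i hi => h i (Finset.mem_range.1 hi)

lemma remaining_eq_of_lt (ω : Env) {X : Path} {n : ℕ} {y v : ℤ} (h : ∀ i < n, X i < y)
    (hv : y ≤ v) : remaining ω X n v = ω v := by
  funext j
  rw [remaining, removeCookies, visitsBefore_eq_zero, zero_add]
  intro i hi
  have := h i hi
  omega

/-- Events whose quenched probability, for the walk started at `0`, only depends on the cookies
in `[0, ∞)`. -/
def DependsOnRight (A : Set Path) : Prop :=
  ∀ ω ω' : Env, (∀ v, 0 ≤ v → ω v = ω' v) → quenched ω 0 A = quenched ω' 0 A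

lemma quenched_inter_trial {n : ℕ} {y : ℤ} {G A : Set Path} (hGm : MeasurableSet G)
    (hG : DeterminedBy n G) (hGy : G ⊆ entranceAt y n) (hA : MeasurableSet A)
    (hdep : DependsOnRight A) (ω : Env) (x : ℤ) :
    quenched ω x (G ∩ after y n ⁻¹' A) = quenched ω x G * quenched (shiftBy y ω) 0 A := by
  rw [quenched_inter_after hGm hG (fun X hX => (hGy hX).2) hA, mul_comm, ← setLIntegral_const]
  refine setLIntegral_congr_fun hGm fun X hX => hdep _ _ fun v hv => ?_
  exact remaining_eq_of_lt ω (hGy hX).1 (by omega)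

lemma measurable_quenched_zero {A : Set Path} (hA : MeasurableSet A) :
    Measurable fun ω : Env => quenched ω 0 A := by
  have h : Measurable fun ω : Env => (ω, (0 : ℤ)) := measurable_prodMk_right
  simpa only [Function.comp_def] using (measurable_quenched_apply hA).comp h

/-- A trial at `y` only uses cookies in `[y, ∞)`, which are independent of the past. -/
lemma Admissible.averaged_inter_trial [IsProbabilityMeasure η] (hα : Admissible η M α)
    (hη : IsIID η) {n : ℕ} {y : ℤ} (hy : 0 ≤ y) {G A : Set Path} (hGm : MeasurableSet G)
    (hG : DeterminedBy n G) (hGy : G ⊆ entranceAt y n) (hA : MeasurableSet A)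
    (hdep : DependsOnRight A) :
    averaged α (G ∩ after y n ⁻¹' A) = averaged α G * ∫⁻ ω, quenched ω 0 A ∂η := by
  rw [averaged_apply α (hGm.inter (measurable_after y n hA)), averaged_apply α hGm]
  simp_rw [quenched_inter_trial hGm hG hGy hA hdep]
  refine hα.lintegral_mul hη hy (measurable_quenched_apply hGm) (fun ω ω' x h => ?_)
    (measurable_quenched_zero hA) hdep
  exact quenched_congr (I := Iio y) n h x hGm hG fun X hX => (hGy hX).1

lemma pairwise_disjoint_entranceAt (y : ℤ) :
    Pairwise fun n m => Disjoint (entranceAt y n) (entranceAt y m) := fun _ _ hnm =>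
  Set.disjoint_left.2 fun _ h h' =>
    hnm (firstEntrance_unique (entranceAt_subset y _ h) (entranceAt_subset y _ h'))

/-- An event before the first entrance into `[k, ∞)` is independent of a trial at `y ≥ k`. -/
lemma Admissible.averaged_inter_trialAt [IsProbabilityMeasure η] (hα : Admissible η M α)
    (hη : IsIID η) {N : ℕ} {y : ℤ} (hy : 0 ≤ y) {E A : Set Path} (hEm : MeasurableSet E)
    (hE : DeterminedBy N E) (hEy : ∀ X ∈ E, ∀ i ≤ N, X i < y) (hA : MeasurableSet A)
    (hdep : DependsOnRight A) :
    averaged α (E ∩ trialAt y A) =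
      averaged α (E ∩ ⋃ n, entranceAt y n) * ∫⁻ ω, quenched ω 0 A ∂η := by
  have hd := pairwise_disjoint_entranceAt y
  rw [trialAt, inter_iUnion, inter_iUnion, measure_iUnion, measure_iUnion, ← ENNReal.tsum_mul_right]
  · refine tsum_congr fun n => ?_
    rw [← inter_assoc]
    rcases le_or_gt n N with h | h
    · have : E ∩ entranceAt y n = ∅ := by
        rw [eq_empty_iff_forall_notMem]
        rintro X ⟨hX, -, hX'⟩
        exact absurd (hEy X hX n h) (by omega)
      rw [this]
      simp
    · exact hα.averaged_inter_trial hη hy (hEm.inter (measurableSet_entranceAt y n))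
        ((hE.mono h.le).inter (determinedBy_entranceAt y n)) inter_subset_right hA hdep
  · exact fun n m hnm => (hd hnm).mono inter_subset_right inter_subset_right
  · exact fun n => hEm.inter (measurableSet_entranceAt y n)
  · exact fun n m hnm => (hd hnm).mono (inter_subset_right.trans inter_subset_left)
      (inter_subset_right.trans inter_subset_left)
  · exact fun n => hEm.inter ((measurableSet_entranceAt y n).inter (measurable_after y n hA))

lemma exists_measure_ge_lt {β : Type*} [MeasurableSpace β] (P : Measure β) [IsFiniteMeasure P]
    {g : β → ℤ} (hg : Measurable g) {ε : ℝ≥0∞} (hε : 0 < ε) (k₀ : ℕ) :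
    ∃ k : ℕ, k₀ ≤ k ∧ P {b | (k : ℤ) ≤ g b} < ε := by
  have h := tendsto_measure_iInter_atTop (μ := P) (s := fun k : ℕ => {b | (k : ℤ) ≤ g b})
    (fun k => (measurableSet_le measurable_const hg).nullMeasurableSet)
    (fun k l hkl b hb => le_trans (by exact_mod_cast hkl) (show (l : ℤ) ≤ g b from hb))
    ⟨0, measure_ne_top _ _⟩
  have h0 : ⋂ k : ℕ, {b | (k : ℤ) ≤ g b} = ∅ := by
    rw [eq_empty_iff_forall_notMem]
    intro b hb
    have : (((g b).toNat + 1 : ℕ) : ℤ) ≤ g b := mem_iInter.1 hb _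
    omega
  rw [h0, measure_empty] at h
  obtain ⟨k, h1, h2⟩ := ((eventually_ge_atTop k₀).and (h.eventually (gt_mem_nhds hε))).exists
  exact ⟨k, h1, h2⟩

open scoped symmDiff in
/-- Events are approximated by events determined by a finite part of the trajectory. -/
lemma exists_determinedBy_approx (P : Measure Path) [IsFiniteMeasure P] {Q : Set Path}
    (hQ : MeasurableSet Q) {δ : ℝ≥0∞} (hδ : 0 < δ) :
    ∃ N E, MeasurableSet E ∧ DeterminedBy N E ∧ P (E ∆ Q) < δ := by
  obtain ⟨E, hE, h⟩ := exists_measure_symmDiff_lt_of_generateFrom_isSetRing (μ := P)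
    (isSetRing_measurableCylinders (α := fun _ : ℕ => ℤ))
    ⟨{univ}, countable_singleton _,
      by simpa only [singleton_subset_iff] using univ_mem_measurableCylinders _, by simp⟩
    (generateFrom_measurableCylinders (α := fun _ : ℕ => ℤ)).symm hQ hδ
  obtain ⟨N, S, hS, rfl⟩ : ∃ N S, MeasurableSet S ∧ E = cylinder (Finset.Iic N) S := by
    simpa [measurableCylinders_nat] using hE
  refine ⟨N, _, .cylinder _ hS, fun X X' hX => ?_, h⟩
  rw [mem_cylinder, mem_cylinder]
  have : (Finset.Iic N).restrict X = (Finset.Iic N).restrict X' := by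
    funext i
    exact hX i (Finset.mem_Iic.1 i.2)
  rw [this]

/-- Trials succeed also on a given event of positive probability: there are infinitely many
first entrances, and every one of them gives a new chance to an event `A`, so that `A` happens after
one of them with a probability that is bounded below on the event `Q`. The constant `s` only depends
on `Q`. -/
lemma Admissible.exists_trial [IsProbabilityMeasure η] (hα : Admissible η M α)
    (hA : Assumptions η M μ) {Q : Set Path} (hQ : MeasurableSet Q) (hpos : 0 < averaged α Q) :
    ∃ s : ℕ, 0 < s ∧ ∀ A : Set Path, MeasurableSet A → DependsOnRight A → ∃ y : ℤ, 0 ≤ y ∧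
      (∫⁻ ω, quenched ω 0 A ∂η).toReal * (averaged α).real Q ≤
        4 * s * (averaged α).real (Q ∩ trialAt y A) := by
  have hprob := hα.prob
  obtain ⟨B, hB⟩ := hA.exists_bound
  set P := averaged α
  set t := P.real Q
  have ht : 0 < t := ENNReal.toReal_pos hpos.ne' (measure_ne_top _ _)
  -- uniformly in `k`, the first entrance into `[k, ∞)` leads to one of the sites in `[k, k + s)`,
  -- up to an event of probability `t / 4`
  obtain ⟨s, hs, hover⟩ : ∃ s : ℕ, 0 < s ∧ ∀ k : ℤ, 0 ≤ k → P.real (overshoot k s) ≤ t / 4 := by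
    have h8 : 0 < ENNReal.ofReal (t / 8) := ENNReal.ofReal_pos.2 (by positivity)
    obtain ⟨s₁, hs₁, h1⟩ := exists_measure_ge_lt α measurable_snd h8 (B + 1)
    obtain ⟨s₂, hs₂, h2⟩ := exists_excess_lt hA h8 s₁
    refine ⟨s₂, by omega, fun k hk => ?_⟩
    refine ENNReal.toReal_le_of_le_ofReal (by positivity) ?_
    refine (hα.averaged_overshoot_le hA hB k (by omega)).trans ?_
    rw [show t / 4 = t / 8 + t / 8 by ring, ENNReal.ofReal_add (by positivity) (by positivity)]
    refine add_le_add ((measure_mono fun p hp => ?_).trans h1.le) h2.le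
    have : k + s₂ ≤ p.2 := hp
    change (s₁ : ℤ) ≤ p.2
    omega
  refine ⟨s, hs, fun A hAm hdep => ?_⟩
  set p := (∫⁻ ω, quenched ω 0 A ∂η).toReal
  have hp1 : ∫⁻ ω, quenched ω 0 A ∂η ≤ 1 := by
    refine (lintegral_mono fun ω => prob_le_one).trans ?_
    simp
  have hp0 : 0 ≤ p := ENNReal.toReal_nonneg
  have hp1' : p ≤ 1 := ENNReal.toReal_le_of_le_ofReal zero_le_one (by simpa using hp1)
  by_contra hc
  push Not at hc
  have hpt : 0 < p * t := by
    refine lt_of_le_of_lt ?_ (hc 0 le_rfl)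
    positivity
  have hs' : (0 : ℝ) < s := Nat.cast_pos.2 hs
  -- `Q` is approximated by an event `E` determined up to time `N`, and `k` is chosen so large that
  -- the walk stays below `k` until then
  set δ : ℝ := p * t / (4 * (2 + s)) with hδ
  have hδ0 : 0 < δ := by positivity
  obtain ⟨N, E, hEm, hE, hEQ⟩ := exists_determinedBy_approx P hQ (ENNReal.ofReal_pos.2 hδ0)
  have hEQ' : P.real (symmDiff E Q) ≤ δ :=
    ENNReal.toReal_le_of_le_ofReal hδ0.le hEQ.le
  have hgm : Measurable fun X : Path => ∑ i ∈ Finset.range (N + 1), ((X i).toNat : ℤ) :=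
    Finset.measurable_sum _ fun i _ => (measurable_of_countable fun z : ℤ => (z.toNat : ℤ)).comp
      (measurable_pi_apply i)
  obtain ⟨k, -, hk⟩ := exists_measure_ge_lt P hgm (ENNReal.ofReal_pos.2 hδ0) 0
  set E' := E ∩ {X : Path | ∀ i ≤ N, X i < k} with hE'
  have hLm : MeasurableSet {X : Path | ∀ i ≤ N, X i < k} := by
    simp_rw [ofPred_forall]
    exact MeasurableSet.iInter fun i => MeasurableSet.iInter fun _ =>
      measurableSet_lt (measurable_pi_apply i) measurable_const
  have hEm' : MeasurableSet E' := hEm.inter hLm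
  have hEd' : DeterminedBy N E' := hE.inter fun X X' hX =>
    forall₂_congr fun i hi => by rw [hX i hi]
  have h1 : t ≤ P.real E' + 2 * δ := by
    have hsub : Q ⊆ E' ∪ (symmDiff E Q ∪
        {X : Path | (k : ℤ) ≤ ∑ i ∈ Finset.range (N + 1), ((X i).toNat : ℤ)}) := by
      intro X hX
      by_cases hXE : X ∈ E
      · by_cases hXk : ∀ i ≤ N, X i < k
        · exact Or.inl ⟨hXE, hXk⟩
        · push Not at hXk
          obtain ⟨i, hi, hik⟩ := hXk
          refine Or.inr (Or.inr ?_)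
          have : ((X i).toNat : ℤ) ≤ ∑ i ∈ Finset.range (N + 1), ((X i).toNat : ℤ) :=
            Finset.single_le_sum (f := fun i => ((X i).toNat : ℤ)) (fun _ _ => by omega)
              (Finset.mem_range.2 (Nat.lt_succ_of_le hi))
          change (k : ℤ) ≤ ∑ i ∈ Finset.range (N + 1), ((X i).toNat : ℤ)
          omega
      · exact Or.inr (Or.inl (Or.inr ⟨hX, hXE⟩))
    have hk' : P.real {X : Path | (k : ℤ) ≤ ∑ i ∈ Finset.range (N + 1), ((X i).toNat : ℤ)} ≤ δ :=
      ENNReal.toReal_le_of_le_ofReal hδ0.le hk.le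
    have := (measureReal_mono (μ := P) hsub).trans ((measureReal_union_le _ _).trans
      (add_le_add le_rfl (measureReal_union_le _ _)))
    linarith
  have h2 : P.real E' ≤ t / 4 +
      ∑ y ∈ Finset.Ico (k : ℤ) (k + s), P.real (E' ∩ ⋃ n, entranceAt y n) := by
    have hsub : E' ≤ᵐ[P] (overshoot k s ∪
        ⋃ y ∈ Finset.Ico (k : ℤ) (k + s), E' ∩ ⋃ n, entranceAt y n : Set Path) := by
      filter_upwards [hα.ae_limsupTop hA] with X hX hXE
      obtain ⟨n, hn⟩ := exists_firstEntrance (hX k).exists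
      rcases le_or_gt (k + s : ℤ) (X n) with h | h
      · exact Or.inl ⟨n, hn, h⟩
      · refine Or.inr (mem_biUnion (x := X n) ?_ ⟨hXE, mem_iUnion.2 ⟨n, ?_, rfl⟩⟩)
        · simpa using ⟨hn.2, h⟩
        · exact fun i hi => (hn.1 i hi).trans_le hn.2
    have hle : P E' ≤ P (overshoot k s) +
        ∑ y ∈ Finset.Ico (k : ℤ) (k + s), P (E' ∩ ⋃ n, entranceAt y n) :=
      (measure_mono_ae hsub).trans ((measure_union_le _ _).trans
        (add_le_add le_rfl (measure_biUnion_finset_le _ _)))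
    have hfin : ∑ y ∈ Finset.Ico (k : ℤ) (k + s), P (E' ∩ ⋃ n, entranceAt y n) ≠ ∞ :=
      ENNReal.sum_ne_top.2 fun _ _ => measure_ne_top _ _
    have := ENNReal.toReal_mono (ENNReal.add_ne_top.2 ⟨measure_ne_top _ _, hfin⟩) hle
    rw [ENNReal.toReal_add (measure_ne_top _ _) hfin,
      ENNReal.toReal_sum fun _ _ => measure_ne_top _ _] at this
    exact this.trans (add_le_add (hover k (by omega)) le_rfl)
  -- by independence, a trial at a site `y ≥ k` succeeds on `E'` with probability `p`
  have h3 : ∀ y ∈ Finset.Ico (k : ℤ) (k + s),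
      p * P.real (E' ∩ ⋃ n, entranceAt y n) ≤ p * t / (4 * s) + δ := by
    intro y hy
    rw [Finset.mem_Ico] at hy
    have e := hα.averaged_inter_trialAt hA.isIID (by omega : 0 ≤ y) hEm' hEd'
      (fun X hX i hi => (hX.2 i hi).trans_le hy.1) hAm hdep
    have e' : P.real (E' ∩ trialAt y A) = P.real (E' ∩ ⋃ n, entranceAt y n) * p := by
      simp only [P, p, Measure.real, e, ENNReal.toReal_mul]
    have hsub : E' ∩ trialAt y A ⊆ (Q ∩ trialAt y A) ∪ symmDiff E Q := by
      rintro X ⟨hX, hX'⟩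
      by_cases hXQ : X ∈ Q
      · exact Or.inl ⟨hXQ, hX'⟩
      · exact Or.inr (Or.inl ⟨hX.1, hXQ⟩)
    have hle := (measureReal_mono (μ := P) hsub).trans (measureReal_union_le _ _)
    have hcy := (hc y (by omega)).le
    have : P.real (Q ∩ trialAt y A) ≤ p * t / (4 * s) := by
      rw [le_div_iff₀ (by positivity)]
      linarith
    rw [mul_comm, ← e']
    linarith
  have h4 : ∑ y ∈ Finset.Ico (k : ℤ) (k + s), p * P.real (E' ∩ ⋃ n, entranceAt y n) ≤
      s * (p * t / (4 * s) + δ) := by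
    refine (Finset.sum_le_sum h3).trans_eq ?_
    simp [mul_add]
  rw [← Finset.mul_sum] at h4
  have h5 : p * P.real E' ≤ p * (t / 4) + (p * t / 4 + s * δ) := by
    have : s * (p * t / (4 * s) + δ) = p * t / 4 + s * δ := by field_simp
    rw [← this]
    have := mul_le_mul_of_nonneg_left h2 hp0
    linarith
  have h6 : p * t ≤ p * P.real E' + 2 * δ := by
    have := mul_le_mul_of_nonneg_left h1 hp0
    nlinarith
  have h7 : (2 + s) * δ = p * t / 4 := by
    rw [hδ]; field_simp
  nlinarith

/-! ### The zero-one law -/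

lemma dependsOnRight_confined : DependsOnRight (confined (Ici 0)) :=
  fun _ _ h => quenched_confined_congr h 0

/-- If the walk started at `0` has a chance to stay in `[0, ∞)` then it is not recurrent, since a
trial succeeds with positive probability even given recurrence. -/
lemma Admissible.averaged_recurrent_eq_zero [IsProbabilityMeasure η] (hα : Admissible η M α)
    (hA : Assumptions η M μ) (h : ∫⁻ ω, quenched ω 0 (confined (Ici 0)) ∂η ≠ 0) :
    averaged α recurrent = 0 := by
  by_contra hpos
  have hprob := hα.prob
  obtain ⟨s, -, hs⟩ := hα.exists_trial hA measurableSet_recurrent (pos_iff_ne_zero.2 hpos)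
  obtain ⟨y, -, hy⟩ := hs _ (measurableSet_confined _) dependsOnRight_confined
  have hempty : recurrent ∩ trialAt y (confined (Ici 0)) = ∅ := by
    rw [eq_empty_iff_forall_notMem]
    rintro X ⟨hr, hX⟩
    obtain ⟨n, -, hn⟩ := mem_iUnion.1 hX
    refine hr (y - 1) ((finite_Iio n).subset fun i hi => ?_)
    by_contra hc
    have h1 : (0 : ℤ) ≤ X (n + (i - n)) - y := hn (i - n)
    rw [Nat.add_sub_cancel' (not_lt.1 hc)] at h1
    have h2 : X i = y - 1 := hi
    omega
  rw [hempty, measureReal_empty, mul_zero] at hy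
  have h1 : ∫⁻ ω, quenched ω 0 (confined (Ici 0)) ∂η ≠ ∞ := by
    refine ne_top_of_le_ne_top ENNReal.one_ne_top
      ((lintegral_mono fun ω => prob_le_one).trans ?_)
    simp
  have := mul_pos (ENNReal.toReal_pos h h1) (ENNReal.toReal_pos hpos (measure_ne_top _ _))
  exact absurd hy (not_le.2 this)

/-- The event `eatUp W c`, with the window left at time `σ`. -/
def eatUpAt (W : ℤ) (c : ℤ → ℕ) (σ : ℕ) : Set Path :=
  {X | (∀ i < σ, X i ∈ Icc 0 W) ∧ X σ = W + 1 ∧ ∀ v ∈ Icc 0 W, c v ≤ visitsBefore X σ v}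

lemma eatUp_eq_iUnion (W : ℤ) (c : ℤ → ℕ) : eatUp W c = ⋃ σ, eatUpAt W c σ := by
  ext X; simp [eatUp, eatUpAt]

lemma measurableSet_eatUpAt (W : ℤ) (c : ℤ → ℕ) (σ : ℕ) : MeasurableSet (eatUpAt W c σ) := by
  refine MeasurableSet.inter ?_ ((measurableSet_apply_eq σ (W + 1)).inter ?_)
  · change MeasurableSet {X : Path | ∀ i < σ, X i ∈ Icc 0 W}
    simp_rw [ofPred_forall]
    exact MeasurableSet.iInter fun i => MeasurableSet.iInter fun _ =>
      (measurable_pi_apply i : Measurable fun X : Path => X i) measurableSet_Icc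
  · change MeasurableSet {X : Path | ∀ v ∈ Icc 0 W, c v ≤ visitsBefore X σ v}
    simp_rw [ofPred_forall]
    exact MeasurableSet.iInter fun v => MeasurableSet.iInter fun _ =>
      measurableSet_le measurable_const (measurable_visitsBefore σ v)

lemma determinedBy_eatUpAt (W : ℤ) (c : ℤ → ℕ) (σ : ℕ) : DeterminedBy σ (eatUpAt W c σ) := by
  intro X X' h
  unfold eatUpAt
  simp only [mem_ofPred_eq]
  rw [h σ le_rfl]
  refine and_congr (forall₂_congr fun i hi => by rw [h i hi.le]) (and_congr_right fun _ => ?_)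
  exact forall₂_congr fun v _ => by rw [visitsBefore_congr fun i hi => h i hi.le]

lemma pairwise_disjoint_eatUpAt (W : ℤ) (c : ℤ → ℕ) :
    Pairwise fun n m => Disjoint (eatUpAt W c n) (eatUpAt W c m) := by
  have : ∀ σ, eatUpAt W c σ ⊆ entranceAt (W + 1) σ := fun σ X hX =>
    ⟨fun i hi => by have := (hX.1 i hi).2; omega, hX.2.1⟩
  exact fun n m hnm => (pairwise_disjoint_entranceAt (W + 1) hnm).mono (this n) (this m)

lemma quenched_eatUp_eq_tsum (W : ℤ) (c : ℤ → ℕ) (ω : Env) (x : ℤ) :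
    quenched ω x (eatUp W c) = ∑' σ, quenched ω x (eatUpAt W c σ) := by
  rw [eatUp_eq_iUnion, measure_iUnion (pairwise_disjoint_eatUpAt W c)
    (measurableSet_eatUpAt W c)]

lemma quenched_eatUp_congr {W : ℤ} {c : ℤ → ℕ} {ω ω' : Env} (h : ∀ v ∈ Icc 0 W, ω v = ω' v)
    (x : ℤ) : quenched ω x (eatUp W c) = quenched ω' x (eatUp W c) := by
  rw [quenched_eatUp_eq_tsum, quenched_eatUp_eq_tsum]
  refine tsum_congr fun σ => ?_
  exact quenched_congr σ h x (measurableSet_eatUpAt W c σ) (determinedBy_eatUpAt W c σ)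
    fun X hX => hX.1

lemma dependsOnRight_eatUp (W : ℤ) (c : ℤ → ℕ) : DependsOnRight (eatUp W c) :=
  fun _ _ h => quenched_eatUp_congr (fun v hv => h v hv.1) 0

/-- Stacks whose first `M` cookies allow nonpositive and nonnegative jumps of size at most `C`. -/
def flexible (M C : ℕ) : Set (ℕ → M1) :=
  {s | ∀ j < M, (∃ l : ℤ, 0 ≤ l ∧ l ≤ C ∧ -l ∈ jumps (s j)) ∧
    ∃ l : ℤ, 0 ≤ l ∧ l ≤ C ∧ l ∈ jumps (s j)}

lemma measurableSet_mem_jumps (j : ℕ) (z : ℤ) : MeasurableSet {s : ℕ → M1 | z ∈ jumps (s j)} :=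
  measurableSet_lt measurable_const ((Measure.measurable_coe (measurableSet_singleton z)).comp
    (measurable_subtype_coe.comp (measurable_pi_apply j)))

lemma measurableSet_flexible (M C : ℕ) : MeasurableSet (flexible M C) := by
  have h1 : ∀ j (g : ℤ → ℤ), MeasurableSet {s : ℕ → M1 | ∃ l : ℤ, 0 ≤ l ∧ l ≤ C ∧
      g l ∈ jumps (s j)} := by
    intro j g
    simp_rw [ofPred_exists, ← exists_prop (b := _ ∧ _), ← exists_prop (b := _ ∈ _), ofPred_exists]
    exact MeasurableSet.iUnion fun l => MeasurableSet.iUnion fun _ => MeasurableSet.iUnion fun _ =>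
      measurableSet_mem_jumps j (g l)
  unfold flexible
  simp_rw [ofPred_forall]
  exact MeasurableSet.iInter fun j => MeasurableSet.iInter fun _ =>
    (h1 j fun l => -l).inter (h1 j id)

lemma Assumptions.exists_flexible (hA : Assumptions η M μ) :
    ∃ C : ℕ, 0 < η {ω | ω 0 ∈ flexible M C} := by
  by_contra hc
  push Not at hc
  have h0 : ∀ᵐ ω ∂η, ∀ C : ℕ, ω 0 ∉ flexible M C :=
    ae_all_iff.2 fun C => measure_eq_zero_iff_ae_notMem.1 (nonpos_iff_eq_zero.1 (hc C))
  refine hA.left_jump.ne' ?_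
  rw [lintegral_congr_ae (g := fun _ => 0), lintegral_zero]
  filter_upwards [h0, hA.mem_envSet] with ω h1 h2
  by_contra hne
  have hpos : ∀ j < M, ∃ l : ℤ, 0 ≤ l ∧ -l ∈ jumps (ω 0 j) := by
    intro j hj
    have hne' := Finset.prod_ne_zero_iff.1 hne j (Finset.mem_range.2 hj)
    by_contra hc'
    push Not at hc'
    refine hne' (measure_eq_zero_iff_ae_notMem.2 ?_)
    filter_upwards [ae_mem_jumps (ω 0 j)] with z hz hz'
    have hz'' : z ≤ 0 := hz'
    exact hc' (-z) (by omega) (by simpa using hz)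
  have hpos' : ∀ j < M, ∃ l : ℤ, 0 ≤ l ∧ l ∈ jumps (ω 0 j) := fun j hj => by
    obtain ⟨l, hl, hl0⟩ := exists_nonneg_jump ((h2 0).1 j hj)
    exact ⟨l, hl0, hl⟩
  choose! l hl0 hl using hpos
  choose! r hr0 hr using hpos'
  refine h1 (∑ j ∈ Finset.range M, ((l j).toNat + (r j).toNat)) fun j hj => ?_
  have hle := Finset.single_le_sum (f := fun j => (l j).toNat + (r j).toNat)
    (fun _ _ => Nat.zero_le _) (Finset.mem_range.2 hj)
  have h3 : (l j).toNat + (r j).toNat ≤ ∑ j ∈ Finset.range M, ((l j).toNat + (r j).toNat) := hle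
  have h4 := hl0 j hj
  have h5 := hr0 j hj
  exact ⟨⟨l j, h4, by omega, hl j hj⟩, ⟨r j, h5, by omega, hr j hj⟩⟩

/-- In a large window the walk may eat up all the cookies. -/
lemma Assumptions.exists_eatUp_pos [IsProbabilityMeasure η] (hA : Assumptions η M μ) :
    ∃ W₀ : ℕ, ∀ W : ℕ, W₀ ≤ W → 0 < ∫⁻ ω, quenched ω 0 (eatUp W fun _ => M) ∂η := by
  obtain ⟨B, hB⟩ := hA.exists_bound
  obtain ⟨C, hC⟩ := hA.exists_flexible
  obtain ⟨a, ha, ha0⟩ := exists_jump_ne_zero hA.span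
  obtain ⟨a, ha, ha0⟩ := exists_jump_pos hA.mean_zero ha ha0
  refine ⟨2 * B + 2 * C, fun W hW => ?_⟩
  have hpos : ∀ᵐ ω ∂η, ω ∈ Set.pi (Finset.Icc (0 : ℤ) W) (fun _ => flexible M C) →
      0 < quenched ω 0 (eatUp W fun _ => M) := by
    filter_upwards [hA.mem_envSet] with ω h1 h2
    have h3 : ∀ v ∈ Icc (0 : ℤ) W, ω v ∈ flexible M C := fun v hv => h2 v (by simpa using hv)
    exact eatUp_pos hB hA.closure_jumps ha ha0 (C := C) (by omega) (by omega) _ rfl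
      (fun v _ j hj => (h1 v).2 j hj) (fun v hv j hj => (h3 v hv j hj).1)
      (fun v hv j hj => (h3 v hv j hj).2) (by simp)
  rw [pos_iff_ne_zero, Ne, lintegral_eq_zero_iff
    (measurable_quenched_zero (measurableSet_eatUp W fun _ => M))]
  intro h0
  have hm : MeasurableSet {ω : Env | ω 0 ∈ flexible M C} :=
    measurable_pi_apply 0 (measurableSet_flexible M C)
  have hprod := hA.isIID.measure_pi (Finset.Icc (0 : ℤ) W) (t := fun _ => flexible M C)
    fun _ => measurableSet_flexible M C
  rw [Measure.map_apply (measurable_pi_apply 0) (measurableSet_flexible M C)] at hprod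
  have : η (Set.pi (Finset.Icc (0 : ℤ) W) fun _ => flexible M C) = 0 := by
    refine measure_eq_zero_iff_ae_notMem.2 ?_
    filter_upwards [h0, hpos] with ω h1 h2 h3
    exact (h2 h3).ne' h1
  rw [this] at hprod
  exact (Finset.prod_ne_zero_iff.2 fun _ _ => hC.ne') hprod.symm

/-- The environment that equals `ω` on `[0, ∞)` and has no cookies on `(-∞, 0)`. -/
def noCookiesLeft (μ : M1) (ω : Env) : Env := splice 0 (fun _ _ => μ) ω

lemma measurable_noCookiesLeft (μ : M1) : Measurable (noCookiesLeft μ) :=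
  (measurable_splice 0).comp (measurable_const.prodMk measurable_id)

lemma shiftBy_remaining_eq {ω : Env} (hω : ∀ y j, M ≤ j → ω y j = μ) {X : Path} {m : ℕ} {K W : ℤ}
    (hX : ∀ i < m, X i < K) (hv : ∀ v, K - W ≤ v → v < K → M ≤ visitsBefore X m v) {v : ℤ}
    (hv' : -W ≤ v) :
    shiftBy K (remaining ω X m) v = noCookiesLeft μ (shiftBy K ω) v := by
  unfold noCookiesLeft
  rcases lt_or_ge v 0 with h | h
  · rw [splice_of_lt h]
    funext j
    refine hω _ _ ((hv (v + K) (by omega) (by omega)).trans (Nat.le_add_right _ _))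
  · rw [splice_of_le h, sub_zero]
    exact remaining_eq_of_lt ω hX (by omega)

/-- If the walk eats up all cookies in the window `[0, W]`, then it may stay in `[0, ∞)` as
the walk without cookies to the left of its starting point may stay in `[-(W + 1), ∞)`. -/
lemma le_quenched_confined {ω : Env} (hω : ∀ y j, M ≤ j → ω y j = μ) (W : ℤ) :
    quenched ω 0 (eatUp W fun _ => M) *
        quenched (noCookiesLeft μ (shiftBy (W + 1) ω)) 0 (confined (Ici (-(W + 1)))) ≤
      quenched ω 0 (confined (Ici 0)) := by
  set c : ℤ → ℕ := fun _ => M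
  have hσ : ∀ σ, quenched ω 0 (eatUpAt W c σ) *
      quenched (noCookiesLeft μ (shiftBy (W + 1) ω)) 0 (confined (Ici (-(W + 1)))) =
      quenched ω 0 (eatUpAt W c σ ∩ after (W + 1) σ ⁻¹' confined (Ici (-(W + 1)))) := by
    intro σ
    rw [quenched_inter_after (measurableSet_eatUpAt W c σ) (determinedBy_eatUpAt W c σ)
      (fun X hX => hX.2.1) (measurableSet_confined _), mul_comm, ← setLIntegral_const]
    refine setLIntegral_congr_fun (measurableSet_eatUpAt W c σ) fun X hX => ?_
    refine quenched_confined_congr (fun v hv => ?_) 0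
    exact (shiftBy_remaining_eq hω (fun i hi => by have := (hX.1 i hi).2; omega)
      (fun v h1 h2 => hX.2.2 v ⟨by omega, by omega⟩) hv).symm
  rw [quenched_eatUp_eq_tsum, ← ENNReal.tsum_mul_right]
  simp_rw [hσ]
  rw [← measure_iUnion]
  · refine measure_mono (iUnion_subset fun σ X hX i => ?_)
    rcases lt_or_ge i σ with h | h
    · exact (hX.1.1 i h).1
    · have : -(W + 1) ≤ X (σ + (i - σ)) - (W + 1) := hX.2 (i - σ)
      rw [Nat.add_sub_cancel' h] at this
      exact mem_Ici.2 (by omega)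
  · exact fun n m hnm => (pairwise_disjoint_eatUpAt W c hnm).mono inter_subset_left
      inter_subset_left
  · exact fun σ => (measurableSet_eatUpAt W c σ).inter
      (measurable_after _ _ (measurableSet_confined _))

lemma dependsOnRight_noCookiesLeft {ω ω' : Env} (h : ∀ v, 0 ≤ v → ω v = ω' v) :
    noCookiesLeft μ ω = noCookiesLeft μ ω' := by
  funext v
  unfold noCookiesLeft
  rcases lt_or_ge v 0 with hv | hv
  · rw [splice_of_lt hv, splice_of_lt hv]
  · rw [splice_of_le hv, splice_of_le hv, sub_zero, h v hv]

/-- If the walk started at `0` cannot stay in `[0, ∞)` then, for large `N`, it cannot stay in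
`[-N, ∞)` either when it finds no cookies on the negative half-line: otherwise it would have the
chance to eat up the cookies of a window of width `N` and to stay in `[0, ∞)` afterwards. -/
lemma Assumptions.ae_noCookiesLeft_eq_zero [IsProbabilityMeasure η] (hA : Assumptions η M μ)
    (h0 : ∫⁻ ω, quenched ω 0 (confined (Ici 0)) ∂η = 0) :
    ∃ N₀ : ℕ, ∀ N : ℕ, N₀ ≤ N →
      ∫⁻ ω, quenched (noCookiesLeft μ ω) 0 (confined (Ici (-(N : ℤ)))) ∂η = 0 := by
  obtain ⟨W₀, hW₀⟩ := hA.exists_eatUp_pos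
  refine ⟨W₀ + 1, fun N hN => ?_⟩
  obtain ⟨W, rfl⟩ : ∃ W, N = W + 1 := ⟨N - 1, by omega⟩
  have hpos := hW₀ W (by omega)
  have hadm : Admissible η M (fromZero η) := admissible_fromZero hA.isIID
  have hm1 : Measurable fun p : Env × ℤ => quenched p.1 0 (eatUp W fun _ => M) :=
    (measurable_quenched_zero (measurableSet_eatUp W fun _ => M)).comp measurable_fst
  have hm2 : Measurable fun ω : Env =>
      quenched (noCookiesLeft μ ω) 0 (confined (Ici (-((W : ℤ) + 1)))) :=
    (measurable_quenched_zero (measurableSet_confined _)).comp (measurable_noCookiesLeft μ)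
  have h := hadm.lintegral_mul hA.isIID (k := W + 1) (by omega) hm1
    (fun ω ω' x h => quenched_eatUp_congr (fun v hv => h v (by have := hv.2; omega)) 0) hm2
    (fun ω ω' h => by rw [dependsOnRight_noCookiesLeft h])
  have hle : ∫⁻ p, quenched p.1 0 (eatUp W fun _ => M) *
      quenched (noCookiesLeft μ (shiftBy (W + 1) p.1)) 0 (confined (Ici (-((W : ℤ) + 1))))
        ∂(fromZero η) ≤ 0 := by
    rw [fromZero_eq_map, lintegral_map _ measurable_prodMk_right]
    · rw [← h0]
      refine lintegral_mono_ae ?_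
      filter_upwards [hA.mem_envSet] with ω hω
      exact le_quenched_confined (fun y j hj => (hω y).2 j hj) W
    · exact hm1.mul (hm2.comp ((measurable_shiftBy _).comp measurable_fst))
  rw [h, nonpos_iff_eq_zero, mul_eq_zero] at hle
  have hne : ∫⁻ p, quenched p.1 0 (eatUp W fun _ => M) ∂(fromZero η) ≠ 0 := by
    rw [fromZero_eq_map, lintegral_map hm1 measurable_prodMk_right]
    exact hpos.ne'
  have := hle.resolve_left hne
  simpa using this

lemma measurable_cookieSum (f : ℤ → ℤ → ℝ≥0∞) : Measurable (cookieSum f) := by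
  refine Measurable.tsum fun y => Measurable.tsum fun j => ?_
  exact (measurable_lintegral_M1 _).comp ((measurable_pi_apply j).comp (measurable_pi_apply y))

lemma cookieSum_longJump_shiftBy (k s a : ℤ) (ω : Env) :
    cookieSum (longJump k s) (shiftBy a ω) = cookieSum (longJump (k + a) s) ω := by
  unfold cookieSum
  rw [← (Equiv.addRight a).tsum_eq fun y => ∑' j, ∫⁻ z, longJump (k + a) s y (y + z)
    ∂(ω y j : Measure ℤ)]
  refine tsum_congr fun y => tsum_congr fun j => lintegral_congr fun z => ?_
  unfold longJump
  simp only [Equiv.coe_addRight]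
  refine if_congr ?_ rfl rfl
  omega

lemma cookieSum_longJump_congr {k s : ℤ} {ω ω' : Env} (h : ∀ y < k, ω y = ω' y) :
    cookieSum (longJump k s) ω = cookieSum (longJump k s) ω' := by
  unfold cookieSum
  refine tsum_congr fun y => tsum_congr fun j => ?_
  rcases lt_or_ge y k with hy | hy
  · rw [h y hy]
  · have : ∀ z, longJump k s y (y + z) = 0 := fun z => if_neg (by omega)
    simp [this]

/-- The walk eats up the cookies in the window `[0, W]`, and later jumps from `(-∞, 0)` over this
window. -/
def eatUpLong (W : ℤ) (c : ℤ → ℕ) : Set Path :=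
  ⋃ σ, eatUpAt W c σ ∩ after (W + 1) σ ⁻¹' {X | ∃ i, X i < -(W + 1) ∧ 0 ≤ X (i + 1)}

lemma measurableSet_exists_jump (k l : ℤ) :
    MeasurableSet {X : Path | ∃ i, X i < k ∧ l ≤ X (i + 1)} := by
  rw [ofPred_exists]
  exact MeasurableSet.iUnion fun i =>
    (measurableSet_lt (measurable_pi_apply i) measurable_const).inter
      (measurableSet_le measurable_const (measurable_pi_apply (i + 1)))

lemma measurableSet_eatUpLong (W : ℤ) (c : ℤ → ℕ) : MeasurableSet (eatUpLong W c) :=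
  MeasurableSet.iUnion fun σ => (measurableSet_eatUpAt W c σ).inter
    (measurable_after _ _ (measurableSet_exists_jump _ _))

lemma quenched_eatUpLong_le (W : ℤ) (c : ℤ → ℕ) (ω : Env) :
    quenched ω 0 (eatUpLong W c) ≤
      quenched ω 0 (eatUp W c) * cookieSum (longJump 0 (W + 1)) ω := by
  refine (measure_iUnion_le _).trans ?_
  rw [quenched_eatUp_eq_tsum, ← ENNReal.tsum_mul_right]
  refine ENNReal.tsum_le_tsum fun σ => ?_
  rw [quenched_inter_after (measurableSet_eatUpAt W c σ) (determinedBy_eatUpAt W c σ)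
    (fun X hX => hX.2.1) (measurableSet_exists_jump _ _), mul_comm, ← setLIntegral_const]
  refine lintegral_mono fun X => ?_
  have h := quenched_longJump_le (shiftBy (W + 1) (remaining ω X σ)) 0 (-(W + 1)) (W + 1)
  rw [neg_add_cancel, cookieSum_longJump_shiftBy, neg_add_cancel] at h
  exact h.trans (cookieSum_removeCookies_le _ _ _)

lemma quenched_trialAt_eatUpLong_le (W y : ℤ) (c : ℤ → ℕ) (ω : Env) (x : ℤ) :
    quenched ω x (trialAt y (eatUpLong W c)) ≤
      cookieSum (longJump y (W + 1)) ω * quenched (shiftBy y ω) 0 (eatUp W c) := by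
  refine (measure_iUnion_le _).trans ?_
  calc ∑' n, quenched ω x (entranceAt y n ∩ after y n ⁻¹' eatUpLong W c)
      ≤ ∑' n, cookieSum (longJump y (W + 1)) ω * quenched (shiftBy y ω) 0 (eatUp W c) *
          quenched ω x (entranceAt y n) := by
        refine ENNReal.tsum_le_tsum fun n => ?_
        rw [quenched_inter_after (measurableSet_entranceAt y n) (determinedBy_entranceAt y n)
          (fun X hX => hX.2) (measurableSet_eatUpLong W c), ← setLIntegral_const]
        refine setLIntegral_mono' (measurableSet_entranceAt y n) fun X hX => ?_
        refine (quenched_eatUpLong_le W c _).trans ?_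
        rw [dependsOnRight_eatUp W c (shiftBy y (remaining ω X n)) (shiftBy y ω)
          fun v hv => remaining_eq_of_lt ω hX.1 (by omega), cookieSum_longJump_shiftBy, zero_add,
          mul_comm]
        exact mul_le_mul_left (cookieSum_removeCookies_le _ _ _) _
    _ ≤ _ := by
        rw [ENNReal.tsum_mul_left, ← measure_iUnion (pairwise_disjoint_entranceAt y)
          (measurableSet_entranceAt y)]
        exact mul_le_of_le_one_right' prob_le_one

lemma Admissible.averaged_trialAt_eatUpLong_le [IsProbabilityMeasure η] (hα : Admissible η M α)
    (hA : Assumptions η M μ) {B : ℕ} (hB : ∀ s ∈ jumps μ, |s| ≤ B) {W y : ℤ} (hy : 0 ≤ y)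
    (hW : B ≤ W) (c : ℤ → ℕ) :
    averaged α (trialAt y (eatUpLong W c)) ≤
      excess η M (W + 1) * ∫⁻ ω, quenched ω 0 (eatUp W c) ∂η := by
  rw [averaged_apply α (measurableSet_trialAt y (measurableSet_eatUpLong W c))]
  have h1 : ∫⁻ p, quenched p.1 p.2 (trialAt y (eatUpLong W c)) ∂α ≤
      ∫⁻ p, cookieSum (longJump y (W + 1)) p.1 * quenched (shiftBy y p.1) 0 (eatUp W c) ∂α :=
    lintegral_mono fun p => quenched_trialAt_eatUpLong_le W y c p.1 p.2
  have h2 := hα.lintegral_mul hA.isIID hy (F := fun p => cookieSum (longJump y (W + 1)) p.1)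
    (H := fun ω => quenched ω 0 (eatUp W c)) ((measurable_cookieSum _).comp measurable_fst)
    (fun ω ω' x h => cookieSum_longJump_congr h)
    (measurable_quenched_zero (measurableSet_eatUp W c)) (dependsOnRight_eatUp W c)
  rw [h2] at h1
  exact h1.trans
    (mul_le_mul_left (hα.lintegral_cookieSum_longJump_le hA hB y (by omega)) _)

lemma visitsBefore_after (X : Path) (y : ℤ) (n m : ℕ) (v : ℤ) :
    visitsBefore X (n + m) v = visitsBefore X n v + visitsBefore (after y n X) m (v - y) := by
  have h : X = glue n X fun i => X (n + i) := by
    funext i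
    rcases lt_or_ge i n with hi | hi
    · exact (glue_of_lt hi _ _).symm
    · obtain ⟨k, rfl⟩ := Nat.exists_eq_add_of_le hi
      rw [glue_add]
  have h2 : after y n X = translate y fun i => X (n + i) := rfl
  conv_lhs => rw [h]
  rw [visitsBefore_glue, h2, visitsBefore_translate, sub_add_cancel]

/-- The walk enters `[K, ∞)` at time `m` at the site `K`, after at least `M` visits to each site
in `[K - W, K)`. -/
def cleared (M : ℕ) (K W : ℤ) (m : ℕ) : Set Path :=
  {X | X ∈ entranceAt K m ∧ ∀ v, K - W ≤ v → v < K → M ≤ visitsBefore X m v}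

lemma measurableSet_cleared (M : ℕ) (K W : ℤ) (m : ℕ) : MeasurableSet (cleared M K W m) := by
  refine (measurableSet_entranceAt K m).inter ?_
  change MeasurableSet {X : Path | ∀ v, K - W ≤ v → v < K → M ≤ visitsBefore X m v}
  simp_rw [ofPred_forall]
  exact MeasurableSet.iInter fun v => MeasurableSet.iInter fun _ => MeasurableSet.iInter fun _ =>
    measurableSet_le measurable_const (measurable_visitsBefore m v)

lemma determinedBy_cleared (M : ℕ) (K W : ℤ) (m : ℕ) : DeterminedBy m (cleared M K W m) := by
  intro X X' h
  refine and_congr (determinedBy_entranceAt K m X X' h) ?_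
  exact forall₃_congr fun v _ _ => by rw [visitsBefore_congr fun i hi => h i hi.le]

/-- After the window is cleared, the walk meets the environment without cookies to its left, as
long as it does not leave the window. -/
lemma quenched_cleared_eq_zero {B : ℕ} (hB : ∀ s ∈ jumps μ, |s| ≤ B)
    (hS : AddSubmonoid.closure (jumps μ) = ⊤) {ω : Env} (hω : ∀ y j, M ≤ j → ω y j = μ)
    {N W K : ℤ} (hN : 2 * B + 1 ≤ N)
    (h0 : quenched (noCookiesLeft μ (shiftBy K ω)) 0 (confined (Ici (-N))) = 0) (m n : ℕ) (x : ℤ) :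
    quenched ω x (cleared M K W m ∩ after K m ⁻¹' upcrossing N W n) = 0 := by
  rw [quenched_inter_after (measurableSet_cleared M K W m) (determinedBy_cleared M K W m)
    (fun X hX => hX.1.2) (measurableSet_upcrossing N W n)]
  rw [setLIntegral_congr_fun (g := fun _ => 0) (measurableSet_cleared M K W m), lintegral_zero]
  intro X hX
  by_contra hne
  have hpos := pos_iff_ne_zero.2 hne
  have hrem := fun v => shiftBy_remaining_eq hω hX.1.1 hX.2 (v := v)
  refine (confined_pos_of_upcrossing (ω' := noCookiesLeft μ (shiftBy K ω)) hB hS hN n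
    (fun y hy => ?_) (fun y h1 h2 j => ?_) (fun y _ h2 j => ?_) (by omega) hpos).ne' h0
  · unfold noCookiesLeft
    rw [splice_of_le hy, sub_zero]
    exact remaining_eq_of_lt ω hX.1.1 (by omega)
  · rw [hrem y h1]
    unfold noCookiesLeft
    rw [splice_of_lt h2]
  · unfold noCookiesLeft
    rw [splice_of_lt h2]

/-- On a trial in which the walk eats up the cookies in the window, does not jump back over the
window, and tends to `+∞`, it performs an upcrossing after clearing the window. -/
lemma exists_cleared_upcrossing {X : Path} (hX : X ∈ transientRight) {W y : ℤ} (hW : -1 ≤ W)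
    (h1 : X ∈ trialAt y (eatUp W fun _ => M)) (h2 : X ∉ trialAt y (eatUpLong W fun _ => M))
    (N₀ : ℕ) : ∃ m n, ∃ N : ℕ, N₀ ≤ N ∧ X ∈ cleared M (y + W + 1) (W + 1) m ∩
      after (y + W + 1) m ⁻¹' upcrossing N (W + 1) n := by
  obtain ⟨n, hn, hn'⟩ := mem_iUnion.1 h1
  have hn'' : after y n X ∈ eatUp W fun _ => M := hn'
  rw [eatUp_eq_iUnion] at hn''
  obtain ⟨σ, hσ⟩ := mem_iUnion.1 hn''
  have hafter : ∀ i, after (y + W + 1) (n + σ) X i = after (W + 1) σ (after y n X) i := by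
    intro i
    simp only [after, add_assoc]
    ring
  obtain ⟨m, hm⟩ := eventually_atTop.1 (tendsto_atTop.1 hX (y + W + 1))
  refine ⟨n + σ, m, ∑ i ∈ Finset.range m, (-after (y + W + 1) (n + σ) X i).toNat + N₀,
    Nat.le_add_left _ _, ⟨⟨fun i hi => ?_, ?_⟩, fun v hv hv' => ?_⟩, fun i => ?_, fun i hi => ?_,
    fun i hi => ?_⟩
  · rcases lt_or_ge i n with h | h
    · have := hn.1 i h
      omega
    · obtain ⟨k, rfl⟩ := Nat.exists_eq_add_of_le h
      have h3 : X (n + k) - y ≤ W := (hσ.1 k (by omega)).2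
      omega
  · have h3 : X (n + σ) - y = W + 1 := hσ.2.1
    omega
  · rw [visitsBefore_after X y n σ v]
    exact (hσ.2.2 (v - y) ⟨by omega, by omega⟩).trans (Nat.le_add_left _ _)
  · rcases lt_or_ge i m with h | h
    · have h3 := Finset.single_le_sum (f := fun i => (-after (y + W + 1) (n + σ) X i).toNat)
        (fun _ _ => Nat.zero_le _) (Finset.mem_range.2 h)
      have h4 : (-after (y + W + 1) (n + σ) X i).toNat ≤
        ∑ i ∈ Finset.range m, (-after (y + W + 1) (n + σ) X i).toNat := h3
      omega
    · have h3 : y + W + 1 ≤ X (n + σ + i) := hm _ (by omega)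
      have h4 : after (y + W + 1) (n + σ) X i = X (n + σ + i) - (y + W + 1) := rfl
      omega
  · have h3 : y + W + 1 ≤ X (n + σ + i) := hm _ (by omega)
    have h4 : after (y + W + 1) (n + σ) X i = X (n + σ + i) - (y + W + 1) := rfl
    omega
  · refine h2 (mem_iUnion.2 ⟨n, hn, mem_iUnion.2 ⟨σ, hσ, i, ?_⟩⟩)
    rw [← hafter, ← hafter]
    exact hi

/-- If the walk started at `0` cannot stay in `[0, ∞)` then it is not transient to the right:
otherwise a trial in which it clears a large window of cookies succeeds together with transience.
For a large window it is unlikely, compared to the success of the trial, that the window is jumped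
over later. Then the walk performs an upcrossing, which shows that it could have stayed above `-N`
without cookies on the negative half-line, and this is impossible. -/
lemma Admissible.averaged_transientRight_eq_zero [IsProbabilityMeasure η] (hα : Admissible η M α)
    (hA : Assumptions η M μ) (h0 : ∫⁻ ω, quenched ω 0 (confined (Ici 0)) ∂η = 0) :
    averaged α transientRight = 0 := by
  by_contra hne
  have hprob := hα.prob
  obtain ⟨B, hB⟩ := hA.exists_bound
  obtain ⟨W₀, hW₀⟩ := hA.exists_eatUp_pos
  obtain ⟨N₀, hN₀⟩ := hA.ae_noCookiesLeft_eq_zero h0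
  obtain ⟨s, hs, htrial⟩ := hα.exists_trial hA measurableSet_transientRight (pos_iff_ne_zero.2 hne)
  set t := (averaged α).real transientRight
  have ht : 0 < t := ENNReal.toReal_pos hne (measure_ne_top _ _)
  have hs' : (0 : ℝ) < s := Nat.cast_pos.2 hs
  obtain ⟨W, hW, hexc⟩ := exists_excess_lt hA
    (ENNReal.ofReal_pos.2 (by positivity : 0 < t / (4 * s))) (W₀ + B)
  set A := eatUp W fun _ => M
  obtain ⟨y, hy, hyt⟩ := htrial A (measurableSet_eatUp W _) (dependsOnRight_eatUp W _)
  set p := ∫⁻ ω, quenched ω 0 A ∂η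
  have hp : 0 < p := hW₀ W (by omega)
  have hp1 : p ≤ 1 := by
    refine (lintegral_mono fun ω => prob_le_one).trans ?_
    simp
  have hptop : p ≠ ∞ := ne_top_of_le_ne_top ENNReal.one_ne_top hp1
  have hp' : 0 < p.toReal := ENNReal.toReal_pos hp.ne' hptop
  set L := trialAt y (eatUpLong W fun _ => M)
  have hLm : MeasurableSet L := measurableSet_trialAt y (measurableSet_eatUpLong W _)
  -- the window is rarely jumped over
  have hL : (averaged α).real L < p.toReal * (t / (4 * s)) := by
    have h1 := hα.averaged_trialAt_eatUpLong_le hA hB hy (W := W) (by omega) fun _ => M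
    have h2 : averaged α L < ENNReal.ofReal (t / (4 * s)) * p := by
      refine h1.trans_lt (ENNReal.mul_lt_mul_left hp.ne' hptop ?_)
      exact (excess_antitone (by omega)).trans_lt hexc
    have h3 := (ENNReal.toReal_lt_toReal (measure_ne_top _ _) (by finiteness)).2 h2
    rw [ENNReal.toReal_mul, ENNReal.toReal_ofReal (by positivity)] at h3
    rw [mul_comm]
    exact h3
  have hpos : averaged α ((transientRight ∩ trialAt y A) \ L) ≠ 0 := by
    intro hz
    have h1 : (averaged α).real (transientRight ∩ trialAt y A) ≤ (averaged α).real L := by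
      refine ENNReal.toReal_mono (measure_ne_top _ _) ?_
      refine (measure_le_inter_add_sdiff _ _ L).trans ?_
      rw [hz, add_zero]
      exact measure_mono inter_subset_right
    have h2 : p.toReal * t ≤ 4 * s * (averaged α).real L :=
      hyt.trans (mul_le_mul_of_nonneg_left h1 (by positivity))
    have h3 : 4 * s * (averaged α).real L < 4 * s * (p.toReal * (t / (4 * s))) :=
      mul_lt_mul_of_pos_left hL (by positivity)
    have h4 : 4 * s * (p.toReal * (t / (4 * s))) = p.toReal * t := by field_simp
    linarith
  refine hpos ((averaged_eq_zero_iff α ((measurableSet_transientRight.inter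
    (measurableSet_trialAt y (measurableSet_eatUp W _))).diff hLm)).2 ?_)
  set K : ℤ := y + W + 1
  have hnull : ∀ᵐ q ∂α, ∀ N : ℕ, N₀ ≤ N →
      quenched (noCookiesLeft μ (shiftBy K q.1)) 0 (confined (Ici (-(N : ℤ)))) = 0 := by
    rw [ae_all_iff]
    intro N
    rw [eventually_imp_distrib_left]
    intro hN
    have hm : Measurable fun ω : Env =>
        quenched (noCookiesLeft μ ω) 0 (confined (Ici (-(N : ℤ)))) :=
      (measurable_quenched_zero (measurableSet_confined _)).comp (measurable_noCookiesLeft μ)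
    have h := hα.lintegral_shiftBy hA.isIID (k := K) (by omega) hm
      (fun ω ω' h => by rw [dependsOnRight_noCookiesLeft h])
    have hm' : Measurable fun q : Env × ℤ =>
        quenched (noCookiesLeft μ (shiftBy K q.1)) 0 (confined (Ici (-(N : ℤ)))) :=
      hm.comp ((measurable_shiftBy K).comp measurable_fst)
    rw [hN₀ N hN, lintegral_eq_zero_iff hm'] at h
    exact h
  filter_upwards [hα.ae_niceEnv hA, hnull] with q hq hq0
  refine measure_mono_null (t := ⋃ (m) (n) (N : ℕ) (_ : N₀ + (2 * B + 1) ≤ N),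
    cleared M K (W + 1) m ∩ after K m ⁻¹' upcrossing N (W + 1) n) ?_ ?_
  · rintro X ⟨⟨hX1, hX2⟩, hX3⟩
    obtain ⟨m, n, N, hN, hX⟩ := exists_cleared_upcrossing hX1 (by omega) hX2 hX3
      (N₀ + (2 * B + 1))
    exact mem_iUnion₂.2 ⟨m, n, mem_iUnion₂.2 ⟨N, hN, hX⟩⟩
  · simp only [measure_iUnion_null_iff]
    intro m n N hN
    exact quenched_cleared_eq_zero hB hA.closure_jumps (fun y j hj => (hq y).2 j hj) (by omega)
      (hq0 N (by omega)) m n q.2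

/-- The zero-one law for admissible laws: the alternative is decided by whether the walk started
at `0` in an environment with law `η` has a chance to stay in `[0, ∞)`. -/
lemma Admissible.zero_one [IsProbabilityMeasure η] (hα : Admissible η M α)
    (hA : Assumptions η M μ) :
    (averaged α).real transientRight = 1 - (averaged α).real recurrent ∧
      (averaged α).real transientRight ∈ ({0, 1} : Set ℝ) := by
  have := hα.prob
  have h : (averaged α).real transientRight + (averaged α).real recurrent = 1 := by
    rw [Measure.real, Measure.real, ← ENNReal.toReal_add (measure_ne_top _ _) (measure_ne_top _ _),
      hα.averaged_add hA, ENNReal.toReal_one]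
  refine ⟨by linarith, ?_⟩
  by_cases h0 : ∫⁻ ω, quenched ω 0 (confined (Ici 0)) ∂η = 0
  · left
    rw [Measure.real, hα.averaged_transientRight_eq_zero hA h0, ENNReal.toReal_zero]
  · right
    have h1 : (averaged α).real recurrent = 0 := by
      rw [Measure.real, hα.averaged_recurrent_eq_zero hA h0, ENNReal.toReal_zero]
    rw [h1, add_zero] at h
    exact h

/-! ### The cookie environment process -/

lemma hitAbove_eq_zero {X : Path} {k : ℤ} (h : ∀ n, X n < k) : hitAbove X k = 0 := by
  unfold hitAbove
  have : {n | k ≤ X n} = ∅ := eq_empty_iff_forall_notMem.2 fun n hn => not_le.2 (h n) hn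
  rw [this, Nat.sInf_empty]

lemma measurable_hitAbove (k : ℤ) : Measurable fun X => hitAbove X k := by
  refine measurable_to_countable' fun n => ?_
  have h1 : MeasurableSet {X : Path | ∀ m, X m < k} := by
    rw [ofPred_forall]
    exact MeasurableSet.iInter fun m => measurableSet_lt (measurable_pi_apply m) measurable_const
  have h : (fun X => hitAbove X k) ⁻¹' {n} =
      firstEntrance k n ∪ ({X : Path | ∀ m, X m < k} ∩ {_X | n = 0}) := by
    ext X
    simp only [mem_preimage, mem_singleton_iff, mem_union]
    constructor
    · intro hX
      by_cases hc : ∃ m, k ≤ X m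
      · obtain ⟨m, hm⟩ := exists_firstEntrance hc
        rw [← hX, hitAbove_eq hm]
        exact Or.inl hm
      · push Not at hc
        exact Or.inr ⟨hc, by rw [mem_ofPred_eq, ← hX, hitAbove_eq_zero hc]⟩
    · rintro (hX | ⟨hX, hn⟩)
      · exact hitAbove_eq hX
      · have hn' : n = 0 := hn
        rw [hitAbove_eq_zero hX, hn']
  rw [h]
  exact (measurableSet_firstEntrance k n).union (h1.inter (MeasurableSet.const _))

/-- The state of the cookie environment process when `[k, ∞)` is entered at time `n`. -/
def stateAt (k : ℤ) (n : ℕ) (q : (Env × ℤ) × Path) : Env × ℤ :=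
  (shiftBy k (remaining q.1.1 q.2 n), q.2 n - k)

lemma measurable_stateAt (k : ℤ) (n : ℕ) : Measurable (stateAt k n) := by
  have h : Measurable fun q : (Env × ℤ) × Path => (q.1.1, q.2) :=
    (measurable_fst.comp measurable_fst).prodMk measurable_snd
  have h2 : Measurable fun q : (Env × ℤ) × Path => q.2 n - k :=
    by fun_prop
  exact ((measurable_shiftBy k).comp ((measurable_remaining n).comp h)).prodMk h2

lemma zeta_eq_stateAt (k : ℕ) (q : (Env × ℤ) × Path) :
    zeta k q = stateAt k (hitAbove q.2 k) q := by
  unfold zeta stateAt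
  rw [shift_iterate]

lemma zeta_of_firstEntrance {k n : ℕ} {q : (Env × ℤ) × Path} (h : q.2 ∈ firstEntrance k n) :
    zeta k q = stateAt k n q := by
  rw [zeta_eq_stateAt, hitAbove_eq h]

lemma measurable_zeta (k : ℕ) : Measurable (zeta k) := by
  have h1 : Measurable fun r : ℕ × ((Env × ℤ) × Path) => stateAt k r.1 r.2 :=
    measurable_from_prod_countable_right fun n => measurable_stateAt k n
  have h2 : Measurable fun q : (Env × ℤ) × Path => (hitAbove q.2 k, q) :=
    ((measurable_hitAbove k).comp measurable_snd).prodMk measurable_id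
  have h3 : zeta k = (fun r : ℕ × ((Env × ℤ) × Path) => stateAt k r.1 r.2) ∘
      fun q => (hitAbove q.2 k, q) := by
    funext q
    exact zeta_eq_stateAt k q
  rw [h3]
  exact h1.comp h2

lemma lintegral_zetaLaw (α : Measure (Env × ℤ)) [SFinite α] (k : ℕ) {F : Env × ℤ → ℝ≥0∞}
    (hF : Measurable F) :
    ∫⁻ p, F p ∂(zetaLaw α k) = ∫⁻ p, ∫⁻ X, F (zeta k (p, X)) ∂(quenched p.1 p.2) ∂α := by
  unfold zetaLaw
  have hm : Measurable fun q => F (zeta k q) := hF.comp (measurable_zeta k)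
  rw [lintegral_map hF (measurable_zeta k), Measure.lintegral_compProd hm]
  rfl

lemma measurable_lintegral_zeta (k : ℕ) {F : Env × ℤ → ℝ≥0∞} (hF : Measurable F) :
    Measurable fun p : Env × ℤ => ∫⁻ X, F (zeta k (p, X)) ∂(quenched p.1 p.2) := by
  have hm : Measurable fun q => F (zeta k q) := hF.comp (measurable_zeta k)
  exact measurable_lintegral_quenched hm measurable_id

instance (α : Measure (Env × ℤ)) [IsProbabilityMeasure α] (k : ℕ) :
    IsProbabilityMeasure (zetaLaw α k) :=
  Measure.isProbabilityMeasure_map (measurable_zeta k).aemeasurable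

lemma measurable_stateAt_right (k : ℤ) (n : ℕ) (p : Env × ℤ) :
    Measurable fun X => stateAt k n (p, X) :=
  (measurable_stateAt k n).comp measurable_prodMk_left

lemma measurable_zeta_right (k : ℕ) (p : Env × ℤ) : Measurable fun X => zeta k (p, X) :=
  (measurable_zeta k).comp measurable_prodMk_left

lemma lintegral_eq_tsum_firstEntrance {P : Measure Path} (h : ∀ᵐ X ∂P, X ∈ limsupTop) (k : ℤ)
    (F : Path → ℝ≥0∞) : ∫⁻ X, F X ∂P = ∑' n, ∫⁻ X in firstEntrance k n, F X ∂P := by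
  rw [← lintegral_iUnion (measurableSet_firstEntrance k)]
  · rw [Measure.restrict_eq_self_of_ae_mem]
    filter_upwards [h] with X hX
    exact mem_iUnion.2 (exists_firstEntrance (hX k).exists)
  · exact fun n m hnm => Set.disjoint_left.2 fun X h h' => hnm (firstEntrance_unique h h')

lemma lintegral_zeta {ω : Env} {x : ℤ} (h : ∀ᵐ X ∂(quenched ω x), X ∈ limsupTop) (k : ℕ)
    (F : Env × ℤ → ℝ≥0∞) :
    ∫⁻ X, F (zeta k ((ω, x), X)) ∂(quenched ω x) =
      ∑' n, ∫⁻ X in firstEntrance k n, F (stateAt k n ((ω, x), X)) ∂(quenched ω x) := by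
  rw [lintegral_eq_tsum_firstEntrance h k]
  refine tsum_congr fun n => setLIntegral_congr_fun (measurableSet_firstEntrance k n) fun X hX => ?_
  rw [zeta_of_firstEntrance hX]

lemma determinedBy_firstEntrance (k : ℤ) (n : ℕ) : DeterminedBy n (firstEntrance k n) := by
  intro X X' h
  unfold firstEntrance
  simp only [mem_ofPred_eq]
  rw [h n le_rfl]
  exact and_congr_left fun _ => forall₂_congr fun i hi => by rw [h i hi.le]

lemma stateAt_splice {k : ℤ} {n : ℕ} (ω ω' : Env) (x : ℤ) {X : Path}
    (hX : X ∈ firstEntrance k n) :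
    stateAt k n ((splice k ω ω', x), X) =
      (splice 0 (stateAt k n ((ω, x), X)).1 ω', (stateAt k n ((ω, x), X)).2) := by
  refine Prod.ext ?_ rfl
  funext v
  simp only [stateAt]
  rcases lt_or_ge v 0 with h | h
  · rw [splice_of_lt h]
    funext j
    simp only [shiftBy, remaining, removeCookies]
    rw [splice_of_lt (by omega)]
  · rw [splice_of_le h, sub_zero]
    unfold shiftBy
    rw [remaining_eq_of_lt _ hX.1 (by omega), splice_of_le (by omega), add_sub_cancel_right]

lemma stateAt_congr (k : ℤ) {n : ℕ} (p : Env × ℤ) {X X' : Path} (h : ∀ i ≤ n, X i = X' i) :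
    stateAt k n (p, X) = stateAt k n (p, X') := by
  unfold stateAt
  simp only
  rw [remaining_congr p.1 fun i hi => h i hi.le, h n le_rfl]

lemma lintegral_stateAt_splice (k : ℤ) (n : ℕ) (ω ω' : Env) (x : ℤ) {Φ : Env × ℤ → ℝ≥0∞}
    (hΦ : Measurable Φ) :
    ∫⁻ X in firstEntrance k n, Φ (stateAt k n ((splice k ω ω', x), X))
        ∂(quenched (splice k ω ω') x) =
      ∫⁻ X in firstEntrance k n, Φ (splice 0 (stateAt k n ((ω, x), X)).1 ω',
        (stateAt k n ((ω, x), X)).2) ∂(quenched ω x) := by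
  have hFE := measurableSet_firstEntrance k n
  have hF : Measurable ((firstEntrance k n).indicator
      fun X => Φ (stateAt k n ((splice k ω ω', x), X))) :=
    (hΦ.comp (measurable_stateAt_right k n (splice k ω ω', x))).indicator hFE
  rw [← lintegral_indicator hFE, lintegral_quenched_congr (I := Iio k) n
    (fun y hy => splice_of_lt hy ω ω') x hF]
  · rw [lintegral_indicator hFE]
    refine setLIntegral_congr_fun hFE fun X hX => ?_
    rw [← stateAt_splice ω ω' x hX]
  · intro X X' h
    by_cases hX : X ∈ firstEntrance k n
    · rw [indicator_of_mem hX, indicator_of_mem ((determinedBy_firstEntrance k n X X' h).1 hX)]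
      exact congrArg Φ (stateAt_congr k _ h)
    · rw [indicator_of_notMem hX,
        indicator_of_notMem fun h' => hX ((determinedBy_firstEntrance k n X X' h).2 h')]
  · intro X hX i hi
    exact (mem_of_indicator_ne_zero hX).1 i hi

lemma measurable_splice_left : Measurable fun r : (Env × ℤ) × Env =>
    ((splice 0 r.1.1 r.2, r.1.2) : Env × ℤ) :=
  ((measurable_splice 0).comp ((measurable_fst.comp measurable_fst).prodMk measurable_snd)).prodMk
    (measurable_snd.comp measurable_fst)

lemma Admissible.lintegral_zetaLaw_eq_tsum [IsProbabilityMeasure η] (hα : Admissible η M α)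
    (hA : Assumptions η M μ) (k : ℕ) {F : Env × ℤ → ℝ≥0∞} (hF : Measurable F) :
    ∫⁻ p, F p ∂(zetaLaw α k) = ∑' n, ∫⁻ p, ∫⁻ X in firstEntrance k n, F (stateAt k n (p, X))
      ∂(quenched p.1 p.2) ∂α := by
  have hprob := hα.prob
  rw [lintegral_zetaLaw α k hF, ← lintegral_tsum]
  · refine lintegral_congr_ae ?_
    filter_upwards [hα.ae_quenched_limsupTop hA] with p hp
    exact lintegral_zeta hp k F
  · intro n
    simp_rw [← lintegral_indicator (measurableSet_firstEntrance k n)]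
    refine (measurable_lintegral_quenched (F := fun r : (Env × ℤ) × Path =>
      (firstEntrance k n).indicator (fun X => F (stateAt k n (r.1, X))) r.2) ?_
      measurable_id).aemeasurable
    exact (hF.comp (measurable_stateAt k n)).indicator
      (measurable_snd (measurableSet_firstEntrance k n))

/-- At the first entrance into `[k, ∞)`, the stacks in `[k, ∞)` are fresh. -/
lemma Admissible.zetaLaw_fresh [IsProbabilityMeasure η] (hα : Admissible η M α)
    (hA : Assumptions η M μ) (k : ℕ) {Φ : Env × ℤ → ℝ≥0∞} (hΦ : Measurable Φ) :
    ∫⁻ p, Φ p ∂(zetaLaw α k) = ∫⁻ p, ∫⁻ ω, Φ (splice 0 p.1 ω, p.2) ∂η ∂(zetaLaw α k) := by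
  have hm : Measurable fun r : (Env × ℤ) × Env => Φ (splice 0 r.1.1 r.2, r.1.2) :=
    hΦ.comp measurable_splice_left
  rw [hα.lintegral_zetaLaw_eq_tsum hA k hΦ,
    hα.lintegral_zetaLaw_eq_tsum hA k hm.lintegral_prod_right']
  refine tsum_congr fun n => ?_
  have hmn : Measurable fun p : Env × ℤ =>
      ∫⁻ X in firstEntrance k n, Φ (stateAt k n (p, X)) ∂(quenched p.1 p.2) := by
    simp_rw [← lintegral_indicator (measurableSet_firstEntrance k n)]
    refine measurable_lintegral_quenched (F := fun r : (Env × ℤ) × Path =>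
      (firstEntrance k n).indicator (fun X => Φ (stateAt k n (r.1, X))) r.2) ?_ measurable_id
    exact (hΦ.comp (measurable_stateAt k n)).indicator
      (measurable_snd (measurableSet_firstEntrance k n))
  rw [hα.fresh_at hA.isIID (k := k) (by omega) hmn]
  refine lintegral_congr fun p => ?_
  simp_rw [lintegral_stateAt_splice k n p.1 _ p.2 hΦ]
  rw [lintegral_lintegral_swap]
  refine Measurable.aemeasurable ?_
  exact hm.comp (((measurable_stateAt_right k n p).comp measurable_snd).prodMk measurable_fst)

/-- The law of the cookie environment process at a fixed time is admissible. -/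
lemma admissible_zetaLaw [IsProbabilityMeasure η] (hA : Assumptions η M μ) (k : ℕ) :
    Admissible η M (zetaLaw (fromZero η) k) where
  prob := by
    have := (admissible_fromZero (M := M) hA.isIID).prob
    infer_instance
  nonneg := by
    have hadm := admissible_fromZero (M := M) hA.isIID
    have hm : MeasurableSet {p : Env × ℤ | 0 ≤ p.2} := measurable_snd measurableSet_Ici
    have h : zetaLaw (fromZero η) k {p | 0 ≤ p.2}ᶜ = 0 := by
      rw [← lintegral_indicator_one hm.compl,
        hadm.lintegral_zetaLaw_eq_tsum hA k (measurable_one.indicator hm.compl)]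
      refine ENNReal.tsum_eq_zero.2 fun n => ?_
      rw [lintegral_congr (g := fun _ => 0) fun p => ?_, lintegral_zero]
      rw [setLIntegral_congr_fun (g := fun _ => 0) (measurableSet_firstEntrance k n),
        lintegral_zero]
      intro X hX
      have h0 : stateAt k n (p, X) ∈ {p : Env × ℤ | 0 ≤ p.2} := by
        have := hX.2
        change 0 ≤ X n - k
        omega
      exact indicator_of_notMem (not_not.2 h0) _
    exact h
  fresh Φ hΦ := (admissible_fromZero hA.isIID).zetaLaw_fresh hA k hΦ
  dominated y S hS := by
    have hadm := admissible_fromZero (M := M) hA.isIID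
    have hprob := hadm.prob
    have hm : MeasurableSet {p : Env × ℤ | p.1 y ∈ S} :=
      ((measurable_pi_apply y).comp measurable_fst) hS
    set U : Set Env := {ω | ∃ l ∈ Finset.range (M + 1), (fun j => ω (y + k) (l + j)) ∈ S}
    have hUm : ∀ (z : ℤ) (l : ℕ), MeasurableSet {ω : Env | (fun j => ω z (l + j)) ∈ S} :=
      fun z l => (by fun_prop : Measurable fun ω : Env => fun j => ω z (l + j)) hS
    have hU : U = ⋃ l ∈ Finset.range (M + 1), {ω : Env | (fun j => ω (y + k) (l + j)) ∈ S} := by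
      ext ω; simp [U]
    have hUmeas : MeasurableSet U := by
      rw [hU]
      exact Finset.measurableSet_biUnion _ fun l _ => hUm (y + k) l
    have h1 : zetaLaw (fromZero η) k {p | p.1 y ∈ S} ≤ η U := by
      rw [← lintegral_indicator_one hm, lintegral_zetaLaw _ k (measurable_one.indicator hm),
        fromZero_eq_map, lintegral_map _ measurable_prodMk_right, ← lintegral_indicator_one hUmeas]
      · refine lintegral_mono_ae ?_
        filter_upwards [hA.mem_envSet] with ω hω
        have : ∀ X, ({p : Env × ℤ | p.1 y ∈ S}.indicator 1 (zeta k ((ω, 0), X)) : ℝ≥0∞) ≤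
            U.indicator 1 ω := by
          intro X
          by_cases h : (zeta k ((ω, 0), X)).1 y ∈ S
          · have hU : ω ∈ U := by
              rw [zeta_eq_stateAt] at h
              set n := hitAbove X k
              -- Removal of `M` or more cookies leaves a stack without cookies.
              refine ⟨min (visitsBefore X n (y + k)) M, by simp, ?_⟩
              convert h using 1
              funext j
              change _ = ω (y + k) (visitsBefore X n (y + k) + j)
              rcases le_total (visitsBefore X n (y + k)) M with h' | h'
              · rw [min_eq_left h']
              · rw [min_eq_right h', (hω _).2 _ (by omega), (hω _).2 _ (by omega)]
            rw [indicator_of_mem hU]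
            exact indicator_le_self' (fun _ _ => zero_le) _ |>.trans le_rfl
          · rw [indicator_of_notMem (by exact h)]
            exact zero_le
        refine (lintegral_mono this).trans ?_
        simp
      · exact measurable_lintegral_zeta k (measurable_one.indicator hm)
    refine h1.trans ?_
    rw [hU]
    refine (measure_biUnion_finset_le _ _).trans (le_of_eq (Finset.sum_congr rfl fun l _ => ?_))
    conv_rhs => rw [← hA.isIID.map_shiftBy (y + k)]
    rw [Measure.map_apply (measurable_shiftBy _) (hUm 0 l)]
    simp [shiftBy]

lemma glue_agree {n : ℕ} {X Z : Path} (h : Z 0 = X n) {i : ℕ} (hi : i ≤ n) :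
    glue n X Z i = X i := by
  rcases hi.lt_or_eq with h' | rfl
  · exact glue_of_lt h' X Z
  · rw [← h]
    simpa using glue_add i 0 X Z

lemma glue_mem_limsupTop_iff {n : ℕ} {X Z : Path} : glue n X Z ∈ limsupTop ↔ Z ∈ limsupTop := by
  refine forall_congr' fun m => ?_
  rw [frequently_atTop, frequently_atTop]
  constructor
  · intro h N
    obtain ⟨i, hi, hm⟩ := h (n + N)
    obtain ⟨j, rfl⟩ := Nat.exists_eq_add_of_le (show n ≤ i by omega)
    rw [glue_add] at hm
    exact ⟨j, by omega, hm⟩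
  · intro h N
    obtain ⟨i, hi, hm⟩ := h N
    exact ⟨n + i, by omega, by rwa [glue_add]⟩

lemma ae_remaining_limsupTop {ω : Env} {x : ℤ} (h : ∀ᵐ X ∂(quenched ω x), X ∈ limsupTop) (n : ℕ) :
    ∀ᵐ X ∂(quenched ω x), ∀ᵐ Z ∂(quenched (remaining ω X n) (X n)), Z ∈ limsupTop := by
  have h0 : quenched ω x limsupTopᶜ = 0 := h
  rw [quenched_apply_glue n ω x measurableSet_limsupTop.compl] at h0
  simp only [mem_compl_iff, glue_mem_limsupTop_iff] at h0
  have hm : Measurable fun X : Path => quenched (remaining ω X n) (X n) {Z | Z ∉ limsupTop} := by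
    have h1 : Measurable fun X : Path => ((remaining ω X n, X n) : Env × ℤ) :=
      ((measurable_remaining n).comp (measurable_const.prodMk measurable_id)).prodMk
        (measurable_pi_apply n)
    change Measurable fun X : Path => quenched (remaining ω X n) (X n) limsupTopᶜ
    simpa only [Function.comp_def] using
      (measurable_quenched_apply measurableSet_limsupTop.compl).comp h1
  rw [lintegral_eq_zero_iff hm] at h0
  exact h0

lemma shiftBy_shiftBy (a b : ℤ) (ω : Env) : shiftBy a (shiftBy b ω) = shiftBy (a + b) ω := by
  funext y
  simp only [shiftBy, add_assoc]

lemma remaining_shiftBy (k : ℤ) (ω : Env) (Z : Path) (m : ℕ) :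
    remaining (shiftBy k ω) (translate k Z) m = shiftBy k (remaining ω Z m) := by
  funext y j
  simp only [remaining, removeCookies, shiftBy, visitsBefore_translate]

lemma zeta_succ_glue {k n : ℕ} {p : Env × ℤ} {X Z : Path} (hX : X ∈ firstEntrance k n)
    (hZ : Z ∈ limsupTop) :
    zeta (k + 1) (p, glue n X Z) = zeta 1 (stateAt k n (p, X), translate k Z) := by
  obtain ⟨m, hm⟩ := exists_firstEntrance (hZ (k + 1)).exists
  have h1 : glue n X Z ∈ firstEntrance ((k + 1 : ℕ) : ℤ) (n + m) := by
    push_cast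
    refine ⟨fun i hi => ?_, by rw [glue_add]; exact hm.2⟩
    rcases lt_or_ge i n with h | h
    · rw [glue_of_lt h]
      exact (hX.1 i h).trans (by omega)
    · obtain ⟨j, rfl⟩ := Nat.exists_eq_add_of_le h
      rw [glue_add]
      exact hm.1 j (by omega)
  have h2 : translate k Z ∈ firstEntrance ((1 : ℕ) : ℤ) m := by
    refine ⟨fun i hi => ?_, ?_⟩
    · have := hm.1 i hi
      change Z i - k < _
      push_cast
      omega
    · have := hm.2
      change _ ≤ Z m - k
      push_cast
      omega
  rw [zeta_of_firstEntrance (q := (p, glue n X Z)) h1,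
    zeta_of_firstEntrance (q := (stateAt k n (p, X), translate k Z)) h2]
  unfold stateAt
  simp only [remaining_glue, remaining_shiftBy, shiftBy_shiftBy, glue_add]
  refine Prod.ext ?_ ?_
  · simp only [Nat.cast_add, Nat.cast_one]
    rw [add_comm]
  · simp only [translate]
    push_cast
    ring

lemma measurable_comp_zeta_right (k : ℕ) (p : Env × ℤ) {F : Env × ℤ → ℝ≥0∞} (hF : Measurable F) :
    Measurable fun X => F (zeta k (p, X)) :=
  hF.comp (measurable_zeta_right k p)

/-- The Markov property of the cookie environment process in a fixed environment. -/
lemma lintegral_zeta_succ {ω : Env} {x : ℤ} (h : ∀ᵐ X ∂(quenched ω x), X ∈ limsupTop) (k : ℕ)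
    {F : Env × ℤ → ℝ≥0∞} (hF : Measurable F) :
    ∫⁻ X, F (zeta (k + 1) ((ω, x), X)) ∂(quenched ω x) =
      ∫⁻ X, (fun p : Env × ℤ => ∫⁻ Y, F (zeta 1 (p, Y)) ∂(quenched p.1 p.2))
        (zeta k ((ω, x), X)) ∂(quenched ω x) := by
  rw [lintegral_zeta h k fun p => ∫⁻ Y, F (zeta 1 (p, Y)) ∂(quenched p.1 p.2),
    lintegral_eq_tsum_firstEntrance h k]
  refine tsum_congr fun n => ?_
  have hFE := measurableSet_firstEntrance k n
  have hmF : Measurable fun X => F (zeta (k + 1) ((ω, x), X)) :=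
    hF.comp (measurable_zeta_right _ _)
  rw [← lintegral_indicator hFE, ← lintegral_indicator hFE,
    lintegral_quenched_glue n ω x (hmF.indicator hFE)]
  refine lintegral_congr_ae ?_
  filter_upwards [ae_remaining_limsupTop h n] with X hlim
  have hstart := ae_start (remaining ω X n) (X n)
  by_cases hX : X ∈ firstEntrance k n
  · rw [indicator_of_mem hX]
    change _ = ∫⁻ Y, F (zeta 1 (stateAt k n ((ω, x), X), Y))
      ∂(quenched (shiftBy k (remaining ω X n)) (X n - k))
    rw [quenched_shiftBy, sub_add_cancel,
      lintegral_map (measurable_comp_zeta_right 1 _ hF) (measurable_translate k)]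
    refine lintegral_congr_ae ?_
    filter_upwards [hlim, hstart] with Z hZ hZ0
    have hglue : glue n X Z ∈ firstEntrance k n :=
      (determinedBy_firstEntrance k n _ _ fun i hi => glue_agree hZ0 hi).2 hX
    rw [indicator_of_mem hglue, zeta_succ_glue hX hZ]
  · rw [indicator_of_notMem hX, lintegral_congr_ae (g := fun _ => 0), lintegral_zero]
    filter_upwards [hstart] with Z hZ0
    refine indicator_of_notMem (fun hc => hX ?_) _
    exact (determinedBy_firstEntrance k n _ _ fun i hi => glue_agree hZ0 hi).1 hc

/-- The Markov property of the cookie environment process. -/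
lemma Admissible.zetaLaw_succ [IsProbabilityMeasure η] (hα : Admissible η M α)
    (hA : Assumptions η M μ) (k : ℕ) : zetaLaw (zetaLaw α k) 1 = zetaLaw α (k + 1) := by
  have hprob := hα.prob
  refine Measure.ext_of_lintegral _ fun F hF => ?_
  rw [lintegral_zetaLaw _ 1 hF, lintegral_zetaLaw _ k (measurable_lintegral_zeta 1 hF),
    lintegral_zetaLaw _ (k + 1) hF]
  refine lintegral_congr_ae ?_
  filter_upwards [hα.ae_quenched_limsupTop hA] with p hp
  exact (lintegral_zeta_succ hp k hF).symm

/-! ### Continuity -/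

lemma continuous_splice (k : ℤ) : Continuous fun p : Env × Env => splice k p.1 p.2 := by
  refine continuous_pi fun y => ?_
  unfold splice
  split_ifs <;> fun_prop

lemma continuous_cyl (X : Path) (n : ℕ) :
    Continuous fun p : Env × ℤ => (quenched p.1 p.2).real (cyl X n) := by
  induction n with
  | zero =>
    have : ∀ p : Env × ℤ, (quenched p.1 p.2).real (cyl X 0) =
        (fun x : ℤ => if X 0 = x then (1 : ℝ) else 0) p.2 := by
      intro p
      rw [Measure.real, quenched_cyl_zero]
      by_cases h : X 0 = p.2 <;> simp [h]
    simp_rw [this]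
    exact (continuous_of_discreteTopology
      (f := fun x : ℤ => if X 0 = x then (1 : ℝ) else 0)).comp continuous_snd
  | succ n ih =>
    have : ∀ p : Env × ℤ, (quenched p.1 p.2).real (cyl X (n + 1)) =
        (quenched p.1 p.2).real (cyl X n) *
          ((p.1 (X n) (visitsBefore X n (X n)) {X (n + 1) - X n} : NNReal) : ℝ) := by
      intro p
      rw [Measure.real, quenched_cyl_succ, ENNReal.toReal_mul]
      rfl
    simp_rw [this]
    refine ih.mul (NNReal.continuous_coe.comp ((continuous_eval_M1 _).comp ?_))
    fun_prop

lemma continuous_stateAt (k : ℤ) (n : ℕ) (X : Path) :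
    Continuous fun p : Env × ℤ => stateAt k n (p, X) := by
  refine Continuous.prodMk ?_ (continuous_const (y := X n - k))
  refine continuous_pi fun y => continuous_pi fun j => ?_
  simp only [shiftBy, remaining, removeCookies]
  fun_prop

lemma extend_frestrictLe (n : ℕ) (X : Path) {i : ℕ} (hi : i ≤ n) :
    extend (Preorder.frestrictLe (π := fun _ => ℤ) n X) i = X i := by
  simp [extend, hi, Preorder.frestrictLe]

/-- The integral of a function of the trajectory up to time `n` is a sum over finite histories. -/
lemma lintegral_eq_tsum_cyl (P : Measure Path) (n : ℕ) {F : Path → ℝ≥0∞}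
    (hF : ∀ X X' : Path, (∀ i ≤ n, X i = X' i) → F X = F X') :
    ∫⁻ X, F X ∂P = ∑' h : (i : Finset.Iic n) → ℤ, F (extend h) * P (cyl (extend h) n) := by
  have hU : ⋃ h : (i : Finset.Iic n) → ℤ, cyl (extend h) n = univ := by
    refine eq_univ_of_forall fun X => mem_iUnion.2 ⟨Preorder.frestrictLe (π := fun _ => ℤ) n X, ?_⟩
    exact fun i hi => (extend_frestrictLe n X hi).symm
  rw [← setLIntegral_univ, ← hU, lintegral_iUnion fun h => measurableSet_cyl _ n]
  · refine tsum_congr fun h => ?_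
    rw [← setLIntegral_const]
    exact setLIntegral_congr_fun (measurableSet_cyl _ n) fun X hX => hF X _ hX
  · intro h h' hne
    refine Set.disjoint_left.2 fun X hX hX' => hne ?_
    rw [← frestrictLe_extend h, ← frestrictLe_extend h']
    funext i
    exact (hX i (Finset.mem_Iic.1 i.2)).symm.trans (hX' i (Finset.mem_Iic.1 i.2))

/-- The contribution of a finite history to the expectation of `f (ζ₁)`: the history has to end
with the first entrance into `[1, ∞)`. Unlike the expectation itself, it is continuous in the
initial state. -/
def historyTerm (f : (Env × ℤ) →ᵇ ℝ) (i : Σ n : ℕ, (Finset.Iic n → ℤ)) (p : Env × ℤ) : ℝ :=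
  (firstEntrance 1 i.1).indicator (fun X => f (stateAt 1 i.1 (p, X)) *
    (quenched p.1 p.2).real (cyl X i.1)) (extend i.2)

lemma continuous_historyTerm (f : (Env × ℤ) →ᵇ ℝ) (i : Σ n : ℕ, (Finset.Iic n → ℤ)) :
    Continuous (historyTerm f i) := by
  unfold historyTerm
  by_cases h : extend i.2 ∈ firstEntrance 1 i.1
  · simp only [indicator_of_mem h]
    exact (f.continuous.comp (continuous_stateAt 1 i.1 _)).mul (continuous_cyl _ _)
  · simp only [indicator_of_notMem h]
    exact continuous_const

lemma historyTerm_nonneg {f : (Env × ℤ) →ᵇ ℝ} (hf : 0 ≤ f) (i : Σ n : ℕ, (Finset.Iic n → ℤ))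
    (p : Env × ℤ) : 0 ≤ historyTerm f i p :=
  indicator_nonneg (fun _ _ => mul_nonneg (hf _) measureReal_nonneg) _

lemma norm_historyTerm_le (f : (Env × ℤ) →ᵇ ℝ) (i : Σ n : ℕ, (Finset.Iic n → ℤ)) (p : Env × ℤ) :
    ‖historyTerm f i p‖ ≤ ‖f‖ := by
  unfold historyTerm
  refine (norm_indicator_le_norm_self _ _).trans ?_
  rw [norm_mul, Real.norm_of_nonneg (measureReal_nonneg (μ := quenched p.1 p.2))]
  exact (mul_le_of_le_one_right (norm_nonneg _) measureReal_le_one).trans (f.norm_coe_le_norm _)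

/-- `historyTerm` as a bounded continuous function. -/
def historyTermBCF (f : (Env × ℤ) →ᵇ ℝ) (i : Σ n : ℕ, (Finset.Iic n → ℤ)) : (Env × ℤ) →ᵇ ℝ :=
  BoundedContinuousFunction.ofNormedAddCommGroup (historyTerm f i) (continuous_historyTerm f i) ‖f‖
    (norm_historyTerm_le f i)

lemma lintegral_zeta_one_eq_tsum {f : (Env × ℤ) →ᵇ ℝ} (hf : 0 ≤ f) {p : Env × ℤ}
    (h : ∀ᵐ X ∂(quenched p.1 p.2), X ∈ limsupTop) :
    ∫⁻ X, ENNReal.ofReal (f (zeta 1 (p, X))) ∂(quenched p.1 p.2) =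
      ∑' i, ENNReal.ofReal (historyTerm f i p) := by
  obtain ⟨ω, x⟩ := p
  rw [lintegral_zeta (F := fun p => ENNReal.ofReal (f p)) h 1, ENNReal.tsum_sigma']
  refine tsum_congr fun n => ?_
  have hFE := measurableSet_firstEntrance (1 : ℕ) n
  rw [← lintegral_indicator hFE, lintegral_eq_tsum_cyl _ n]
  · refine tsum_congr fun g => ?_
    unfold historyTerm
    simp only [Nat.cast_one]
    by_cases hX : extend g ∈ firstEntrance 1 n
    · rw [indicator_of_mem hX, indicator_of_mem hX,
        ENNReal.ofReal_mul (show (0 : ℝ) ≤ f _ from hf _), Measure.real,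
        ENNReal.ofReal_toReal (measure_ne_top _ _)]
    · rw [indicator_of_notMem hX, indicator_of_notMem hX]
      simp
  · intro X X' hXX'
    by_cases hX : X ∈ firstEntrance (1 : ℕ) n
    · rw [indicator_of_mem hX, indicator_of_mem ((determinedBy_firstEntrance _ n X X' hXX').1 hX),
        stateAt_congr _ _ hXX']
    · rw [indicator_of_notMem hX,
        indicator_of_notMem fun h' => hX ((determinedBy_firstEntrance _ n X X' hXX').2 h')]

/-! ### Limits of the Cesàro averages -/

lemma cesaro_apply (η : Measure Env) (n : ℕ) (s : Set (Env × ℤ)) :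
    cesaro η n s = (n : ℝ≥0∞)⁻¹ * ∑ k ∈ Finset.Icc 1 n, zetaLaw (fromZero η) k s := by
  unfold cesaro
  rw [Measure.smul_apply, Measure.finsetSum_apply, smul_eq_mul]

lemma lintegral_cesaro (η : Measure Env) (n : ℕ) (F : Env × ℤ → ℝ≥0∞) :
    ∫⁻ p, F p ∂(cesaro η n) =
      (n : ℝ≥0∞)⁻¹ * ∑ k ∈ Finset.Icc 1 n, ∫⁻ p, F p ∂(zetaLaw (fromZero η) k) := by
  unfold cesaro
  rw [lintegral_smul_measure, lintegral_finsetSum_measure, smul_eq_mul]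

lemma inv_mul_sum_le {n : ℕ} {a : ℕ → ℝ≥0∞} {c : ℝ≥0∞} (h : ∀ k, a k ≤ c) :
    (n : ℝ≥0∞)⁻¹ * ∑ k ∈ Finset.Icc 1 n, a k ≤ c := by
  rcases Nat.eq_zero_or_pos n with rfl | hn
  · simp
  · calc (n : ℝ≥0∞)⁻¹ * ∑ k ∈ Finset.Icc 1 n, a k ≤ (n : ℝ≥0∞)⁻¹ * ∑ k ∈ Finset.Icc 1 n, c := by
          gcongr with k hk
          exact h k
      _ = c := by
          rw [Finset.sum_const, Nat.card_Icc, Nat.add_sub_cancel, nsmul_eq_mul, ← mul_assoc,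
            ENNReal.inv_mul_cancel (by simpa using hn.ne') (ENNReal.natCast_ne_top n), one_mul]

instance [IsProbabilityMeasure η] : IsProbabilityMeasure (fromZero η) := by
  unfold fromZero; infer_instance

lemma cesaro_univ [IsProbabilityMeasure η] {n : ℕ} (hn : 0 < n) : cesaro η n univ = 1 := by
  rw [cesaro_apply]
  simp only [measure_univ, Finset.sum_const, Nat.card_Icc, Nat.add_sub_cancel, nsmul_eq_mul,
    mul_one]
  exact ENNReal.inv_mul_cancel (by simpa using hn.ne') (ENNReal.natCast_ne_top n)

lemma admissible_cesaro [IsProbabilityMeasure η] (hA : Assumptions η M μ) {n : ℕ} (hn : 0 < n) :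
    Admissible η M (cesaro η n) where
  prob := ⟨cesaro_univ hn⟩
  nonneg := by
    have h : cesaro η n {p | ¬ 0 ≤ p.2} = 0 := by
      rw [cesaro_apply, Finset.sum_eq_zero, mul_zero]
      exact fun k _ => (admissible_zetaLaw hA k).nonneg
    exact h
  fresh Φ hΦ := by
    rw [lintegral_cesaro, lintegral_cesaro]
    congr 1
    exact Finset.sum_congr rfl fun k _ => (admissible_zetaLaw hA k).fresh Φ hΦ
  dominated y S hS := by
    rw [cesaro_apply]
    exact inv_mul_sum_le fun k => (admissible_zetaLaw hA k).dominated y S hS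

/-- One step of the chain changes a Cesàro average by at most one of its terms. -/
lemma lintegral_zeta_cesaro_le [IsProbabilityMeasure η] (hA : Assumptions η M μ) (n : ℕ)
    {F : Env × ℤ → ℝ≥0∞} (hF : Measurable F) {c : ℝ≥0∞} (hc : ∀ p, F p ≤ c) :
    ∫⁻ p, ∫⁻ X, F (zeta 1 (p, X)) ∂(quenched p.1 p.2) ∂(cesaro η n) ≤
      ∫⁻ p, F p ∂(cesaro η n) + (n : ℝ≥0∞)⁻¹ * c := by
  have hadm : Admissible η M (fromZero η) := admissible_fromZero hA.isIID
  rw [lintegral_cesaro, lintegral_cesaro, ← mul_add]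
  gcongr
  have h1 : ∀ k, ∫⁻ p, ∫⁻ X, F (zeta 1 (p, X)) ∂(quenched p.1 p.2) ∂(zetaLaw (fromZero η) k) =
      ∫⁻ p, F p ∂(zetaLaw (fromZero η) (k + 1)) := by
    intro k
    rw [← hadm.zetaLaw_succ hA k, lintegral_zetaLaw _ 1 hF]
  simp_rw [h1]
  have h2 : ∫⁻ p, F p ∂(zetaLaw (fromZero η) (n + 1)) ≤ c := by
    refine (lintegral_mono hc).trans ?_
    simp
  have h3 : ∀ b : ℕ → ℝ≥0∞, ∑ k ∈ Finset.Icc 1 n, b (k + 1) ≤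
      ∑ k ∈ Finset.Icc 1 n, b k + b (n + 1) := by
    intro b
    rw [← Finset.sum_Icc_succ_top (by omega),
      ← Finset.sum_image (f := b) (g := fun k => k + 1) (by simp)]
    refine Finset.sum_le_sum_of_subset fun k hk => ?_
    simp only [Finset.mem_image, Finset.mem_Icc] at hk ⊢
    omega
  exact (h3 fun k => ∫⁻ p, F p ∂(zetaLaw (fromZero η) k)).trans (add_le_add le_rfl h2)

lemma lintegral_ofReal_bcf {ν : Measure (Env × ℤ)} [IsFiniteMeasure ν] {f : (Env × ℤ) →ᵇ ℝ}
    (hf : 0 ≤ f) : ∫⁻ p, ENNReal.ofReal (f p) ∂ν = ENNReal.ofReal (∫ p, f p ∂ν) :=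
  (ofReal_integral_eq_lintegral_ofReal (f.integrable ν) (ae_of_all _ fun p => hf p)).symm

instance [IsProbabilityMeasure η] (n : ℕ) : IsFiniteMeasure (cesaro η n) := by
  rcases Nat.eq_zero_or_pos n with rfl | hn
  · exact ⟨by simp [cesaro_apply]⟩
  · exact ⟨by rw [cesaro_univ hn]; exact ENNReal.one_lt_top⟩

lemma IsCesaroLimit.exists_subseq {π : Measure (Env × ℤ)} (hπ : IsCesaroLimit η π) :
    ∃ φ : ℕ → ℕ, StrictMono φ ∧ (∀ m, 0 < φ m) ∧ ∀ f : (Env × ℤ) →ᵇ ℝ,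
      Tendsto (fun m => ∫ p, f p ∂(cesaro η (φ m))) atTop (𝓝 (∫ p, f p ∂π)) := by
  obtain ⟨φ, hφ, h⟩ := hπ.weak_limit
  refine ⟨fun m => φ (m + 1), fun a b hab => hφ (by omega), fun m => ?_, fun f =>
    (h f).comp (tendsto_add_atTop_nat 1)⟩
  exact (Nat.zero_le _).trans_lt (hφ (Nat.lt_succ_self m))

/-- `π` is the weak limit of the Cesàro averages along `φ`, with all the properties of
`IsCesaroLimit` but that of being carried by the state space, which follows from the others. The
index `0`, for which the Cesàro average is the zero measure, is excluded. -/
structure IsWeakLimit (η : Measure Env) (π : Measure (Env × ℤ)) (φ : ℕ → ℕ) : Prop where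
  prob : IsProbabilityMeasure π
  strictMono : StrictMono φ
  pos : ∀ m, 0 < φ m
  tendsto : ∀ f : (Env × ℤ) →ᵇ ℝ,
    Tendsto (fun m => ∫ p, f p ∂(cesaro η (φ m))) atTop (𝓝 (∫ p, f p ∂π))

variable {π : Measure (Env × ℤ)} {φ : ℕ → ℕ}

lemma IsWeakLimit.measure_le [IsProbabilityMeasure η] (h : IsWeakLimit η π φ)
    {G : Set (Env × ℤ)} (hG : IsOpen G) {c : ℝ≥0∞} (hc : ∀ n, 0 < n → cesaro η n G ≤ c) :
    π G ≤ c := by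
  have := h.prob
  let ν : ℕ → ProbabilityMeasure (Env × ℤ) := fun m => ⟨cesaro η (φ m), ⟨cesaro_univ (h.pos m)⟩⟩
  have hν : Tendsto ν atTop (𝓝 ⟨π, h.prob⟩) :=
    ProbabilityMeasure.tendsto_iff_forall_integral_tendsto.2 fun f => h.tendsto f
  refine (ProbabilityMeasure.le_liminf_measure_open_of_tendsto hν hG).trans ?_
  refine liminf_le_of_le (by isBoundedDefault) fun b hb => ?_
  obtain ⟨m, hm⟩ := hb.exists
  exact hm.trans (hc _ (h.pos m))

lemma isOpen_snd_neg : IsOpen {p : Env × ℤ | ¬ 0 ≤ p.2} :=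
  (isOpen_discrete {z : ℤ | ¬ 0 ≤ z}).preimage continuous_snd

/-- Freshness of the stacks in `[0, ∞)` passes to weak limits. -/
lemma IsWeakLimit.fresh [IsProbabilityMeasure η] (hA : Assumptions η M μ)
    (h : IsWeakLimit η π φ) :
    (π.prod η).map (fun r : (Env × ℤ) × Env => ((splice 0 r.1.1 r.2, r.1.2) : Env × ℤ)) = π := by
  have := h.prob
  have hs := measurable_splice_left
  have hc : Continuous fun r : (Env × ℤ) × Env => ((splice 0 r.1.1 r.2, r.1.2) : Env × ℤ) :=
    ((continuous_splice 0).comp ((continuous_fst.comp continuous_fst).prodMk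
      continuous_snd)).prodMk (continuous_snd.comp continuous_fst)
  have : IsProbabilityMeasure ((π.prod η).map fun r : (Env × ℤ) × Env =>
      ((splice 0 r.1.1 r.2, r.1.2) : Env × ℤ)) :=
    Measure.isProbabilityMeasure_map hs.aemeasurable
  refine ext_of_forall_integral_eq_of_IsFiniteMeasure fun f => ?_
  -- The average of `f` over the fresh part of the environment is continuous.
  have hint : ∀ p : Env × ℤ, Integrable (fun ω => f (splice 0 p.1 ω, p.2)) η := fun p =>
    (integrable_const ‖f‖).mono' ((f.continuous.measurable.comp
      (hs.comp measurable_prodMk_left)).aestronglyMeasurable)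
      (ae_of_all _ fun ω => f.norm_coe_le_norm _)
  have hcont : Continuous fun p : Env × ℤ => ∫ ω, f (splice 0 p.1 ω, p.2) ∂η := by
    refine continuous_of_dominated (bound := fun _ => ‖f‖) (fun p => (hint p).1)
      (fun p => ae_of_all _ fun ω => f.norm_coe_le_norm _) (integrable_const _)
      (ae_of_all _ fun ω => f.continuous.comp (hc.comp
        (continuous_id.prodMk continuous_const)))
  let g : (Env × ℤ) →ᵇ ℝ := BoundedContinuousFunction.ofNormedAddCommGroup
    (fun p => ∫ ω, f (splice 0 p.1 ω, p.2) ∂η) hcont ‖f‖ fun p => by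
      refine (norm_integral_le_integral_norm _).trans ?_
      refine (integral_mono_of_nonneg (ae_of_all _ fun _ => norm_nonneg _)
        (integrable_const ‖f‖) (ae_of_all _ fun ω => f.norm_coe_le_norm _)).trans ?_
      simp
  have hg : ∀ ν : Measure (Env × ℤ), IsProbabilityMeasure ν →
      ∫ p, f p ∂((ν.prod η).map fun r : (Env × ℤ) × Env =>
        ((splice 0 r.1.1 r.2, r.1.2) : Env × ℤ)) = ∫ p, g p ∂ν := by
    intro ν hν
    have hi : Integrable (fun r : (Env × ℤ) × Env => f (splice 0 r.1.1 r.2, r.1.2)) (ν.prod η) :=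
      (integrable_const ‖f‖).mono' (f.continuous.measurable.comp hs).aestronglyMeasurable
        (ae_of_all _ fun r => f.norm_coe_le_norm _)
    rw [integral_map hs.aemeasurable f.continuous.measurable.aestronglyMeasurable,
      integral_prod _ hi]
    rfl
  rw [hg π h.prob]
  have h1 := h.tendsto g
  have h2 : ∀ m, ∫ p, g p ∂(cesaro η (φ m)) = ∫ p, f p ∂(cesaro η (φ m)) := by
    intro m
    have hadm := admissible_cesaro hA (h.pos m)
    rw [← hg _ hadm.prob]
    congr 1
    have := hadm.prob
    refine Measure.ext_of_lintegral _ fun Φ hΦ => ?_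
    have hm : Measurable fun r : (Env × ℤ) × Env => Φ (splice 0 r.1.1 r.2, r.1.2) := hΦ.comp hs
    rw [lintegral_map hΦ hs, lintegral_prod _ hm.aemeasurable]
    exact (hadm.fresh Φ hΦ).symm
  simp_rw [h2] at h1
  exact tendsto_nhds_unique h1 (h.tendsto f)

/-- The domination of stacks passes to weak limits, by the outer regularity of the bound. -/
lemma IsWeakLimit.dominated [IsProbabilityMeasure η] (hA : Assumptions η M μ)
    (h : IsWeakLimit η π φ) (y : ℤ) {S : Set (ℕ → M1)} (hS : MeasurableSet S) :
    π {p | p.1 y ∈ S} ≤ ∑ l ∈ Finset.range (M + 1), η {ω | (fun j => ω 0 (l + j)) ∈ S} := by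
  set κ : Measure (ℕ → M1) := ∑ l ∈ Finset.range (M + 1), η.map fun ω : Env => fun j => ω 0 (l + j)
  have hm : ∀ l, Measurable fun ω : Env => fun j => ω 0 (l + j) := fun l => by fun_prop
  have hκ : ∀ U, MeasurableSet U →
      κ U = ∑ l ∈ Finset.range (M + 1), η {ω | (fun j => ω 0 (l + j)) ∈ U} := by
    intro U hU
    rw [Measure.finsetSum_apply]
    exact Finset.sum_congr rfl fun l _ => Measure.map_apply (hm l) hU
  have hfin : IsFiniteMeasure κ := by
    refine ⟨?_⟩
    rw [hκ univ .univ]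
    exact ENNReal.sum_lt_top.2 fun l _ => measure_lt_top _ _
  rw [← hκ S hS, S.measure_eq_iInf_isOpen]
  refine le_iInf fun U => le_iInf fun hSU => le_iInf fun hU => ?_
  refine (measure_mono fun p hp => hSU hp : π {p | p.1 y ∈ S} ≤ π {p | p.1 y ∈ U}).trans ?_
  refine h.measure_le (hU.preimage ((continuous_apply y).comp continuous_fst)) fun n hn => ?_
  rw [hκ U hU.measurableSet]
  exact (admissible_cesaro hA hn).dominated y U hU.measurableSet

lemma IsWeakLimit.admissible [IsProbabilityMeasure η] (hA : Assumptions η M μ)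
    (h : IsWeakLimit η π φ) : Admissible η M π where
  prob := h.prob
  nonneg := nonpos_iff_eq_zero.1 (h.measure_le isOpen_snd_neg fun _ hn =>
    (admissible_cesaro hA hn).nonneg.le)
  fresh Φ hΦ := by
    have := h.prob
    have hm : Measurable fun r : (Env × ℤ) × Env => Φ (splice 0 r.1.1 r.2, r.1.2) :=
      hΦ.comp measurable_splice_left
    conv_lhs => rw [← h.fresh hA]
    rw [lintegral_map hΦ measurable_splice_left, lintegral_prod _ hm.aemeasurable]
  dominated y S hS := h.dominated hA y hS

lemma IsWeakLimit.tendsto_lintegral [IsProbabilityMeasure η] (h : IsWeakLimit η π φ)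
    {f : (Env × ℤ) →ᵇ ℝ} (hf : 0 ≤ f) :
    Tendsto (fun m => ∫⁻ p, ENNReal.ofReal (f p) ∂(cesaro η (φ m))) atTop
      (𝓝 (∫⁻ p, ENNReal.ofReal (f p) ∂π)) := by
  have := h.prob
  simp_rw [lintegral_ofReal_bcf hf]
  exact (ENNReal.continuous_ofReal.tendsto _).comp (h.tendsto f)

/-- One half of stationarity: the expectation of `f (ζ₁)` is lower semicontinuous in the initial
state, since it is a sum of nonnegative continuous functions. -/
lemma IsWeakLimit.lintegral_zetaLaw_le [IsProbabilityMeasure η] (hA : Assumptions η M μ)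
    (h : IsWeakLimit η π φ) {f : (Env × ℤ) →ᵇ ℝ} (hf : 0 ≤ f) :
    ∫⁻ p, ENNReal.ofReal (f p) ∂(zetaLaw π 1) ≤ ∫⁻ p, ENNReal.ofReal (f p) ∂π := by
  have := h.prob
  have hadm := h.admissible hA
  have hF : Measurable fun p : Env × ℤ => ENNReal.ofReal (f p) :=
    ENNReal.measurable_ofReal.comp f.continuous.measurable
  have hm : ∀ i, Measurable fun p : Env × ℤ => ENNReal.ofReal (historyTermBCF f i p) := fun i =>
    ENNReal.measurable_ofReal.comp (historyTermBCF f i).continuous.measurable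
  rw [lintegral_zetaLaw π 1 hF]
  have hsum : ∫⁻ p, ∫⁻ X, ENNReal.ofReal (f (zeta 1 (p, X))) ∂(quenched p.1 p.2) ∂π =
      ∑' i, ∫⁻ p, ENNReal.ofReal (historyTermBCF f i p) ∂π := by
    rw [← lintegral_tsum fun i => (hm i).aemeasurable]
    refine lintegral_congr_ae ?_
    filter_upwards [hadm.ae_quenched_limsupTop hA] with p hp
    exact lintegral_zeta_one_eq_tsum hf hp
  rw [hsum, ENNReal.tsum_eq_iSup_sum]
  refine iSup_le fun s => ?_
  have hlim : Tendsto (fun m => ∑ i ∈ s, ∫⁻ p, ENNReal.ofReal (historyTermBCF f i p)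
      ∂(cesaro η (φ m))) atTop (𝓝 (∑ i ∈ s, ∫⁻ p, ENNReal.ofReal (historyTermBCF f i p) ∂π)) :=
    tendsto_finsetSum s fun i _ => h.tendsto_lintegral fun p => historyTerm_nonneg hf i p
  have hlim2 : Tendsto (fun m => ∫⁻ p, ENNReal.ofReal (f p) ∂(cesaro η (φ m)) +
      (φ m : ℝ≥0∞)⁻¹ * ENNReal.ofReal ‖f‖) atTop (𝓝 (∫⁻ p, ENNReal.ofReal (f p) ∂π + 0)) := by
    refine (h.tendsto_lintegral hf).add ?_
    have h0 : Tendsto (fun m => (φ m : ℝ≥0∞)⁻¹) atTop (𝓝 0) :=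
      ENNReal.tendsto_inv_nat_nhds_zero.comp h.strictMono.tendsto_atTop
    simpa using ENNReal.Tendsto.mul_const h0 (Or.inr (ENNReal.ofReal_ne_top (r := ‖f‖)))
  rw [add_zero] at hlim2
  refine le_of_tendsto_of_tendsto' hlim hlim2 fun m => ?_
  refine le_trans ?_ (lintegral_zeta_cesaro_le hA (φ m) hF fun p =>
    ENNReal.ofReal_le_ofReal ((le_abs_self _).trans (f.norm_coe_le_norm p)))
  rw [← lintegral_finsetSum _ fun i _ => hm i]
  refine lintegral_mono_ae ?_
  filter_upwards [(admissible_cesaro hA (h.pos m)).ae_quenched_limsupTop hA] with p hp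
  rw [lintegral_zeta_one_eq_tsum hf hp]
  exact ENNReal.sum_le_tsum s

/-- Weak limits of the Cesàro averages are stationary: an inequality between probability measures
is an equality. -/
lemma IsWeakLimit.zetaLaw_eq [IsProbabilityMeasure η] (hA : Assumptions η M μ)
    (h : IsWeakLimit η π φ) : zetaLaw π 1 = π := by
  have := h.prob
  have hle : ∀ f : (Env × ℤ) →ᵇ ℝ, 0 ≤ f → ∫ p, f p ∂(zetaLaw π 1) ≤ ∫ p, f p ∂π := by
    intro f hf
    have h1 := h.lintegral_zetaLaw_le hA hf
    rw [lintegral_ofReal_bcf hf, lintegral_ofReal_bcf hf] at h1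
    exact (ENNReal.ofReal_le_ofReal_iff (integral_nonneg fun p => hf p)).1 h1
  have hle' : ∀ f : (Env × ℤ) →ᵇ ℝ, ∫ p, f p ∂(zetaLaw π 1) ≤ ∫ p, f p ∂π := by
    intro f
    have h1 := hle (f + BoundedContinuousFunction.const _ ‖f‖) fun p => by
      have := neg_le_of_abs_le (f.norm_coe_le_norm p)
      change (0 : ℝ) ≤ f p + ‖f‖
      linarith
    simp only [BoundedContinuousFunction.coe_add, Pi.add_apply,
      BoundedContinuousFunction.const_apply] at h1
    rw [integral_add (f.integrable _) (integrable_const _),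
      integral_add (f.integrable _) (integrable_const _)] at h1
    simpa using h1
  refine ext_of_forall_integral_eq_of_IsFiniteMeasure fun f => le_antisymm (hle' f) ?_
  have h1 := hle' (-f)
  simp only [BoundedContinuousFunction.coe_neg, Pi.neg_apply, integral_neg] at h1
  linarith

/-! ### Tightness of the Cesàro averages -/

lemma measurable_eval_M1 (s : Set ℤ) : Measurable fun ν : M1 => ν s :=
  (continuous_eval_M1 s).measurable

/-- Finite measures on `M₁(ℤ)` are tight: the compact sets are given by bounds on the tails. -/
lemma exists_isCompact_measure_compl_le (κ : Measure M1) [IsFiniteMeasure κ] {ε : ℝ≥0∞}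
    (hε : ε ≠ 0) : ∃ K : Set M1, IsCompact K ∧ κ Kᶜ ≤ ε := by
  obtain ⟨u, -, u_pos, u_lim⟩ :=
    exists_seq_strictAnti_tendsto (0 : NNReal)
  obtain ⟨δ, δ_pos, hδ⟩ := ENNReal.exists_pos_sum_of_countable hε ℕ
  have key : ∀ m, ∃ n : ℕ, κ {ν : M1 | u m < ν (Icc (-(n : ℤ)) n)ᶜ} < δ m := by
    intro m
    have hanti : Antitone fun n : ℕ => {ν : M1 | u m < ν (Icc (-(n : ℤ)) n)ᶜ} := by
      intro a b hab ν hν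
      refine lt_of_lt_of_le (show u m < ν (Icc (-(b : ℤ)) b)ᶜ from hν) ?_
      refine ν.apply_mono (compl_subset_compl.2 (Icc_subset_Icc ?_ ?_)) <;> omega
    have hmeas : ∀ n : ℕ, NullMeasurableSet {ν : M1 | u m < ν (Icc (-(n : ℤ)) n)ᶜ} κ := fun n =>
      (measurableSet_lt measurable_const (measurable_eval_M1 _)).nullMeasurableSet
    have hempty : ⋂ n : ℕ, {ν : M1 | u m < ν (Icc (-(n : ℤ)) n)ᶜ} = ∅ := by
      rw [eq_empty_iff_forall_notMem]
      intro ν hν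
      have hν' : ∀ n : ℕ, u m < ν (Icc (-(n : ℤ)) n)ᶜ := fun n => mem_iInter.1 hν n
      have hlim : Tendsto (fun n : ℕ => (ν : Measure ℤ) (Icc (-(n : ℤ)) n)ᶜ) atTop
          (𝓝 ((ν : Measure ℤ) (⋂ n : ℕ, (Icc (-(n : ℤ)) n)ᶜ))) := by
        refine tendsto_measure_iInter_atTop (fun n => (measurableSet_Icc.compl).nullMeasurableSet)
          (fun a b hab => compl_subset_compl.2 (Icc_subset_Icc ?_ ?_)) ⟨0, measure_ne_top _ _⟩
          <;> omega
      have h0 : ⋂ n : ℕ, (Icc (-(n : ℤ)) n)ᶜ = ∅ := by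
        rw [eq_empty_iff_forall_notMem]
        intro z hz
        have := mem_iInter.1 hz z.natAbs
        simp only [mem_compl_iff, mem_Icc] at this
        omega
      rw [h0, measure_empty] at hlim
      obtain ⟨n, hn⟩ := (hlim.eventually
        (gt_mem_nhds (ENNReal.coe_pos.2 (u_pos m)))).exists
      rw [← ProbabilityMeasure.ennreal_coeFn_eq_coeFn_toMeasure, ENNReal.coe_lt_coe] at hn
      exact absurd (hν' n) (not_lt.2 hn.le)
    have h := tendsto_measure_iInter_atTop hmeas hanti ⟨0, measure_ne_top _ _⟩
    rw [hempty, measure_empty] at h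
    exact (h.eventually (gt_mem_nhds (ENNReal.coe_pos.2 (δ_pos m)))).exists
  choose n hn using key
  refine ⟨{ν : M1 | ∀ m, ν (Icc (-(n m : ℤ)) (n m))ᶜ ≤ u m},
    isCompact_setOfPred_probabilityMeasure_mass_eq_compl_isCompact_le u_lim
      (fun m => (finite_Icc _ _).isCompact) (Or.inl inferInstance), ?_⟩
  calc κ {ν : M1 | ∀ m, ν (Icc (-(n m : ℤ)) (n m))ᶜ ≤ u m}ᶜ
      ≤ κ (⋃ m, {ν : M1 | u m < ν (Icc (-(n m : ℤ)) (n m))ᶜ}) := by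
        refine measure_mono fun ν hν => ?_
        simp only [mem_compl_iff, mem_ofPred_eq, not_forall, not_le] at hν
        exact mem_iUnion.2 hν
    _ ≤ ∑' m, κ {ν : M1 | u m < ν (Icc (-(n m : ℤ)) (n m))ᶜ} := measure_iUnion_le _
    _ ≤ ∑' m, (δ m : ℝ≥0∞) := ENNReal.tsum_le_tsum fun m => (hn m).le
    _ ≤ ε := hδ.le

/-- The environments under admissible laws are uniformly tight, since each cookie is dominated by
the sum of the laws of finitely many cookies under `η`. -/
lemma exists_isCompact_env [IsProbabilityMeasure η] (M : ℕ) {ε : ℝ≥0∞} (hε : ε ≠ 0) :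
    ∃ K : Set Env, IsCompact K ∧ ∀ α, Admissible η M α → α {p | p.1 ∉ K} ≤ ε := by
  obtain ⟨δ, δ_pos, hδ⟩ := ENNReal.exists_pos_sum_of_countable hε (ℤ × ℕ)
  let κ : ℕ → Measure M1 := fun j => ∑ l ∈ Finset.range (M + 1), η.map fun ω : Env => ω 0 (l + j)
  have hm : ∀ i, Measurable fun ω : Env => ω 0 i := fun i => by fun_prop
  have hκ : ∀ j S, MeasurableSet S →
      κ j S = ∑ l ∈ Finset.range (M + 1), η {ω | ω 0 (l + j) ∈ S} := by
    intro j S hS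
    rw [Measure.finsetSum_apply]
    exact Finset.sum_congr rfl fun l _ => Measure.map_apply (hm _) hS
  have hfin : ∀ j, IsFiniteMeasure (κ j) := fun j => by
    refine ⟨?_⟩
    rw [hκ j univ .univ]
    exact ENNReal.sum_lt_top.2 fun l _ => measure_lt_top _ _
  choose K hK hKε using fun i : ℤ × ℕ =>
    exists_isCompact_measure_compl_le (κ i.2) (ENNReal.coe_ne_zero.2 (δ_pos i).ne')
  refine ⟨univ.pi fun y => univ.pi fun j => K (y, j),
    isCompact_univ_pi fun y => isCompact_univ_pi fun j => hK (y, j), fun α hα => ?_⟩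
  calc α {p | p.1 ∉ univ.pi fun y => univ.pi fun j => K (y, j)}
      ≤ α (⋃ i : ℤ × ℕ, {p | p.1 i.1 i.2 ∈ (K i)ᶜ}) := by
        refine measure_mono fun p hp => ?_
        simp only [mem_ofPred_eq, Set.mem_pi, mem_univ, true_imp_iff, not_forall] at hp
        obtain ⟨y, j, h⟩ := hp
        exact mem_iUnion.2 ⟨(y, j), h⟩
    _ ≤ ∑' i : ℤ × ℕ, α {p | p.1 i.1 i.2 ∈ (K i)ᶜ} := measure_iUnion_le _
    _ ≤ ∑' i, (δ i : ℝ≥0∞) := by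
        refine ENNReal.tsum_le_tsum fun i => ?_
        have hS : MeasurableSet (K i)ᶜ := (hK i).isClosed.measurableSet.compl
        refine le_trans ?_ (hKε i)
        rw [hκ _ _ hS]
        exact hα.dominated i.1 {σ | σ i.2 ∈ (K i)ᶜ} (measurable_pi_apply i.2 hS)
    _ ≤ ε := hδ.le

/-- The second coordinate of `ζ_k` is the overshoot over `k`. -/
lemma zetaLaw_le_averaged_overshoot (α : Measure (Env × ℤ)) [SFinite α] (k : ℕ) {s : ℤ}
    (hs : 0 ≤ s) : zetaLaw α k {p | s ≤ p.2} ≤ averaged α (overshoot k s) := by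
  have hm : MeasurableSet {p : Env × ℤ | s ≤ p.2} :=
    measurableSet_le measurable_const measurable_snd
  unfold zetaLaw averaged
  rw [← Measure.snd_compProd, Measure.map_apply (measurable_zeta k) hm,
    Measure.snd_apply (measurableSet_overshoot k s)]
  refine measure_mono fun q hq => ?_
  have hq' : s ≤ q.2 (hitAbove q.2 k) - k := hq
  obtain ⟨n, hn⟩ := exists_firstEntrance (X := q.2) (k := k) ⟨hitAbove q.2 k, by omega⟩
  rw [hitAbove_eq hn] at hq'
  exact ⟨n, hn, by omega⟩

lemma exists_zetaLaw_snd_le [IsProbabilityMeasure η] (hA : Assumptions η M μ) {ε : ℝ≥0∞}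
    (hε : ε ≠ 0) : ∃ s : ℕ, ∀ k, zetaLaw (fromZero η) k {p | (s : ℤ) ≤ p.2} ≤ ε := by
  obtain ⟨B, hB⟩ := hA.exists_bound
  obtain ⟨s, hs, hsε⟩ := exists_excess_lt hA (pos_iff_ne_zero.2 hε) (B + 1)
  refine ⟨s, fun k => ?_⟩
  have h0 : fromZero η {p | (k : ℤ) + s ≤ p.2} = 0 := by
    have hm : MeasurableSet {p : Env × ℤ | (k : ℤ) + s ≤ p.2} :=
      measurableSet_le measurable_const measurable_snd
    have hm' : Measurable fun ω : Env => ((ω, 0) : Env × ℤ) := by fun_prop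
    rw [fromZero_eq_map, Measure.map_apply hm' hm]
    have : (fun ω : Env => ((ω, 0) : Env × ℤ)) ⁻¹' {p | (k : ℤ) + s ≤ p.2} = ∅ := by
      refine eq_empty_iff_forall_notMem.2 fun ω hω => ?_
      have hω' : (k : ℤ) + s ≤ 0 := hω
      omega
    rw [this, measure_empty]
  calc zetaLaw (fromZero η) k {p | (s : ℤ) ≤ p.2}
      ≤ averaged (fromZero η) (overshoot k s) := zetaLaw_le_averaged_overshoot _ k (by omega)
    _ ≤ fromZero η {p | (k : ℤ) + s ≤ p.2} + excess η M s :=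
        (admissible_fromZero hA.isIID).averaged_overshoot_le hA hB k (by omega)
    _ ≤ ε := by rw [h0, zero_add]; exact hsε.le

/-- Tightness: compactness for the environments comes from domination, and for the second
coordinate from the bound on the overshoots. -/
lemma exists_isCompact_cesaro [IsProbabilityMeasure η] (hA : Assumptions η M μ) {ε : ℝ≥0∞}
    (hε : ε ≠ 0) : ∃ K : Set (Env × ℤ), IsCompact K ∧ ∀ n, 0 < n → cesaro η n Kᶜ ≤ ε := by
  have hε2 : ε / 2 ≠ 0 := (ENNReal.half_pos hε).ne'
  obtain ⟨K, hK, hKε⟩ := exists_isCompact_env (η := η) M hε2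
  obtain ⟨s, hs⟩ := exists_zetaLaw_snd_le hA hε2
  refine ⟨K ×ˢ Icc 0 (s : ℤ), hK.prod (finite_Icc _ _).isCompact, fun n hn => ?_⟩
  have hadm := admissible_cesaro hA hn
  have h0 : cesaro η n {p | ¬ 0 ≤ p.2} = 0 := hadm.nonneg
  calc cesaro η n (K ×ˢ Icc 0 (s : ℤ))ᶜ
      ≤ cesaro η n ({p | ¬ 0 ≤ p.2} ∪ ({p | p.1 ∉ K} ∪ {p | (s : ℤ) ≤ p.2})) := by
        refine measure_mono fun p hp => ?_
        simp only [mem_compl_iff, mem_prod, mem_Icc, not_and, not_le] at hp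
        simp only [mem_union, mem_ofPred_eq]
        by_cases h1 : 0 ≤ p.2
        · by_cases h2 : p.1 ∈ K
          · exact Or.inr (Or.inr (hp h2 h1).le)
          · exact Or.inr (Or.inl h2)
        · exact Or.inl h1
    _ ≤ cesaro η n {p | ¬ 0 ≤ p.2} + (cesaro η n {p | p.1 ∉ K} + cesaro η n {p | (s : ℤ) ≤ p.2}) :=
        (measure_union_le _ _).trans (add_le_add le_rfl (measure_union_le _ _))
    _ ≤ 0 + (ε / 2 + ε / 2) := by
        refine add_le_add h0.le (add_le_add (hKε _ hadm) ?_)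
        rw [cesaro_apply]
        exact inv_mul_sum_le hs
    _ = ε := by rw [zero_add, ENNReal.add_halves]

/-- Prokhorov's theorem yields convergent subsequences of the Cesàro averages. -/
lemma exists_isWeakLimit [IsProbabilityMeasure η] (hA : Assumptions η M μ) :
    ∃ π φ, IsWeakLimit η π φ := by
  let ν : ℕ → ProbabilityMeasure (Env × ℤ) := fun n =>
    ⟨cesaro η (n + 1), ⟨cesaro_univ n.succ_pos⟩⟩
  have htight : IsTightMeasureSet {((ρ : ProbabilityMeasure (Env × ℤ)) : Measure (Env × ℤ)) |
      ρ ∈ range ν} := by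
    rw [isTightMeasureSet_iff_exists_isCompact_measure_compl_le]
    intro ε hε
    obtain ⟨K, hK, h⟩ := exists_isCompact_cesaro hA hε.ne'
    refine ⟨K, hK, ?_⟩
    rintro _ ⟨_, ⟨n, rfl⟩, rfl⟩
    exact h (n + 1) n.succ_pos
  obtain ⟨π, -, φ, hφ, hlim⟩ := (isCompact_closure_of_isTightMeasureSet htight).tendsto_subseq
    fun n => subset_closure (mem_range_self n)
  refine ⟨π, fun m => φ m + 1, inferInstance, fun a b hab => Nat.succ_lt_succ (hφ hab),
    fun m => Nat.succ_pos _, fun f => ?_⟩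
  exact ProbabilityMeasure.tendsto_iff_forall_integral_tendsto.1 hlim f

lemma IsWeakLimit.isCesaroLimit [IsProbabilityMeasure η] (hA : Assumptions η M μ)
    {π : Measure (Env × ℤ)} {φ : ℕ → ℕ} (h : IsWeakLimit η π φ) : IsCesaroLimit η π where
  prob := h.prob
  mem_stateSpace := (h.admissible hA).ae_mem_stateSpace hA
  weak_limit := ⟨φ, h.strictMono, h.tendsto⟩

lemma IsCesaroLimit.exists_isWeakLimit {π : Measure (Env × ℤ)} (hπ : IsCesaroLimit η π) :
    ∃ φ, IsWeakLimit η π φ := by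
  obtain ⟨φ, h1, h2, h3⟩ := hπ.exists_subseq
  exact ⟨φ, hπ.prob, h1, h2, h3⟩

end ExcitedWalk

end

theorem proposition5p1 (η : Measure Env) [IsProbabilityMeasure η] (M : ℕ) (μ : M1)
    (hη : Assumptions η M μ) :
    -- the zero-one law under `ℙ_η`
    ((averaged (fromZero η)).real transientRight
        = 1 - (averaged (fromZero η)).real recurrent ∧
      (averaged (fromZero η)).real transientRight ∈ ({0, 1} : Set ℝ)) ∧
    -- the Cesàro averages of the cookie environment process have a limit point on `Ψ` …
    (∃ π : Measure (Env × ℤ), IsCesaroLimit η π) ∧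
    -- … and every limit point is stationary and satisfies the zero-one law
    ∀ π : Measure (Env × ℤ), IsCesaroLimit η π →
      IsStationaryLaw π ∧
      (averaged π).real transientRight = 1 - (averaged π).real recurrent ∧
      (averaged π).real transientRight ∈ ({0, 1} : Set ℝ) := by
  refine ⟨(admissible_fromZero hη.isIID).zero_one hη, ?_, fun π hπ => ?_⟩
  · obtain ⟨π, φ, h⟩ := exists_isWeakLimit hη
    exact ⟨π, h.isCesaroLimit hη⟩
  · obtain ⟨φ, h⟩ := hπ.exists_isWeakLimit
    exact ⟨⟨hπ.prob, hπ.mem_stateSpace, h.zetaLaw_eq hη⟩, (h.admissible hη).zero_one hη⟩
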